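/- Let $\partial=\partial_x$ and let $\mathcal S$ be the space of smooth functions $u(x,y)$ on $\mathbb R^2$ all of whose partial derivatives decay faster than every power of $|x|$ as $x\to-\infty$, uniformly for $y$ in bounded sets (it contains the Schwartz functions, and $\partial$ is invertible on it, $\partial^{-1}f(x,y)=\int_{-\infty}^x f(s,y)\,\mathrm ds$). Pseudo-differential operators $\sum_{k\le N}c_k\partial^k$ have smooth coefficients $c_k(x,y)$ and are composed by $\partial^sf=\sum_{i\ge0}\binom si(\partial^if)\partial^{s-i}$, $s\in\mathbb Z$; $P_+$ is the part with $k\ge0$, and $P_y$ is the coefficientwise derivative. For maps $f,g:\mathcal S\to\mathcal S$ put $f'[g](u)=\frac{d}{d\varepsilon}f(u+\varepsilon g(u))|_{\varepsilon=0}$ and $[\![f,g]\!]=f'[g]-g'[f]$; Gâteaux derivatives of operator-valued maps are taken coefficientwise. Put $A_2=\partial^2+2u$. **Theorem.** (1) There is exactly one map $u\mapsto L=\partial+u\,\partial^{-1}+u_3\partial^{-2}+u_4\partial^{-3}+\cdots$ on $\mathcal S$ with all $u_j\in\mathcal S$ and $L_y=[A_2,L]$. (2) For each $m\ge1$ there is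 exactly one pair consisting of a map $K_m:\mathcal S\to\mathcal S$ and an operator $A_m=\partial^m+\sum_{j=1}^m a_j\partial^{m-j}$, depending on $u\in\mathcal S$, such that $A_m|_{u=0}=\partial^m$, the coefficients of $A_m-\partial^m$ lie in $\mathcal S$, and the Lax triad $L\phi=\eta\phi$, $\phi_y=A_2\phi$, $\phi_{t_m}=A_m\phi$, $\eta_{t_m}=0$ is compatible along $u_{t_m}=K_m(u)$, i.e. $$L_y=[A_2,L],\qquad L'[K_m]=[A_m,L],\qquad A_2'[K_m]-A_{m,y}+[A_2,A_m]=0 .$$ Moreover $A_m=(L^m)_+$. (3) For each $m\ge1$ there is exactly one pair consisting of a map $\sigma_m:\mathcal S\to\mathcal S$ and an operator $B_m=\sum_{j=0}^m b_j\partial^{m-j}$, depending on $u\in\mathcal S$, such that $B_m|_{u=0}=2y\partial^m+x\partial^{m-1}$, the coefficients of $B_m-2y\partial^m-x\partial^{m-1}$ lie in $\mathcal S$, and the Lax triad $L\phi=\eta\phi$, $\phi_y=A_2\phi$, $\phi_{t_m}=B_m\phi$, $\eta_{t_m}=\eta^{m-1}$ is compatible along $u_{t_m}=\sigma_m(u)$,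 i.e. $$L_y=[A_2,L],\qquad L'[\sigma_m]=[B_m,L]+L^{m-1},\qquad A_2'[\sigma_m]-B_{m,y}+[A_2,B_m]=0 .$$ (4) These flows have the zero-curvature representations $K_m=\tfrac12(A_{m,y}-[A_2,A_m])$ and $\sigma_m=\tfrac12(B_{m,y}-[A_2,B_m])$, with $K_m|_{u=0}=\sigma_m|_{u=0}=0$. (5) Put $K_0=\sigma_0=0$. For all $l,r\ge1$, $$[\![K_l,K_r]\!]=0,\qquad [\![K_l,\sigma_r]\!]=l\,K_{l+r-2},\qquad [\![\sigma_l,\sigma_r]\!]=(l-r)\,\sigma_{l+r-2},$$ and the real linear span of $\{K_l\}_{l\ge1}\cup\{\sigma_r\}_{r\ge1}$ is closed under $[\![\cdot,\cdot]\!]$ and is a Lie algebra with this product. (All Gâteaux derivatives involved exist and lie in $\mathcal S$.) -/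

import Mathlib

open scoped ContDiff

noncomputable section

namespace KP

/-- Real-valued smooth functions of `(x, y)`. -/
def SmoothFn : Subalgebra ℝ (ℝ × ℝ → ℝ) where
  carrier := {f | ContDiff ℝ ∞ f}
  mul_mem' := by
    intro f g hf hg
    exact ContDiff.mul (Set.mem_ofPred_eq ▸ hf) (Set.mem_ofPred_eq ▸ hg)
  add_mem' := by
    intro f g hf hg
    exact ContDiff.add (Set.mem_ofPred_eq ▸ hf) (Set.mem_ofPred_eq ▸ hg)
  algebraMap_mem' := by
    intro c
    change ContDiff ℝ ∞ (fun _ : ℝ × ℝ => c)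
    exact contDiff_const

theorem contDiff_coe (f : SmoothFn) : ContDiff ℝ ∞ f.1 := f.2

/-- Directional derivative along `v`, on smooth functions. -/
def dirDeriv (v : ℝ × ℝ) : SmoothFn →ₗ[ℝ] SmoothFn where
  toFun f := ⟨fun p => fderiv ℝ f.1 p v, by
    change ContDiff ℝ ∞ (fun p => fderiv ℝ f.1 p v)
    exact (ContDiff.fderiv_right (m := ∞) (contDiff_coe f) (by simp)).clm_apply contDiff_const⟩
  map_add' f g := by
    apply Subtype.ext
    funext p
    have hf : DifferentiableAt ℝ f.1 p := (contDiff_coe f).differentiable (by simp) p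
    have hg : DifferentiableAt ℝ g.1 p := (contDiff_coe g).differentiable (by simp) p
    change fderiv ℝ (f.1 + g.1) p v = fderiv ℝ f.1 p v + fderiv ℝ g.1 p v
    rw [fderiv_add hf hg]
    rfl
  map_smul' c f := by
    apply Subtype.ext
    funext p
    have hf : DifferentiableAt ℝ f.1 p := (contDiff_coe f).differentiable (by simp) p
    change fderiv ℝ (c • f.1) p v = c * fderiv ℝ f.1 p v
    rw [fderiv_const_smul hf]
    rfl

/-- `∂/∂x` on smooth functions. -/
def Dx : SmoothFn →ₗ[ℝ] SmoothFn := dirDeriv (1, 0)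

/-- `∂/∂y` on smooth functions. -/
def Dy : SmoothFn →ₗ[ℝ] SmoothFn := dirDeriv (0, 1)

/-- The coordinate function `x`. -/
def xFn : SmoothFn := ⟨fun p => p.1, show ContDiff ℝ ∞ _ from contDiff_fst⟩

/-- The coordinate function `y`. -/
def yFn : SmoothFn := ⟨fun p => p.2, show ContDiff ℝ ∞ _ from contDiff_snd⟩

/-- The space of rapidly decreasing functions: smooth functions all of whose partial derivatives
decay faster than every power of `|x|` as `x → -∞`, uniformly for `y` in bounded sets.  It contains
the Schwartz functions, and (unlike the Schwartz space) it is stable under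
`∂⁻¹ f (x, y) = ∫_{-∞}^x f (s, y) ds`, which inverts `∂ = ∂/∂x` on it. -/
def RapidDecay : Submodule ℝ SmoothFn where
  carrier := {f | ∀ i j k : ℕ, ∀ R : ℝ, ∃ C : ℝ, ∀ x y : ℝ, x ≤ 0 → |y| ≤ R →
    |x| ^ k * |((Dx ^ i) ((Dy ^ j) f)).1 (x, y)| ≤ C}
  zero_mem' := by
    intro i j k R
    refine ⟨0, fun x y _ _ => ?_⟩
    simp
  add_mem' := by
    intro f g hf hg i j k R
    obtain ⟨C, hC⟩ := hf i j k R
    obtain ⟨C', hC'⟩ := hg i j k R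
    refine ⟨C + C', fun x y hx hy => ?_⟩
    have h1 := hC x y hx hy
    have h2 := hC' x y hx hy
    rw [map_add, map_add]
    change |x| ^ k * |((Dx ^ i) ((Dy ^ j) f)).1 (x, y) + ((Dx ^ i) ((Dy ^ j) g)).1 (x, y)| ≤ _
    calc _ ≤ |x| ^ k * (|((Dx ^ i) ((Dy ^ j) f)).1 (x, y)| + |((Dx ^ i) ((Dy ^ j) g)).1 (x, y)|) := by
          gcongr
          exact abs_add_le _ _
      _ ≤ C + C' := by rw [mul_add]; exact add_le_add h1 h2
  smul_mem' := by
    intro c f hf i j k R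
    obtain ⟨C, hC⟩ := hf i j k R
    refine ⟨|c| * C, fun x y hx hy => ?_⟩
    have h1 := hC x y hx hy
    rw [map_smul, map_smul]
    change |x| ^ k * |c * ((Dx ^ i) ((Dy ^ j) f)).1 (x, y)| ≤ _
    rw [abs_mul, mul_left_comm]
    exact mul_le_mul_of_nonneg_left h1 (abs_nonneg c)

/-- Pseudo-differential operators `∑_{k ≤ N} c_k ∂^k` (formal in `∂⁻¹`), with smooth coefficients. -/
@[ext] structure PDO where
  coeff : ℤ → SmoothFn
  bdd : ∃ N : ℤ, ∀ k, N < k → coeff k = 0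

namespace PDO

/-- The operator `a ∂^k`. -/
def monomial (a : SmoothFn) (k : ℤ) : PDO where
  coeff j := if j = k then a else 0
  bdd := ⟨k, fun j hj => if_neg (by omega)⟩

instance : Inhabited PDO := ⟨monomial 0 0⟩

instance : Add PDO where
  add P Q :=
    { coeff := fun k => P.coeff k + Q.coeff k
      bdd := by
        obtain ⟨N, hN⟩ := P.bdd
        obtain ⟨M, hM⟩ := Q.bdd
        exact ⟨max N M, fun k hk => by
          rw [hN k (lt_of_le_of_lt (le_max_left _ _) hk),
            hM k (lt_of_le_of_lt (le_max_right _ _) hk), add_zero]⟩ }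

instance : Sub PDO where
  sub P Q :=
    { coeff := fun k => P.coeff k - Q.coeff k
      bdd := by
        obtain ⟨N, hN⟩ := P.bdd
        obtain ⟨M, hM⟩ := Q.bdd
        exact ⟨max N M, fun k hk => by
          rw [hN k (lt_of_le_of_lt (le_max_left _ _) hk),
            hM k (lt_of_le_of_lt (le_max_right _ _) hk), sub_zero]⟩ }

/-- The term `C(m, i) a_m (∂ⁱ b_n)`, `n = k - m + i`, contributing to the coefficient of `∂^k`
in `(∑ a_m ∂^m) (∑ b_n ∂^n)`; here `q = (m, i)`. -/
def mulTerm (P Q : PDO) (k : ℤ) (q : ℤ × ℕ) : SmoothFn :=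
  Ring.choose q.1 q.2 • (P.coeff q.1 * (Dx ^ q.2) (Q.coeff (k - q.1 + q.2)))

theorem mulTerm_eq_zero {P Q : PDO} {N M : ℤ} (hN : ∀ k, N < k → P.coeff k = 0)
    (hM : ∀ k, M < k → Q.coeff k = 0) (k : ℤ) (q : ℤ × ℕ)
    (h : N < q.1 ∨ M < k - q.1 + q.2) : mulTerm P Q k q = 0 := by
  rcases h with h | h
  · simp [mulTerm, hN _ h]
  · simp [mulTerm, hM _ h]

/-- Only finitely many terms contribute to each coefficient of a product. -/
theorem mulTerm_support_finite (P Q : PDO) (k : ℤ) : (Function.support (mulTerm P Q k)).Finite := by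
  obtain ⟨N, hN⟩ := P.bdd
  obtain ⟨M, hM⟩ := Q.bdd
  refine ((Set.finite_Icc (k - M) N).prod (Set.finite_Iic (M - k + N).toNat)).subset ?_
  rintro ⟨m, i⟩ hq
  have h : ¬ (N < m ∨ M < k - m + (i : ℤ)) := fun h => hq (mulTerm_eq_zero hN hM k (m, i) h)
  simp only [Set.mem_prod, Set.mem_Icc, Set.mem_Iic]
  omega

/-- Composition, given by the Leibniz rule `∂^s f = ∑_{i ≥ 0} C(s, i) (∂ⁱ f) ∂^{s - i}`, `s ∈ ℤ`. -/
instance : Mul PDO where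
  mul P Q :=
    { coeff := fun k => ∑ᶠ q : ℤ × ℕ, mulTerm P Q k q
      bdd := by
        obtain ⟨N, hN⟩ := P.bdd
        obtain ⟨M, hM⟩ := Q.bdd
        refine ⟨N + M, fun k hk => ?_⟩
        rw [finsum_congr (g := fun _ => 0), finsum_zero]
        exact fun q => mulTerm_eq_zero hN hM k q (by omega) }

/-- Powers `P ^ m`. -/
def pow (P : PDO) : ℕ → PDO
  | 0 => monomial 1 0
  | m + 1 => pow P m * P

/-- The commutator `[P, Q] = P Q - Q P`. -/
def comm (P Q : PDO) : PDO := P * Q - Q * P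

/-- The derivative `P_y`, taken on the coefficients. -/
def dy (P : PDO) : PDO where
  coeff k := Dy (P.coeff k)
  bdd := by
    obtain ⟨N, hN⟩ := P.bdd
    exact ⟨N, fun k hk => by rw [hN k hk, map_zero]⟩

/-- The differential part `P_+`. -/
def pos (P : PDO) : PDO where
  coeff k := if 0 ≤ k then P.coeff k else 0
  bdd := by
    obtain ⟨N, hN⟩ := P.bdd
    exact ⟨N, fun k hk => by rw [hN k hk, ite_self]⟩

end PDO

open PDO

/-- `F'[g] = P` at `u`, where `F'[g] = d/dε F(u + ε g) |_{ε = 0}`, for an operator-valued `F`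
(coefficientwise). -/
def HasOpGateaux (F : RapidDecay → PDO) (u g : RapidDecay) (P : PDO) : Prop :=
  ∀ (k : ℤ) (p : ℝ × ℝ),
    HasDerivAt (fun ε : ℝ => ((F (u + ε • g)).coeff k).1 p) ((P.coeff k).1 p) 0

/-- `f'[g] = a` at `u`, where `f'[g] = d/dε f(u + ε g) |_{ε = 0}`, for a function-valued `f`. -/
def HasGateaux (f : RapidDecay → RapidDecay) (u g a : RapidDecay) : Prop :=
  ∀ p : ℝ × ℝ, HasDerivAt (fun ε : ℝ => (f (u + ε • g)).1.1 p) (a.1.1 p) 0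

/-- `h = ⟦f, g⟧`, i.e. `h = f'[g] - g'[f]` (both Gateaux derivatives existing). -/
def IsLieProduct (f g h : RapidDecay → RapidDecay) : Prop :=
  ∀ u, ∃ a b, HasGateaux f u (g u) a ∧ HasGateaux g u (f u) b ∧ h u = a - b

/-- `A₂ = ∂² + 2 u`. -/
def A₂ (u : RapidDecay) : PDO := monomial 1 2 + monomial ((2 : ℝ) • u.1) 0

/-- `L = ∂ + u₂ ∂⁻¹ + u₃ ∂⁻² + ⋯` as a function of `u = u₂`: every `u_j` is rapidly decreasing, and
`u₃, u₄, …` are expressed through `u` by `L_y = [A₂, L]`. -/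
structure IsLaxOperator (L : RapidDecay → PDO) : Prop where
  coeff_of_gt : ∀ u k, 1 < k → (L u).coeff k = 0
  coeff_one : ∀ u, (L u).coeff 1 = 1
  coeff_zero : ∀ u, (L u).coeff 0 = 0
  coeff_neg_one : ∀ u, (L u).coeff (-1) = u.1
  coeff_neg : ∀ u k, k < 0 → (L u).coeff k ∈ RapidDecay
  compat_y : ∀ u, (L u).dy = comm (A₂ u) (L u)

/-- `A` is, for every `u`, a differential operator `∑_{j=0}^m a_j ∂^{m-j}` with asymptotic data
`A|_{u=0} = A0`, and the coefficients of `A - A0` are rapidly decreasing. -/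
structure HasAsymptotics (m : ℕ) (A : RapidDecay → PDO) (A0 : PDO) : Prop where
  coeff_eq_zero : ∀ u k, k < 0 ∨ (m : ℤ) < k → (A u).coeff k = 0
  at_zero : A 0 = A0
  sub_mem : ∀ u k, (A u).coeff k - A0.coeff k ∈ RapidDecay

/-- Compatibility of the isospectral Lax triad `L φ = η φ`, `φ_y = A₂ φ`, `φ_t = A φ`, `η_t = 0`
along the evolution `u_t = K(u)` (so that `F_t = F'[K]`), with `A = ∂^m + ∑_{j=1}^m a_j ∂^{m-j}` and
`A|_{u=0} = ∂^m`. -/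
structure IsIsospectralTriad (m : ℕ) (L A : RapidDecay → PDO) (K : RapidDecay → RapidDecay) :
    Prop where
  asymptotics : HasAsymptotics m A (monomial 1 m)
  leading : ∀ u, (A u).coeff m = 1
  compat_y : ∀ u, (L u).dy = comm (A₂ u) (L u)
  compat_t : ∀ u, HasOpGateaux L u (K u) (comm (A u) (L u))
  compat_yt : ∀ u, HasOpGateaux A₂ u (K u) ((A u).dy - comm (A₂ u) (A u))

/-- The asymptotic operator `2 y ∂^m + x ∂^{m-1}`. -/
def nonisoAsymp (m : ℕ) : PDO := monomial ((2 : ℝ) • yFn) m + monomial xFn ((m : ℤ) - 1)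

/-- Compatibility of the non-isospectral Lax triad `L φ = η φ`, `φ_y = A₂ φ`, `φ_t = B φ`,
`η_t = η^{m-1}` along the evolution `u_t = σ(u)`, with `B = ∑_{j=0}^m b_j ∂^{m-j}` and
`B|_{u=0} = 2 y ∂^m + x ∂^{m-1}`. -/
structure IsNonisospectralTriad (m : ℕ) (L B : RapidDecay → PDO) (σ : RapidDecay → RapidDecay) :
    Prop where
  asymptotics : HasAsymptotics m B (nonisoAsymp m)
  compat_y : ∀ u, (L u).dy = comm (A₂ u) (L u)
  compat_t : ∀ u, HasOpGateaux L u (σ u) (comm (B u) (L u) + (L u).pow (m - 1))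
  compat_yt : ∀ u, HasOpGateaux A₂ u (σ u) ((B u).dy - comm (A₂ u) (B u))

/-- The pseudo-differential operator `L`, as a function of `u`. -/
def laxL : RapidDecay → PDO := Classical.epsilon IsLaxOperator

/-- The solution `(A_m, K_m)` of the isospectral triad. -/
def isoTriad (m : ℕ) : (RapidDecay → PDO) × (RapidDecay → RapidDecay) :=
  Classical.epsilon fun q => IsIsospectralTriad m laxL q.1 q.2

/-- The solution `(B_m, σ_m)` of the non-isospectral triad. -/
def nonisoTriad (m : ℕ) : (RapidDecay → PDO) × (RapidDecay → RapidDecay) :=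
  Classical.epsilon fun q => IsNonisospectralTriad m laxL q.1 q.2

/-- The operators `A_m`, `m ≥ 1`. -/
def opA (m : ℕ) : RapidDecay → PDO := (isoTriad m).1

/-- The operators `B_m`, `m ≥ 1`. -/
def opB (m : ℕ) : RapidDecay → PDO := (nonisoTriad m).1

/-- The isospectral flows `K_m`, `m ≥ 1`, with `K_0 = 0`. -/
def flowK (m : ℕ) : RapidDecay → RapidDecay := if m = 0 then 0 else (isoTriad m).2

/-- The non-isospectral flows `σ_m`, `m ≥ 1`, with `σ_0 = 0`. -/
def flowσ (m : ℕ) : RapidDecay → RapidDecay := if m = 0 then 0 else (nonisoTriad m).2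

/-- The real linear space spanned by all the flows `K_l`, `σ_r`. -/
def flowSpan : Submodule ℝ (RapidDecay → RapidDecay) :=
  Submodule.span ℝ ({f | ∃ l, 1 ≤ l ∧ f = flowK l} ∪ {f | ∃ r, 1 ≤ r ∧ f = flowσ r})

end KP

end

noncomputable section

namespace KP

open PDO

/-! Everything rests on the derivation ∇P = P_y - [A₂, P] (`nabla`). Since [∂², P] = 2 P_x ∂ + P_xx,
it sends an operator of order N with leading coefficient c to one of order N + 1 with coefficient -2
c_x there. As ∂ is bijective on rapidly decreasing functions (`DxEquiv`), two facts follow by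
working down the orders. First, ∇ is injective on operators with decaying coefficients, and a
decaying differential operator P with ∇P of order at most 0 vanishes (`eq_zero_of_nabla_eq_zero`,
`eq_zero_of_mem_diffOp`). Second, ∇P = R can be solved for decaying R (`nabla_solution`). Operators
killed by ∇ are therefore determined by their asymptotic values, and identities between them need
checking only on those values.

Solving ∇ = 0 with asymptotic value ∂ gives L, and with x + 2y∂ gives the Orlov–Schulman operator M.
From [∂, x + 2y∂] = 1 follows [L, M] = 1. For Z = L^m or Z = M L^(m-1), ∇Z = 0 gives ∇(Z_+) = -∇(Z -
Z_+). The left side is a differential operator and the right side has order at most 0, so both equal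
a function 2φ (`IsDressing.exists_isFlowPair`). This φ is K_m or σ_m. Uniqueness of the triads is
the vanishing statement again (`IsFlowPair.unique`). The Lax equations hold because both sides have
the same image under ∇ (`hasOpGateaux_laxL`).

The coefficients of the solution come from those of A₂ by sums, products and linear maps, so along a
line u + εg they are polynomials in ε. This gives all Gâteaux derivatives and puts them in the right
spaces (`HasPolyDeriv.mem`).

For flows φ₁, φ₂, φ₃ with operators X₁, X₂, X₃, whose asymptotic values satisfy [Y₁, Y₂] = c Y₃, the
operator X₁'[φ₂] - X₂'[φ₁] + [X₁, X₂] - c X₃ is differential and decaying, and its ∇ is the function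
2(⟦φ₁, φ₂⟧ - c φ₃). Hence both vanish (`IsFlowPair.isLieProduct`), and the structure constants are
those of ∂^l and (x + 2y∂)∂^(r-1). The Jacobi identity is then verified from the structure
constants, which avoids second Gâteaux derivatives. -/

/-! ### Partial derivatives of smooth functions. -/

theorem dirDeriv_mul (v : ℝ × ℝ) (f g : SmoothFn) :
    dirDeriv v (f * g) = dirDeriv v f * g + f * dirDeriv v g := by
  apply Subtype.ext
  funext p
  have hf : DifferentiableAt ℝ f.1 p := (contDiff_coe f).differentiable (by simp) p
  have hg : DifferentiableAt ℝ g.1 p := (contDiff_coe g).differentiable (by simp) p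
  change fderiv ℝ (f.1 * g.1) p v = fderiv ℝ f.1 p v * g.1 p + f.1 p * fderiv ℝ g.1 p v
  rw [fderiv_mul hf hg]
  simp only [add_apply, smul_apply, smul_eq_mul]
  ring

theorem dirDeriv_comm (v w : ℝ × ℝ) (f : SmoothFn) :
    dirDeriv v (dirDeriv w f) = dirDeriv w (dirDeriv v f) := by
  apply Subtype.ext
  funext p
  have hd : DifferentiableAt ℝ (fderiv ℝ f.1) p :=
    ((ContDiff.fderiv_right (m := ∞) (contDiff_coe f) (by simp)).differentiable (by simp)) p
  have key : ∀ a b : ℝ × ℝ, fderiv ℝ (fun q => fderiv ℝ f.1 q a) p b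
      = fderiv ℝ (fderiv ℝ f.1) p b a := by
    intro a b
    rw [fderiv_clm_apply hd (differentiableAt_const _)]
    simp
  change fderiv ℝ (fun q => fderiv ℝ f.1 q w) p v = fderiv ℝ (fun q => fderiv ℝ f.1 q v) p w
  rw [key, key]
  exact ((contDiff_coe f).contDiffAt.isSymmSndFDerivAt (by
    simp only [minSmoothness_of_isRCLikeNormedField]; exact WithTop.coe_le_coe.2 le_top)) v w

theorem Dx_mul (f g : SmoothFn) : Dx (f * g) = Dx f * g + f * Dx g := dirDeriv_mul _ f g

theorem Dy_mul (f g : SmoothFn) : Dy (f * g) = Dy f * g + f * Dy g := dirDeriv_mul _ f g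

theorem Dx_Dy (f : SmoothFn) : Dx (Dy f) = Dy (Dx f) := dirDeriv_comm _ _ f

theorem Dx_pow_Dy (i : ℕ) (f : SmoothFn) : (Dx ^ i) (Dy f) = Dy ((Dx ^ i) f) := by
  have h : Commute Dx Dy := LinearMap.ext Dx_Dy
  exact LinearMap.congr_fun (h.pow_left i) f

theorem Dx_one : Dx 1 = 0 := by
  have h := Dx_mul 1 1
  simpa using h

theorem Dy_one : Dy 1 = 0 := by
  have h := Dy_mul 1 1
  simpa using h

theorem Dx_pow_one (i : ℕ) (hi : i ≠ 0) : (Dx ^ i) 1 = 0 := by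
  obtain ⟨j, rfl⟩ := Nat.exists_eq_succ_of_ne_zero hi
  rw [Nat.succ_eq_add_one, pow_succ, Module.End.mul_apply, Dx_one, map_zero]

/-- The iterated Leibniz rule. -/
theorem Dx_pow_mul (n : ℕ) (f g : SmoothFn) :
    (Dx ^ n) (f * g) = ∑ q ∈ Finset.HasAntidiagonal.antidiagonal n,
      n.choose q.1 • ((Dx ^ q.1) f * (Dx ^ q.2) g) := by
  induction n with
  | zero => simp
  | succ n ih =>
    rw [Finset.sum_antidiagonal_choose_succ_nsmul
      (fun i j => (Dx ^ i) f * (Dx ^ j) g), pow_succ', Module.End.mul_apply, ih, map_sum,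
      ← Finset.sum_add_distrib]
    refine Finset.sum_congr rfl fun q hq => ?_
    have hc : n.choose q.2 = n.choose q.1 :=
      Nat.choose_symm_of_eq_add (by rw [Finset.HasAntidiagonal.mem_antidiagonal] at hq; omega)
    rw [map_nsmul, Dx_mul, smul_add, ← Module.End.mul_apply, ← Module.End.mul_apply,
      ← pow_succ', ← pow_succ', add_comm]
    simp only [hc]

/-! ### The ring of pseudo-differential operators. -/

namespace PDO

theorem coeff_injective : Function.Injective PDO.coeff := fun _ _ h => PDO.ext h

instance : Zero PDO := ⟨⟨0, 0, fun _ _ => rfl⟩⟩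

instance : Neg PDO where
  neg P :=
    { coeff := fun k => - P.coeff k
      bdd := by
        obtain ⟨N, hN⟩ := P.bdd
        exact ⟨N, fun k hk => by rw [hN k hk, neg_zero]⟩ }

/-- Generic in the scalars, so that one instance supplies the ℕ-, ℤ- and ℝ-actions needed to pull
the module structure back along `coeff_injective`. -/
instance smulOf {α : Type*} [SMulZeroClass α SmoothFn] : SMul α PDO where
  smul c P :=
    { coeff := fun k => c • P.coeff k
      bdd := by
        obtain ⟨N, hN⟩ := P.bdd
        exact ⟨N, fun k hk => by rw [hN k hk, smul_zero]⟩ }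

instance : AddCommGroup PDO :=
  coeff_injective.addCommGroup PDO.coeff rfl (fun _ _ => rfl) (fun _ => rfl) (fun _ _ => rfl)
    (fun _ _ => rfl) (fun _ _ => rfl)

/-- The coefficients, as an additive map. -/
def coeffHom : PDO →+ (ℤ → SmoothFn) where
  toFun := PDO.coeff
  map_zero' := rfl
  map_add' _ _ := rfl

instance : Module ℝ PDO :=
  coeff_injective.module ℝ coeffHom (fun _ _ => rfl)

@[simp] theorem coeff_zero (k : ℤ) : (0 : PDO).coeff k = 0 := rfl
@[simp] theorem coeff_add (P Q : PDO) (k : ℤ) : (P + Q).coeff k = P.coeff k + Q.coeff k := rfl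
@[simp] theorem coeff_sub (P Q : PDO) (k : ℤ) : (P - Q).coeff k = P.coeff k - Q.coeff k := rfl
@[simp] theorem coeff_neg (P : PDO) (k : ℤ) : (-P).coeff k = -P.coeff k := rfl
@[simp] theorem coeff_smul (c : ℝ) (P : PDO) (k : ℤ) : (c • P).coeff k = c • P.coeff k := rfl

theorem coeff_sum {ι : Type*} (s : Finset ι) (f : ι → PDO) (k : ℤ) :
    (∑ i ∈ s, f i).coeff k = ∑ i ∈ s, (f i).coeff k := by
  change coeffHom (∑ i ∈ s, f i) k = _
  rw [map_sum, Finset.sum_apply]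
  rfl

theorem coeff_monomial (a : SmoothFn) (n k : ℤ) :
    (monomial a n).coeff k = if k = n then a else 0 := rfl

@[simp] theorem coeff_monomial_self (a : SmoothFn) (n : ℤ) : (monomial a n).coeff n = a :=
  if_pos rfl

theorem coeff_monomial_ne (a : SmoothFn) {n k : ℤ} (h : k ≠ n) : (monomial a n).coeff k = 0 :=
  if_neg h

theorem monomial_add (a b : SmoothFn) (n : ℤ) :
    monomial (a + b) n = monomial a n + monomial b n := by
  ext1; funext k
  by_cases h : k = n <;> simp [coeff_monomial, h]

theorem monomial_zero (n : ℤ) : monomial 0 n = 0 := by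
  ext1; funext k
  simp [coeff_monomial]

theorem monomial_smul (c : ℝ) (a : SmoothFn) (n : ℤ) :
    monomial (c • a) n = c • monomial a n := by
  ext1; funext k
  by_cases h : k = n <;> simp [coeff_monomial, h]

theorem monomial_sub (a b : SmoothFn) (n : ℤ) :
    monomial (a - b) n = monomial a n - monomial b n := by
  ext1; funext k
  by_cases h : k = n <;> simp [coeff_monomial, h]

/-- `P` has order at most `N`. -/
def OrdLE (P : PDO) (N : ℤ) : Prop := ∀ k, N < k → P.coeff k = 0

theorem exists_ordLE (P : PDO) : ∃ N, OrdLE P N := P.bdd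

theorem OrdLE.mono {P : PDO} {N M : ℤ} (h : OrdLE P N) (hNM : N ≤ M) : OrdLE P M :=
  fun k hk => h k (lt_of_le_of_lt hNM hk)

theorem OrdLE.add {P Q : PDO} {N : ℤ} (hP : OrdLE P N) (hQ : OrdLE Q N) : OrdLE (P + Q) N :=
  fun k hk => by rw [coeff_add, hP k hk, hQ k hk, add_zero]

theorem OrdLE.sub {P Q : PDO} {N : ℤ} (hP : OrdLE P N) (hQ : OrdLE Q N) : OrdLE (P - Q) N :=
  fun k hk => by rw [coeff_sub, hP k hk, hQ k hk, sub_zero]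

theorem OrdLE.neg {P : PDO} {N : ℤ} (hP : OrdLE P N) : OrdLE (-P) N :=
  fun k hk => by rw [coeff_neg, hP k hk, neg_zero]

theorem ordLE_zero (N : ℤ) : OrdLE 0 N := fun _ _ => rfl

theorem ordLE_monomial (a : SmoothFn) (n : ℤ) : OrdLE (monomial a n) n :=
  fun _ hk => coeff_monomial_ne a (by omega)

theorem OrdLE.mul {P Q : PDO} {N M : ℤ} (hP : OrdLE P N) (hQ : OrdLE Q M) :
    OrdLE (P * Q) (N + M) := by
  intro k hk
  change ∑ᶠ q : ℤ × ℕ, mulTerm P Q k q = 0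
  rw [finsum_congr (g := fun _ => 0), finsum_zero]
  exact fun q => mulTerm_eq_zero hP hQ k q (by omega)

theorem OrdLE.pow {P : PDO} {N : ℤ} (hP : OrdLE P N) (m : ℕ) : OrdLE (P.pow m) (m * N) := by
  induction m with
  | zero => exact (ordLE_monomial 1 0).mono (by simp)
  | succ m ih => exact (ih.mul hP).mono (by push_cast; linarith)

theorem coeff_mul (P Q : PDO) (k : ℤ) : (P * Q).coeff k = ∑ᶠ q : ℤ × ℕ, mulTerm P Q k q := rfl

/-- A finite set of indices which supports the coefficient of `∂^k` in a product. -/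
def mulBox (N M k : ℤ) : Finset (ℤ × ℕ) :=
  Finset.Icc (k - M) N ×ˢ Finset.range ((M - k + N).toNat + 1)

/-- The index set depends only on the order bounds, so it is shared by several products, or by a
whole family of operators, and sums can be compared term by term. -/
theorem coeff_mul_eq_sum {P Q : PDO} {N M : ℤ} (hP : OrdLE P N) (hQ : OrdLE Q M) (k : ℤ) :
    (P * Q).coeff k = ∑ q ∈ mulBox N M k, mulTerm P Q k q := by
  rw [coeff_mul]
  refine finsum_eq_sum_of_support_subset _ ?_
  rintro ⟨m, i⟩ hq
  have h : ¬ (N < m ∨ M < k - m + (i : ℤ)) := fun h => hq (mulTerm_eq_zero hP hQ k (m, i) h)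
  simp only [mulBox, Finset.coe_product, Set.mem_prod, Finset.mem_coe, Finset.mem_Icc,
    Finset.mem_range]
  omega

theorem exists_common_ordLE (P Q : PDO) : ∃ N, OrdLE P N ∧ OrdLE Q N := by
  obtain ⟨N, hN⟩ := P.exists_ordLE
  obtain ⟨M, hM⟩ := Q.exists_ordLE
  exact ⟨max N M, hN.mono (le_max_left _ _), hM.mono (le_max_right _ _)⟩

theorem left_distrib' (P Q R : PDO) : P * (Q + R) = P * Q + P * R := by
  ext1; funext k
  obtain ⟨N, hP⟩ := P.exists_ordLE
  obtain ⟨M, hQ, hR⟩ := exists_common_ordLE Q R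
  rw [coeff_add, coeff_mul_eq_sum hP (hQ.add hR), coeff_mul_eq_sum hP hQ, coeff_mul_eq_sum hP hR,
    ← Finset.sum_add_distrib]
  refine Finset.sum_congr rfl fun q _ => ?_
  simp only [mulTerm, coeff_add, map_add, mul_add, smul_add]

theorem right_distrib' (P Q R : PDO) : (P + Q) * R = P * R + Q * R := by
  ext1; funext k
  obtain ⟨N, hR⟩ := R.exists_ordLE
  obtain ⟨M, hP, hQ⟩ := exists_common_ordLE P Q
  rw [coeff_add, coeff_mul_eq_sum (hP.add hQ) hR, coeff_mul_eq_sum hP hR, coeff_mul_eq_sum hQ hR,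
    ← Finset.sum_add_distrib]
  refine Finset.sum_congr rfl fun q _ => ?_
  simp only [mulTerm, coeff_add, add_mul, smul_add]

theorem smul_mul' (c : ℝ) (P Q : PDO) : (c • P) * Q = c • (P * Q) := by
  ext1; funext k
  obtain ⟨N, hP⟩ := P.exists_ordLE
  obtain ⟨M, hQ⟩ := Q.exists_ordLE
  have hcP : OrdLE (c • P) N := fun k hk => by rw [coeff_smul, hP k hk, smul_zero]
  rw [coeff_smul, coeff_mul_eq_sum hcP hQ, coeff_mul_eq_sum hP hQ, Finset.smul_sum]
  refine Finset.sum_congr rfl fun q _ => ?_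
  simp only [mulTerm, coeff_smul, smul_mul_assoc]
  rw [smul_comm]

theorem mul_smul' (c : ℝ) (P Q : PDO) : P * (c • Q) = c • (P * Q) := by
  ext1; funext k
  obtain ⟨N, hP⟩ := P.exists_ordLE
  obtain ⟨M, hQ⟩ := Q.exists_ordLE
  have hcQ : OrdLE (c • Q) M := fun k hk => by rw [coeff_smul, hQ k hk, smul_zero]
  rw [coeff_smul, coeff_mul_eq_sum hP hcQ, coeff_mul_eq_sum hP hQ, Finset.smul_sum]
  refine Finset.sum_congr rfl fun q _ => ?_
  simp only [mulTerm, coeff_smul, map_smul, mul_smul_comm]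
  rw [smul_comm]

theorem mul_zero' (P : PDO) : P * 0 = 0 := by
  have h := left_distrib' P 0 0
  simpa using h

theorem zero_mul' (P : PDO) : 0 * P = 0 := by
  have h := right_distrib' 0 0 P
  simpa using h

/-- Coefficients are indexed by their distance d below the top order, which turns the sum over ℤ × ℕ
into one over an antidiagonal. -/
theorem coeff_monomial_mul {Q : PDO} {M : ℤ} (hQ : OrdLE Q M) (a : SmoothFn) (l : ℤ) (d : ℕ) :
    (monomial a l * Q).coeff (l + M - d) = ∑ q ∈ Finset.HasAntidiagonal.antidiagonal d,
      Ring.choose l q.1 • (a * (Dx ^ q.1) (Q.coeff (M - q.2))) := by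
  rw [coeff_mul, finsum_eq_sum_of_support_subset
    (s := (Finset.HasAntidiagonal.antidiagonal d).image fun q => ((l, q.1) : ℤ × ℕ)),
    Finset.sum_image]
  · refine Finset.sum_congr rfl fun q hq => ?_
    rw [Finset.HasAntidiagonal.mem_antidiagonal] at hq
    have : l + M - d - l + q.1 = M - q.2 := by omega
    simp only [mulTerm, coeff_monomial_self, this]
  · intro q hq q' hq' h
    simp only [Finset.mem_coe,
      Finset.HasAntidiagonal.mem_antidiagonal] at hq hq'
    simp only [Prod.mk.injEq, true_and] at h
    ext <;> omega
  · rintro ⟨m, i⟩ hq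
    have hm : m = l := by
      by_contra hm
      exact hq (by simp [mulTerm, coeff_monomial_ne a hm])
    subst hm
    have h : ¬ (m < m ∨ M < m + M - d - m + (i : ℤ)) :=
      fun h => hq (mulTerm_eq_zero (ordLE_monomial a m) hQ _ (m, i) h)
    simp only [Finset.coe_image, Set.mem_image, Finset.mem_coe, Finset.HasAntidiagonal.mem_antidiagonal]
    exact ⟨(i, d - i), by simp only; omega, rfl⟩

theorem coeff_mul_monomial {P : PDO} {N : ℤ} (hP : OrdLE P N) (c : SmoothFn) (p : ℤ) (d : ℕ) :
    (P * monomial c p).coeff (N + p - d) = ∑ q ∈ Finset.HasAntidiagonal.antidiagonal d,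
      Ring.choose (N - q.1) q.2 • (P.coeff (N - q.1) * (Dx ^ q.2) c) := by
  rw [coeff_mul, finsum_eq_sum_of_support_subset
    (s := (Finset.HasAntidiagonal.antidiagonal d).image fun q =>
      ((N - q.1, q.2) : ℤ × ℕ)), Finset.sum_image]
  · refine Finset.sum_congr rfl fun q hq => ?_
    rw [Finset.HasAntidiagonal.mem_antidiagonal] at hq
    have : N + p - d - (N - q.1) + q.2 = p := by omega
    simp only [mulTerm, this, coeff_monomial_self]
  · intro q hq q' hq' h
    simp only [Prod.mk.injEq] at h
    ext <;> omega
  · rintro ⟨m, i⟩ hq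
    have hm : N + p - d - m + i = p := by
      by_contra hm
      exact hq (by simp [mulTerm, coeff_monomial_ne c hm])
    have h : ¬ (N < m ∨ p < N + p - d - m + (i : ℤ)) :=
      fun h => hq (mulTerm_eq_zero hP (ordLE_monomial c p) _ (m, i) h)
    simp only [Finset.coe_image, Set.mem_image, Finset.mem_coe, Finset.HasAntidiagonal.mem_antidiagonal]
    exact ⟨(d - i, i), by simp only; omega, by simp only [Prod.mk.injEq, and_true]; omega⟩

theorem coeff_monomial_mul_monomial (a b : SmoothFn) (l n : ℤ) (i : ℕ) :
    (monomial a l * monomial b n).coeff (l + n - i) = Ring.choose l i • (a * (Dx ^ i) b) := by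
  rw [coeff_monomial_mul (ordLE_monomial b n), Finset.sum_eq_single (i, 0)]
  · simp
  · intro q hq hne
    rw [Finset.HasAntidiagonal.mem_antidiagonal] at hq
    have : n - (q.2 : ℤ) ≠ n := by
      intro h
      exact hne (by ext <;> simp only <;> omega)
    rw [coeff_monomial_ne b this, map_zero, mul_zero, smul_zero]
  · intro h
    exact absurd (by simp) h

/-- Both sides run over the triples of natural numbers with sum d. -/
theorem sum_antidiagonal_assoc {α : Type*} [AddCommMonoid α] (d : ℕ) (F : ℕ → ℕ → ℕ → α) :
    ∑ q ∈ Finset.HasAntidiagonal.antidiagonal d, ∑ s ∈ Finset.HasAntidiagonal.antidiagonal q.1, F s.1 s.2 q.2 =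
      ∑ q ∈ Finset.HasAntidiagonal.antidiagonal d, ∑ s ∈ Finset.HasAntidiagonal.antidiagonal q.2, F q.1 s.1 s.2 := by
  rw [Finset.sum_sigma', Finset.sum_sigma']
  refine Finset.sum_nbij' (fun x => ⟨(x.2.1, x.2.2 + x.1.2), (x.2.2, x.1.2)⟩)
    (fun x => ⟨(x.1.1 + x.2.1, x.2.2), (x.1.1, x.2.1)⟩) ?_ ?_ ?_ ?_ ?_ <;>
  · rintro ⟨⟨a, b⟩, ⟨c, e⟩⟩ h
    simp only [Finset.mem_sigma, Finset.HasAntidiagonal.mem_antidiagonal] at h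
    obtain ⟨h1, h2⟩ := h
    subst h2
    subst h1
    simp [add_assoc]

theorem eq_of_coeff_sub {P Q : PDO} {N : ℤ} (hP : OrdLE P N) (hQ : OrdLE Q N)
    (h : ∀ d : ℕ, P.coeff (N - d) = Q.coeff (N - d)) : P = Q := by
  ext1; funext k
  by_cases hk : N < k
  · rw [hP k hk, hQ k hk]
  · have := h (N - k).toNat
    rwa [show N - ((N - k).toNat : ℤ) = k by omega] at this

/-- On the right the iterated Leibniz rule expands the derivatives of b ∂^j c; on the left a
binomial coefficient of upper index l + n - t appears. They agree by C(l, q) C(q, t) = C(l, t) C(l -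
t, q - t) and the Chu–Vandermonde identity, both valid for integer upper index. -/
theorem monomial_mul_assoc (a b c : SmoothFn) (l n p : ℤ) :
    monomial a l * monomial b n * monomial c p = monomial a l * (monomial b n * monomial c p) := by
  have hab := (ordLE_monomial a l).mul (ordLE_monomial b n)
  have hbc := (ordLE_monomial b n).mul (ordLE_monomial c p)
  refine eq_of_coeff_sub (hab.mul (ordLE_monomial c p))
    (((ordLE_monomial a l).mul hbc).mono (by omega)) fun d => ?_
  rw [coeff_mul_monomial hab, show l + n + p - (d : ℤ) = l + (n + p) - d by ring,
    coeff_monomial_mul hbc]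
  simp only [coeff_monomial_mul_monomial]
  let F : ℕ → ℕ → ℕ → SmoothFn := fun t r j =>
    (Ring.choose l t * (Ring.choose (l - t) r * Ring.choose n j)) •
      (a * (Dx ^ t) b * (Dx ^ (r + j)) c)
  have hR : ∀ q : ℕ × ℕ, Ring.choose l q.1 •
      (a * (Dx ^ q.1) (Ring.choose n q.2 • (b * (Dx ^ q.2) c))) =
        ∑ s ∈ Finset.HasAntidiagonal.antidiagonal q.1, F s.1 s.2 q.2 := by
    intro q
    rw [map_zsmul, Dx_pow_mul, Finset.smul_sum, Finset.mul_sum, Finset.smul_sum]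
    refine Finset.sum_congr rfl fun s hs => ?_
    rw [Finset.HasAntidiagonal.mem_antidiagonal] at hs
    have hc := Ring.choose_smul_choose l (n := q.1) (k := s.1) (by omega)
    rw [show q.1 - s.1 = s.2 by omega] at hc
    change _ = (Ring.choose l s.1 * (Ring.choose (l - s.1) s.2 * Ring.choose n q.2)) •
      (a * (Dx ^ s.1) b * (Dx ^ (s.2 + q.2)) c)
    rw [← mul_assoc, ← hc]
    simp only [pow_add, Module.End.mul_apply, zsmul_eq_mul, nsmul_eq_mul]
    push_cast
    ring
  rw [Finset.sum_congr rfl fun q _ => hR q, sum_antidiagonal_assoc d F]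
  refine Finset.sum_congr rfl fun q _ => ?_
  have hv : Ring.choose (l + n - q.1) q.2 = ∑ s ∈ Finset.HasAntidiagonal.antidiagonal q.2,
      Ring.choose (l - q.1) s.1 * Ring.choose n s.2 := by
    rw [← Ring.add_choose_eq q.2 (Commute.all _ _)]
    congr 1
    ring
  rw [hv, Finset.sum_smul]
  refine Finset.sum_congr rfl fun s hs => ?_
  rw [Finset.HasAntidiagonal.mem_antidiagonal] at hs
  simp only [F, hs, zsmul_eq_mul]
  push_cast
  ring

/-- The sum of the terms of `P` of order in `[K, N]`. -/
def truncate (P : PDO) (K N : ℤ) : PDO := ∑ m ∈ Finset.Icc K N, monomial (P.coeff m) m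

theorem coeff_truncate (P : PDO) (K N k : ℤ) :
    (P.truncate K N).coeff k = if k ∈ Finset.Icc K N then P.coeff k else 0 := by
  simp only [truncate, coeff_sum, coeff_monomial, Finset.sum_ite_eq]

theorem ordLE_sub_truncate {P : PDO} {N : ℤ} (hP : OrdLE P N) (K : ℤ) :
    OrdLE (P - P.truncate K N) (K - 1) := by
  intro k hk
  rw [coeff_sub, coeff_truncate]
  split_ifs with h
  · rw [sub_self]
  · rw [Finset.mem_Icc] at h
    rw [hP k (by omega), sub_zero]

/-- An additive map which shifts the order by a bounded amount is determined by its values on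
monomials. -/
theorem eq_zero_of_monomial (φ : PDO →+ PDO) (c : ℤ)
    (hφ : ∀ P N, OrdLE P N → OrdLE (φ P) (N + c)) (h : ∀ a n, φ (monomial a n) = 0) (P : PDO) :
    φ P = 0 := by
  obtain ⟨N, hP⟩ := P.exists_ordLE
  ext1; funext k
  -- The discarded tail has order at most k - c - 1, so its image has order below k and cannot
  -- affect the coefficient of ∂^k.
  have h1 : φ (P.truncate (k - c) N) = 0 := by
    rw [truncate, map_sum]
    exact Finset.sum_eq_zero fun m _ => h _ _
  have h2 := hφ _ _ (ordLE_sub_truncate hP (k - c))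
  rw [map_sub, h1, sub_zero] at h2
  exact h2 k (by omega)

/-- Left multiplication as an additive map. -/
def mulL (P : PDO) : PDO →+ PDO where
  toFun Q := P * Q
  map_zero' := mul_zero' P
  map_add' := left_distrib' P

/-- Right multiplication as an additive map. -/
def mulR (Q : PDO) : PDO →+ PDO where
  toFun P := P * Q
  map_zero' := zero_mul' Q
  map_add' P P' := right_distrib' P P' Q

/-- The associator is additive in each factor and shifts orders boundedly, so it passes from
monomials to general operators one factor at a time, starting with the rightmost. -/
theorem mul_assoc' (P Q R : PDO) : P * Q * R = P * (Q * R) := by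
  have h1 : ∀ (a b : SmoothFn) (l n : ℤ) (R : PDO),
      monomial a l * monomial b n * R = monomial a l * (monomial b n * R) := by
    intro a b l n R
    refine sub_eq_zero.1 (eq_zero_of_monomial
      (mulL (monomial a l * monomial b n) - (mulL (monomial a l)).comp (mulL (monomial b n)))
      (l + n) (fun P N hP => ?_) (fun c p => sub_eq_zero.2 (monomial_mul_assoc a b c l n p)) R)
    have hl := ordLE_monomial a l
    have hn := ordLE_monomial b n
    exact (((hl.mul hn).mul hP).mono (by omega)).sub ((hl.mul (hn.mul hP)).mono (by omega))
  have h2 : ∀ (a : SmoothFn) (l : ℤ) (Q R : PDO),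
      monomial a l * Q * R = monomial a l * (Q * R) := by
    intro a l Q R
    obtain ⟨K, hR⟩ := R.exists_ordLE
    refine sub_eq_zero.1 (eq_zero_of_monomial
      ((mulR R).comp (mulL (monomial a l)) - (mulL (monomial a l)).comp (mulR R))
      (l + K) (fun P N hP => ?_) (fun b n => sub_eq_zero.2 (h1 a b l n R)) Q)
    have hl := ordLE_monomial a l
    exact (((hl.mul hP).mul hR).mono (by omega)).sub ((hl.mul (hP.mul hR)).mono (by omega))
  obtain ⟨M, hQ⟩ := Q.exists_ordLE
  obtain ⟨K, hR⟩ := R.exists_ordLE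
  refine sub_eq_zero.1 (eq_zero_of_monomial
    ((mulR R).comp (mulR Q) - mulR (Q * R))
    (M + K) (fun P N hP => ?_) (fun a l => sub_eq_zero.2 (h2 a l Q R)) P)
  exact (((hP.mul hQ).mul hR).mono (by omega)).sub ((hP.mul (hQ.mul hR)).mono (by omega))

/-- Right multiplication by `∂^n` shifts the coefficients. -/
theorem coeff_mul_monomial_one (P : PDO) (n k : ℤ) :
    (P * monomial 1 n).coeff k = P.coeff (k - n) := by
  rw [coeff_mul, finsum_eq_single _ ((k - n, 0) : ℤ × ℕ)]
  · simp [mulTerm]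
  · rintro ⟨m, i⟩ hq
    by_cases hi : i = 0
    · subst hi
      have : k - m + (0 : ℕ) ≠ n := by
        intro h
        apply hq
        simp only [Prod.mk.injEq, and_true]
        push_cast at h
        omega
      simp only [mulTerm, coeff_monomial_ne 1 this, map_zero, mul_zero, smul_zero]
    · by_cases h : k - m + (i : ℤ) = n
      · simp [mulTerm, h, Dx_pow_one i hi]
      · simp only [mulTerm, coeff_monomial_ne 1 h, map_zero, mul_zero, smul_zero]

theorem monomial_mul_monomial_one (a : SmoothFn) (m n : ℤ) :
    monomial a m * monomial 1 n = monomial a (m + n) := by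
  ext1; funext k
  rw [coeff_mul_monomial_one, coeff_monomial, coeff_monomial]
  simp only [sub_eq_iff_eq_add]

/-- Left multiplication by a function acts on the coefficients. -/
theorem coeff_monomial_zero_mul (a : SmoothFn) (Q : PDO) (k : ℤ) :
    (monomial a 0 * Q).coeff k = a * Q.coeff k := by
  rw [coeff_mul, finsum_eq_single _ ((0, 0) : ℤ × ℕ)]
  · simp [mulTerm]
  · rintro ⟨m, i⟩ hq
    by_cases hm : m = 0
    · subst hm
      have hi : 0 < i := by
        rcases Nat.eq_zero_or_pos i with h | h
        · exact absurd (by rw [h]) hq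
        · exact h
      simp only [mulTerm]
      rw [Ring.choose_zero_pos ℤ hi, zero_smul]
    · simp [mulTerm, coeff_monomial_ne a hm]

instance : One PDO := ⟨monomial 1 0⟩

theorem one_def : (1 : PDO) = monomial 1 0 := rfl

instance : Ring PDO :=
  { (inferInstance : AddCommGroup PDO), (inferInstance : Mul PDO), (inferInstance : One PDO) with
    left_distrib := left_distrib'
    right_distrib := right_distrib'
    zero_mul := zero_mul'
    mul_zero := mul_zero'
    mul_assoc := mul_assoc'
    one_mul := fun P => by
      ext1; funext k
      rw [one_def, coeff_monomial_zero_mul, one_mul]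
    mul_one := fun P => by
      ext1; funext k
      rw [one_def, coeff_mul_monomial_one, sub_zero] }

instance : Algebra ℝ PDO :=
  Algebra.ofModule smul_mul' mul_smul'

theorem pow_eq (P : PDO) (m : ℕ) : P.pow m = P ^ m := by
  induction m with
  | zero => rfl
  | succ m ih => rw [PDO.pow, ih, pow_succ]

end PDO

/-! ### Rapidly decreasing functions and their multipliers. -/

theorem Dx_pow_Dy_pow_Dx (i j : ℕ) (f : SmoothFn) :
    (Dx ^ i) ((Dy ^ j) (Dx f)) = (Dx ^ (i + 1)) ((Dy ^ j) f) := by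
  have h : Commute Dy Dx := LinearMap.ext fun f => (Dx_Dy f).symm
  rw [pow_succ, Module.End.mul_apply]
  congr 1
  exact LinearMap.congr_fun (h.pow_left j) f

theorem Dx_mem {f : SmoothFn} (hf : f ∈ RapidDecay) : Dx f ∈ RapidDecay := by
  intro i j k R
  rw [Dx_pow_Dy_pow_Dx]
  exact hf (i + 1) j k R

theorem Dy_mem {f : SmoothFn} (hf : f ∈ RapidDecay) : Dy f ∈ RapidDecay := by
  intro i j k R
  have h : (Dy ^ j) (Dy f) = (Dy ^ (j + 1)) f := by rw [pow_succ, Module.End.mul_apply]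
  rw [h]
  exact hf i (j + 1) k R

theorem Dx_pow_mem {f : SmoothFn} (hf : f ∈ RapidDecay) (i : ℕ) : (Dx ^ i) f ∈ RapidDecay := by
  induction i with
  | zero => exact hf
  | succ i ih => rw [pow_succ', Module.End.mul_apply]; exact Dx_mem ih

/-- Decay of a function, without its derivatives, faster than all powers of `|x|` as `x → -∞`,
uniformly for bounded `y`. -/
def Decays (f : SmoothFn) : Prop :=
  ∀ k : ℕ, ∀ R : ℝ, ∃ C : ℝ, ∀ x y : ℝ, x ≤ 0 → |y| ≤ R → |x| ^ k * |f.1 (x, y)| ≤ C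

theorem decays_of_mem {f : SmoothFn} (hf : f ∈ RapidDecay) : Decays f := fun k R => hf 0 0 k R

theorem Decays.add {f g : SmoothFn} (hf : Decays f) (hg : Decays g) : Decays (f + g) := by
  intro k R
  obtain ⟨C, hC⟩ := hf k R
  obtain ⟨C', hC'⟩ := hg k R
  refine ⟨C + C', fun x y hx hy => ?_⟩
  have h1 := hC x y hx hy
  have h2 := hC' x y hx hy
  calc |x| ^ k * |f.1 (x, y) + g.1 (x, y)|
      ≤ |x| ^ k * (|f.1 (x, y)| + |g.1 (x, y)|) := by gcongr; exact abs_add_le _ _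
    _ ≤ C + C' := by rw [mul_add]; exact add_le_add h1 h2

theorem Decays.mul {f g : SmoothFn} (hf : Decays f) (hg : Decays g) : Decays (f * g) := by
  intro k R
  obtain ⟨C, hC⟩ := hf 0 R
  obtain ⟨C', hC'⟩ := hg k R
  refine ⟨C * C', fun x y hx hy => ?_⟩
  have h1 := hC x y hx hy
  have h2 := hC' x y hx hy
  rw [pow_zero, one_mul] at h1
  change |x| ^ k * |f.1 (x, y) * g.1 (x, y)| ≤ _
  rw [abs_mul, mul_left_comm]
  exact mul_le_mul h1 h2 (by positivity) ((abs_nonneg _).trans h1)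

/-- Membership in `RapidDecay` of a family which is closed under both derivatives, up to sums. -/
theorem mem_of_closed (T : AddSubmonoid SmoothFn) (hdec : ∀ f ∈ T, Decays f)
    (hx : ∀ f ∈ T, Dx f ∈ T) (hy : ∀ f ∈ T, Dy f ∈ T) {f : SmoothFn} (hf : f ∈ T) :
    f ∈ RapidDecay := by
  intro i j
  have hj : (Dy ^ j) f ∈ T := by
    induction j with
    | zero => exact hf
    | succ j ih => rw [pow_succ', Module.End.mul_apply]; exact hy _ ih
  have hi : (Dx ^ i) ((Dy ^ j) f) ∈ T := by
    induction i with
    | zero => exact hj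
    | succ i ih => rw [pow_succ', Module.End.mul_apply]; exact hx _ ih
  exact hdec _ hi

/-- Plain decay passes to finite sums, so if the first derivatives of generators are sums of
generators, no higher derivative has to be estimated. -/
theorem mem_of_generators (G : Set SmoothFn) (hdec : ∀ f ∈ G, Decays f)
    (hx : ∀ f ∈ G, Dx f ∈ AddSubmonoid.closure G) (hy : ∀ f ∈ G, Dy f ∈ AddSubmonoid.closure G)
    {f : SmoothFn} (hf : f ∈ G) : f ∈ RapidDecay := by
  refine mem_of_closed (AddSubmonoid.closure G) (fun f hf => ?_) (fun f hf => ?_)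
    (fun f hf => ?_) (AddSubmonoid.subset_closure hf)
  · induction hf using AddSubmonoid.closure_induction with
    | mem f hf => exact hdec f hf
    | zero => exact fun k R => ⟨0, fun x y _ _ => by simp⟩
    | add f g _ _ h1 h2 => exact h1.add h2
  · induction hf using AddSubmonoid.closure_induction with
    | mem f hf => exact hx f hf
    | zero => rw [map_zero]; exact zero_mem _
    | add f g _ _ h1 h2 => rw [map_add]; exact add_mem h1 h2
  · induction hf using AddSubmonoid.closure_induction with
    | mem f hf => exact hy f hf
    | zero => rw [map_zero]; exact zero_mem _
    | add f g _ _ h1 h2 => rw [map_add]; exact add_mem h1 h2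

theorem mul_mem' {f g : SmoothFn} (hf : f ∈ RapidDecay) (hg : g ∈ RapidDecay) :
    f * g ∈ RapidDecay := by
  have hsub : ∀ a ∈ RapidDecay, ∀ b ∈ RapidDecay, a * b ∈
      AddSubmonoid.closure {h | ∃ a ∈ RapidDecay, ∃ b ∈ RapidDecay, h = a * b} :=
    fun a ha b hb => AddSubmonoid.subset_closure ⟨a, ha, b, hb, rfl⟩
  refine mem_of_generators {h | ∃ a ∈ RapidDecay, ∃ b ∈ RapidDecay, h = a * b} ?_ ?_ ?_
    ⟨f, hf, g, hg, rfl⟩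
  · rintro _ ⟨a, ha, b, hb, rfl⟩
    exact (decays_of_mem ha).mul (decays_of_mem hb)
  · rintro _ ⟨a, ha, b, hb, rfl⟩
    rw [Dx_mul]
    exact add_mem (hsub _ (Dx_mem ha) _ hb) (hsub _ ha _ (Dx_mem hb))
  · rintro _ ⟨a, ha, b, hb, rfl⟩
    rw [Dy_mul]
    exact add_mem (hsub _ (Dy_mem ha) _ hb) (hsub _ ha _ (Dy_mem hb))

theorem Dx_xFn : Dx xFn = 1 := by
  apply Subtype.ext; funext p
  change fderiv ℝ (fun p : ℝ × ℝ => p.1) p (1, 0) = 1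
  rw [fderiv_fst]; rfl

theorem Dy_xFn : Dy xFn = 0 := by
  apply Subtype.ext; funext p
  change fderiv ℝ (fun p : ℝ × ℝ => p.1) p (0, 1) = 0
  rw [fderiv_fst]; rfl

theorem Dx_yFn : Dx yFn = 0 := by
  apply Subtype.ext; funext p
  change fderiv ℝ (fun p : ℝ × ℝ => p.2) p (1, 0) = 0
  rw [fderiv_snd]; rfl

theorem Dy_yFn : Dy yFn = 1 := by
  apply Subtype.ext; funext p
  change fderiv ℝ (fun p : ℝ × ℝ => p.2) p (0, 1) = 1
  rw [fderiv_snd]; rfl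

theorem xFn_mul_mem {f : SmoothFn} (hf : f ∈ RapidDecay) : xFn * f ∈ RapidDecay := by
  -- The rapidly decreasing functions are included because ∂(x a) = a + x a_x leaves the products x
  -- a.
  let G : Set SmoothFn := {h | h ∈ RapidDecay ∧ Decays h ∨ ∃ a ∈ RapidDecay, h = xFn * a}
  have h1 : ∀ a ∈ RapidDecay, a ∈ AddSubmonoid.closure G :=
    fun a ha => AddSubmonoid.subset_closure (Or.inl ⟨ha, decays_of_mem ha⟩)
  have h2 : ∀ a ∈ RapidDecay, xFn * a ∈ AddSubmonoid.closure G :=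
    fun a ha => AddSubmonoid.subset_closure (Or.inr ⟨a, ha, rfl⟩)
  refine mem_of_generators G ?_ ?_ ?_ (Or.inr ⟨f, hf, rfl⟩)
  · rintro _ (⟨-, h⟩ | ⟨a, ha, rfl⟩)
    · exact h
    · intro k R
      obtain ⟨C, hC⟩ := decays_of_mem ha (k + 1) R
      refine ⟨C, fun x y hx hy => ?_⟩
      change |x| ^ k * |x * a.1 (x, y)| ≤ C
      rw [abs_mul, ← mul_assoc, ← pow_succ]
      exact hC x y hx hy
  · rintro _ (⟨h, -⟩ | ⟨a, ha, rfl⟩)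
    · exact h1 _ (Dx_mem h)
    · rw [Dx_mul, Dx_xFn, one_mul]
      exact add_mem (h1 _ ha) (h2 _ (Dx_mem ha))
  · rintro _ (⟨h, -⟩ | ⟨a, ha, rfl⟩)
    · exact h1 _ (Dy_mem h)
    · rw [Dy_mul, Dy_xFn, zero_mul, zero_add]
      exact h2 _ (Dy_mem ha)

theorem yFn_mul_mem {f : SmoothFn} (hf : f ∈ RapidDecay) : yFn * f ∈ RapidDecay := by
  let G : Set SmoothFn := {h | h ∈ RapidDecay ∧ Decays h ∨ ∃ a ∈ RapidDecay, h = yFn * a}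
  have h1 : ∀ a ∈ RapidDecay, a ∈ AddSubmonoid.closure G :=
    fun a ha => AddSubmonoid.subset_closure (Or.inl ⟨ha, decays_of_mem ha⟩)
  have h2 : ∀ a ∈ RapidDecay, yFn * a ∈ AddSubmonoid.closure G :=
    fun a ha => AddSubmonoid.subset_closure (Or.inr ⟨a, ha, rfl⟩)
  refine mem_of_generators G ?_ ?_ ?_ (Or.inr ⟨f, hf, rfl⟩)
  · rintro _ (⟨-, h⟩ | ⟨a, ha, rfl⟩)
    · exact h
    · intro k R
      obtain ⟨C, hC⟩ := decays_of_mem ha k R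
      -- Decay is uniform only for bounded y, so the factor y costs just the bound R of the strip.
      refine ⟨R * C, fun x y hx hy => ?_⟩
      change |x| ^ k * |y * a.1 (x, y)| ≤ R * C
      rw [abs_mul, mul_left_comm]
      exact mul_le_mul hy (hC x y hx hy) (by positivity) ((abs_nonneg y).trans hy)
  · rintro _ (⟨h, -⟩ | ⟨a, ha, rfl⟩)
    · exact h1 _ (Dx_mem h)
    · rw [Dx_mul, Dx_yFn, zero_mul, zero_add]
      exact h2 _ (Dx_mem ha)
  · rintro _ (⟨h, -⟩ | ⟨a, ha, rfl⟩)
    · exact h1 _ (Dy_mem h)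
    · rw [Dy_mul, Dy_yFn, one_mul]
      exact add_mem (h1 _ ha) (h2 _ (Dy_mem ha))

/-- The multipliers of `RapidDecay`. -/
def Multiplier : Subalgebra ℝ SmoothFn where
  carrier := {f | ∀ h ∈ RapidDecay, f * h ∈ RapidDecay}
  mul_mem' hf hg h hh := by
    rw [mul_assoc]
    exact hf _ (hg _ hh)
  add_mem' hf hg h hh := by
    rw [add_mul]
    exact add_mem (hf _ hh) (hg _ hh)
  algebraMap_mem' c h hh := by
    rw [← Algebra.smul_def]
    exact RapidDecay.smul_mem c hh

theorem mem_multiplier_of_mem {f : SmoothFn} (hf : f ∈ RapidDecay) : f ∈ Multiplier :=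
  fun _ hh => mul_mem' hf hh

theorem xFn_mem_multiplier : xFn ∈ Multiplier := fun _ hh => xFn_mul_mem hh

theorem yFn_mem_multiplier : yFn ∈ Multiplier := fun _ hh => yFn_mul_mem hh

theorem Dx_mem_multiplier {f : SmoothFn} (hf : f ∈ Multiplier) : Dx f ∈ Multiplier := by
  intro h hh
  have : Dx f * h = Dx (f * h) - f * Dx h := by rw [Dx_mul]; ring
  rw [this]
  exact sub_mem (Dx_mem (hf h hh)) (hf _ (Dx_mem hh))

theorem Dx_pow_mem_multiplier {f : SmoothFn} (hf : f ∈ Multiplier) (i : ℕ) :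
    (Dx ^ i) f ∈ Multiplier := by
  induction i with
  | zero => exact hf
  | succ i ih => rw [pow_succ', Module.End.mul_apply]; exact Dx_mem_multiplier ih

/-! ### Inverting ∂ on rapidly decreasing functions. -/

theorem continuous_coe (f : SmoothFn) : Continuous f.1 := (contDiff_coe f).continuous

/-- Decay controls only x ≤ 0; the remaining rectangle 0 ≤ x ≤ R, |y| ≤ R is compact. -/
theorem exists_weighted_bound {f : SmoothFn} (hf : Decays f) (R : ℝ) :
    ∃ C, 0 ≤ C ∧ ∀ x y : ℝ, x ≤ R → |y| ≤ R → (1 + x ^ 2) * |f.1 (x, y)| ≤ C := by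
  obtain ⟨C0, h0⟩ := hf 0 R
  obtain ⟨C2, h2⟩ := hf 2 R
  have hc : IsCompact (Set.Icc (0 : ℝ) R ×ˢ Set.Icc (-R) R) := isCompact_Icc.prod isCompact_Icc
  have hcont : Continuous fun p : ℝ × ℝ => (1 + p.1 ^ 2) * |f.1 p| := by
    have := continuous_coe f
    fun_prop
  obtain ⟨C1, h1⟩ := hc.bddAbove_image hcont.continuousOn
  refine ⟨max (max (C0 + C2) C1) 0, le_max_right _ _, fun x y hx hy => ?_⟩
  rcases le_total x 0 with h | h
  · refine le_trans ?_ ((le_max_left _ _).trans (le_max_left _ _))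
    have e0 := h0 x y h hy
    have e2 := h2 x y h hy
    rw [sq_abs] at e2
    rw [pow_zero] at e0
    rw [add_mul]
    exact add_le_add e0 e2
  · refine le_trans ?_ ((le_max_right _ _).trans (le_max_left _ _))
    exact h1 ⟨(x, y), ⟨⟨h, hx⟩, abs_le.1 hy⟩, rfl⟩

/-- `∫_{-∞}^0 f(x + s, y) ds`. -/
def antideriv (f : SmoothFn) (p : ℝ × ℝ) : ℝ := ∫ s in Set.Iic (0 : ℝ), f.1 (p.1 + s, p.2)

/-- Provides an integrable majorant in s, uniform for (x, y) in a bounded set, as dominated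
differentiation requires. -/
theorem exists_shift_bound {f : SmoothFn} (hf : Decays f) (R : ℝ) :
    ∃ C, 0 ≤ C ∧ ∀ x y s : ℝ, |x| ≤ R → |y| ≤ R → s ≤ 0 →
      |f.1 (x + s, y)| ≤ C * (1 + s ^ 2)⁻¹ := by
  obtain ⟨C, hC0, hC⟩ := exists_weighted_bound hf R
  refine ⟨2 * (1 + R ^ 2) * C, by positivity, fun x y s hx hy hs => ?_⟩
  have h1 := hC (x + s) y (by linarith [le_abs_self x]) hy
  have hxR : x ^ 2 ≤ R ^ 2 := by
    rw [← sq_abs x]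
    exact pow_le_pow_left₀ (abs_nonneg x) hx 2
  -- Peetre's inequality: s = (x + s) - x gives s² ≤ 2 (x + s)² + 2 x².
  have h2 : 1 + s ^ 2 ≤ 2 * (1 + R ^ 2) * (1 + (x + s) ^ 2) := by
    nlinarith [sq_nonneg (x + s), sq_nonneg (s + 2 * x), sq_nonneg x,
      mul_nonneg (sq_nonneg R) (sq_nonneg (x + s))]
  rw [← div_eq_mul_inv, le_div_iff₀ (by positivity)]
  calc |f.1 (x + s, y)| * (1 + s ^ 2)
      ≤ |f.1 (x + s, y)| * (2 * (1 + R ^ 2) * (1 + (x + s) ^ 2)) := by gcongr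
    _ = 2 * (1 + R ^ 2) * ((1 + (x + s) ^ 2) * |f.1 (x + s, y)|) := by ring
    _ ≤ 2 * (1 + R ^ 2) * C := by gcongr

theorem continuous_shift (f : SmoothFn) (p : ℝ × ℝ) :
    Continuous fun s : ℝ => f.1 (p.1 + s, p.2) := by
  have := continuous_coe f
  fun_prop

theorem integrableOn_shift {f : SmoothFn} (hf : Decays f) (p : ℝ × ℝ) :
    MeasureTheory.IntegrableOn (fun s => f.1 (p.1 + s, p.2)) (Set.Iic 0) := by
  obtain ⟨C, hC0, hC⟩ := exists_shift_bound hf (max |p.1| |p.2|)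
  refine MeasureTheory.Integrable.mono' (integrable_inv_one_add_sq.integrableOn.const_mul C)
    (continuous_shift f p).aestronglyMeasurable ?_
  filter_upwards [MeasureTheory.ae_restrict_mem measurableSet_Iic] with s hs
  exact hC _ _ _ (le_max_left _ _) (le_max_right _ _) hs

theorem fderiv_apply_eq (f : SmoothFn) (p v : ℝ × ℝ) :
    fderiv ℝ f.1 p v = v.1 * (Dx f).1 p + v.2 * (Dy f).1 p := by
  have hv : v = v.1 • ((1, 0) : ℝ × ℝ) + v.2 • ((0, 1) : ℝ × ℝ) := by ext <;> simp
  conv_lhs => rw [hv, map_add, map_smul, map_smul]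
  rfl

/-- In the shifted form the domain of integration does not depend on the point, so both partial
derivatives go under the integral sign. -/
theorem hasFDerivAt_antideriv {f : SmoothFn} (hf : f ∈ RapidDecay) (p : ℝ × ℝ) :
    HasFDerivAt (antideriv f) (antideriv (Dx f) p • ContinuousLinearMap.fst ℝ ℝ ℝ +
      antideriv (Dy f) p • ContinuousLinearMap.snd ℝ ℝ ℝ) p := by
  have hfx := decays_of_mem (Dx_mem hf)
  have hfy := decays_of_mem (Dy_mem hf)
  set R := max |p.1| |p.2| + 1 with hR
  obtain ⟨C, hC0, hC⟩ := exists_shift_bound hfx R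
  obtain ⟨C', hC0', hC'⟩ := exists_shift_bound hfy R
  let F' : ℝ × ℝ → ℝ → (ℝ × ℝ →L[ℝ] ℝ) := fun q s =>
    (Dx f).1 (q.1 + s, q.2) • ContinuousLinearMap.fst ℝ ℝ ℝ +
      (Dy f).1 (q.1 + s, q.2) • ContinuousLinearMap.snd ℝ ℝ ℝ
  have hF'cont : Continuous (F' p) := by
    have h1 := continuous_shift (Dx f) p
    have h2 := continuous_shift (Dy f) p
    fun_prop
  have key := hasFDerivAt_integral_of_dominated_of_fderiv_le (𝕜 := ℝ)
    (μ := MeasureTheory.volume.restrict (Set.Iic (0 : ℝ)))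
    (F := fun (q : ℝ × ℝ) s => f.1 (q.1 + s, q.2)) (F' := F') (x₀ := p)
    (s := Metric.ball p 1) (bound := fun s => (C + C') * (1 + s ^ 2)⁻¹)
    (Metric.ball_mem_nhds p one_pos)
    (Filter.Eventually.of_forall fun q => (continuous_shift f q).aestronglyMeasurable)
    (integrableOn_shift (decays_of_mem hf) p) hF'cont.aestronglyMeasurable ?_
    (integrable_inv_one_add_sq.integrableOn.const_mul _) ?_
  · have e : ∫ s in Set.Iic (0 : ℝ), F' p s = antideriv (Dx f) p • ContinuousLinearMap.fst ℝ ℝ ℝ +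
        antideriv (Dy f) p • ContinuousLinearMap.snd ℝ ℝ ℝ := by
      rw [MeasureTheory.integral_add, integral_smul_const, integral_smul_const]
      · rfl
      · exact (integrableOn_shift hfx p).smul_const _
      · exact (integrableOn_shift hfy p).smul_const _
    rw [← e]
    exact key
  · filter_upwards [MeasureTheory.ae_restrict_mem measurableSet_Iic] with s hs q hq
    rw [Metric.mem_ball, Prod.dist_eq, max_lt_iff, Real.dist_eq, Real.dist_eq] at hq
    have hq1 : |q.1| ≤ R := by
      have := abs_sub_abs_le_abs_sub q.1 p.1
      linarith [le_max_left |p.1| |p.2|, hq.1]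
    have hq2 : |q.2| ≤ R := by
      have := abs_sub_abs_le_abs_sub q.2 p.2
      linarith [le_max_right |p.1| |p.2|, hq.2]
    have e1 := hC q.1 q.2 s hq1 hq2 hs
    have e2 := hC' q.1 q.2 s hq1 hq2 hs
    calc ‖F' q s‖ ≤ ‖(Dx f).1 (q.1 + s, q.2) • ContinuousLinearMap.fst ℝ ℝ ℝ‖ +
          ‖(Dy f).1 (q.1 + s, q.2) • ContinuousLinearMap.snd ℝ ℝ ℝ‖ := norm_add_le _ _
      _ ≤ |(Dx f).1 (q.1 + s, q.2)| * 1 + |(Dy f).1 (q.1 + s, q.2)| * 1 := by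
          rw [norm_smul, norm_smul, Real.norm_eq_abs, Real.norm_eq_abs]
          gcongr
          · exact ContinuousLinearMap.norm_fst_le ℝ ℝ ℝ
          · exact ContinuousLinearMap.norm_snd_le ℝ ℝ ℝ
      _ ≤ (C + C') * (1 + s ^ 2)⁻¹ := by rw [add_mul, mul_one, mul_one]; exact add_le_add e1 e2
  · filter_upwards with s q _
    have h1 : HasFDerivAt f.1 (fderiv ℝ f.1 (q.1 + s, q.2)) (q.1 + s, q.2) :=
      ((contDiff_coe f).differentiable (by simp) _).hasFDerivAt
    have h2 : HasFDerivAt (fun q : ℝ × ℝ => (q.1 + s, q.2)) (ContinuousLinearMap.id ℝ (ℝ × ℝ)) q := by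
      have h3 : HasFDerivAt (fun q : ℝ × ℝ => q + (s, 0)) (ContinuousLinearMap.id ℝ (ℝ × ℝ)) q :=
        (hasFDerivAt_id q).add_const _
      convert h3 using 2 with q
      ext <;> simp
    have h3 : F' q s = (fderiv ℝ f.1 (q.1 + s, q.2)).comp (ContinuousLinearMap.id ℝ (ℝ × ℝ)) := by
      refine ContinuousLinearMap.ext fun v => ?_
      rw [ContinuousLinearMap.comp_id, fderiv_apply_eq, mul_comm v.1, mul_comm v.2]
      rfl
    rw [h3]
    exact h1.comp q h2

theorem contDiff_antideriv {f : SmoothFn} (hf : f ∈ RapidDecay) : ContDiff ℝ ∞ (antideriv f) := by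
  rw [contDiff_infty]
  intro n
  induction n generalizing f with
  | zero =>
    rw [Nat.cast_zero, contDiff_zero]
    exact continuous_iff_continuousAt.2 fun p => (hasFDerivAt_antideriv hf p).continuousAt
  | succ n ih =>
    rw [Nat.cast_succ, contDiff_succ_iff_fderiv]
    refine ⟨fun p => (hasFDerivAt_antideriv hf p).differentiableAt, by simp, ?_⟩
    have : fderiv ℝ (antideriv f) = fun p => antideriv (Dx f) p • ContinuousLinearMap.fst ℝ ℝ ℝ +
      antideriv (Dy f) p • ContinuousLinearMap.snd ℝ ℝ ℝ :=
      funext fun p => (hasFDerivAt_antideriv hf p).fderiv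
    rw [this]
    exact ((ih (Dx_mem hf)).smul contDiff_const).add ((ih (Dy_mem hf)).smul contDiff_const)

/-- The antiderivative as a smooth function. -/
def antiderivFn (f : RapidDecay) : SmoothFn := ⟨antideriv f.1, contDiff_antideriv f.2⟩

theorem Dx_antiderivFn_eq (f : RapidDecay) : Dx (antiderivFn f) = antiderivFn ⟨Dx f.1, Dx_mem f.2⟩ := by
  apply Subtype.ext; funext p
  change fderiv ℝ (antideriv f.1) p (1, 0) = antideriv (Dx f.1) p
  rw [(hasFDerivAt_antideriv f.2 p).fderiv]
  simp

theorem Dy_antiderivFn_eq (f : RapidDecay) : Dy (antiderivFn f) = antiderivFn ⟨Dy f.1, Dy_mem f.2⟩ := by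
  apply Subtype.ext; funext p
  change fderiv ℝ (antideriv f.1) p (0, 1) = antideriv (Dy f.1) p
  rw [(hasFDerivAt_antideriv f.2 p).fderiv]
  simp

theorem antiderivFn_Dx (f : RapidDecay) : antiderivFn ⟨Dx f.1, Dx_mem f.2⟩ = f.1 := by
  apply Subtype.ext; funext p
  change ∫ s in Set.Iic (0 : ℝ), (Dx f.1).1 (p.1 + s, p.2) = f.1.1 p
  have hd : ∀ s : ℝ, HasDerivAt (fun s => f.1.1 (p.1 + s, p.2)) ((Dx f.1).1 (p.1 + s, p.2)) s := by
    intro s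
    have h1 : HasFDerivAt f.1.1 (fderiv ℝ f.1.1 (p.1 + s, p.2)) (p.1 + s, p.2) :=
      ((contDiff_coe f.1).differentiable (by simp) _).hasFDerivAt
    have h2 : HasDerivAt (fun s : ℝ => (p.1 + s, p.2)) ((1 : ℝ), (0 : ℝ)) s :=
      ((hasDerivAt_id s).const_add p.1).prodMk (hasDerivAt_const s p.2)
    exact h1.comp_hasDerivAt s h2
  have hlim : Filter.Tendsto (fun s => f.1.1 (p.1 + s, p.2)) Filter.atBot (nhds 0) := by
    obtain ⟨C, hC0, hC⟩ := exists_shift_bound (decays_of_mem f.2) (max |p.1| |p.2|)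
    have h1 : Filter.Tendsto (fun s : ℝ => C * (1 + s ^ 2)⁻¹) Filter.atBot (nhds 0) := by
      rw [← mul_zero C]
      refine Filter.Tendsto.const_mul C (Filter.Tendsto.inv_tendsto_atTop ?_)
      refine Filter.tendsto_atTop_add_const_left _ _ ?_
      have := (Filter.tendsto_pow_atTop (α := ℝ) two_ne_zero).comp Filter.tendsto_neg_atBot_atTop
      simpa [Function.comp_def] using this
    refine squeeze_zero_norm' ?_ h1
    filter_upwards [Filter.eventually_le_atBot 0] with s hs
    exact hC _ _ _ (le_max_left _ _) (le_max_right _ _) hs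
  have := MeasureTheory.integral_Iic_of_hasDerivAt_of_tendsto'
    (a := 0) (fun s _ => hd s) (integrableOn_shift (decays_of_mem (Dx_mem f.2)) p) hlim
  rw [this]
  simp

/-- For x, s ≤ 0 both |x| and |s| are at most |x + s|. Two extra powers of decay of f therefore pay
for the integrable weight 1 / (1 + s²). -/
theorem decays_antiderivFn (f : RapidDecay) : Decays (antiderivFn f) := by
  intro k R
  obtain ⟨C0, h0⟩ := decays_of_mem f.2 k R
  obtain ⟨C2, h2⟩ := decays_of_mem f.2 (k + 2) R
  refine ⟨(C0 + C2) * ∫ s in Set.Iic (0 : ℝ), (1 + s ^ 2)⁻¹, fun x y hx hy => ?_⟩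
  change |x| ^ k * |∫ s in Set.Iic (0 : ℝ), f.1.1 (x + s, y)| ≤ _
  rw [← MeasureTheory.integral_const_mul]
  have : |x| ^ k * |∫ s in Set.Iic (0 : ℝ), f.1.1 (x + s, y)| =
      ‖∫ s in Set.Iic (0 : ℝ), |x| ^ k * f.1.1 (x + s, y)‖ := by
    rw [MeasureTheory.integral_const_mul, norm_mul, Real.norm_eq_abs, Real.norm_eq_abs, abs_pow,
      abs_abs]
  rw [this]
  refine MeasureTheory.norm_integral_le_of_norm_le
    (integrable_inv_one_add_sq.integrableOn.const_mul _) ?_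
  filter_upwards [MeasureTheory.ae_restrict_mem measurableSet_Iic] with s hs
  have hs' : s ≤ 0 := hs
  have e0 := h0 (x + s) y (by linarith) hy
  have e2 := h2 (x + s) y (by linarith) hy
  have hxs : |x| ≤ |x + s| := by
    rw [abs_of_nonpos hx, abs_of_nonpos (by linarith)]; linarith
  have hss : s ^ 2 ≤ |x + s| ^ 2 := by
    rw [sq_abs]; nlinarith
  rw [norm_mul, Real.norm_eq_abs, Real.norm_eq_abs, abs_pow, abs_abs, ← div_eq_mul_inv,
    le_div_iff₀ (by positivity)]
  calc |x| ^ k * |f.1.1 (x + s, y)| * (1 + s ^ 2)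
      ≤ |x + s| ^ k * |f.1.1 (x + s, y)| * (1 + |x + s| ^ 2) := by gcongr
    _ = |x + s| ^ k * |f.1.1 (x + s, y)| + |x + s| ^ (k + 2) * |f.1.1 (x + s, y)| := by ring
    _ ≤ C0 + C2 := add_le_add e0 e2

theorem antiderivFn_mem (f : RapidDecay) : antiderivFn f ∈ RapidDecay := by
  have hsub : ∀ a : RapidDecay, antiderivFn a ∈ AddSubmonoid.closure (Set.range antiderivFn) :=
    fun a => AddSubmonoid.subset_closure ⟨a, rfl⟩
  refine mem_of_generators (Set.range antiderivFn) ?_ ?_ ?_ ⟨f, rfl⟩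
  · rintro _ ⟨a, rfl⟩
    exact decays_antiderivFn a
  · rintro _ ⟨a, rfl⟩
    rw [Dx_antiderivFn_eq]
    exact hsub _
  · rintro _ ⟨a, rfl⟩
    rw [Dy_antiderivFn_eq]
    exact hsub _

/-- Decay as x → -∞ removes the constant of integration; all uniqueness statements below come from
this. -/
theorem eq_zero_of_Dx_eq_zero {f : SmoothFn} (hf : f ∈ RapidDecay) (h : Dx f = 0) : f = 0 := by
  have h1 := antiderivFn_Dx ⟨f, hf⟩
  have h0 := antiderivFn_Dx 0
  have e : (⟨Dx f, Dx_mem hf⟩ : RapidDecay) = ⟨Dx (0 : RapidDecay).1, Dx_mem (0 : RapidDecay).2⟩ :=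
    Subtype.ext (h.trans (map_zero Dx).symm)
  exact h1.symm.trans ((congrArg antiderivFn e).trans h0)

/-- `∂` is a linear bijection of `RapidDecay`. -/
def DxEquiv : RapidDecay ≃ₗ[ℝ] RapidDecay :=
  LinearEquiv.ofBijective (Dx.restrict fun _ hf => Dx_mem hf) <| by
    constructor
    · rw [injective_iff_map_eq_zero]
      intro f hf
      exact Subtype.ext (eq_zero_of_Dx_eq_zero f.2 (congrArg Subtype.val hf))
    · intro f
      refine ⟨⟨antiderivFn f, antiderivFn_mem f⟩, Subtype.ext ?_⟩
      change Dx (antiderivFn f) = f.1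
      rw [Dx_antiderivFn_eq, antiderivFn_Dx]

/-- A linear extension of `∂⁻¹` to all smooth functions. -/
theorem exists_invDx : ∃ J : SmoothFn →ₗ[ℝ] SmoothFn,
    ∀ f ∈ RapidDecay, J f ∈ RapidDecay ∧ Dx (J f) = f := by
  -- Values outside `RapidDecay` are irrelevant; totality lets recursions apply J before membership
  -- is known.
  obtain ⟨J, hJ⟩ := LinearMap.exists_extend (RapidDecay.subtype ∘ₗ DxEquiv.symm.toLinearMap)
  refine ⟨J, fun f hf => ?_⟩
  have h : J f = (DxEquiv.symm ⟨f, hf⟩).1 := LinearMap.congr_fun hJ ⟨f, hf⟩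
  rw [h]
  exact ⟨Subtype.property _, congrArg Subtype.val (DxEquiv.apply_symm_apply ⟨f, hf⟩)⟩

/-! ### Derivatives of operators; decaying, multiplier and differential operators. -/

namespace PDO

theorem comm_eq (P Q : PDO) : comm P Q = P * Q - Q * P := rfl

@[simp] theorem coeff_dy (P : PDO) (k : ℤ) : P.dy.coeff k = Dy (P.coeff k) := rfl

theorem coeff_pos (P : PDO) (k : ℤ) : P.pos.coeff k = if 0 ≤ k then P.coeff k else 0 := rfl

theorem OrdLE.dy {P : PDO} {N : ℤ} (hP : OrdLE P N) : OrdLE P.dy N :=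
  fun k hk => by rw [coeff_dy, hP k hk, map_zero]

/-- `P ↦ P_y` as a linear map. -/
def dyLin : PDO →ₗ[ℝ] PDO where
  toFun := dy
  map_add' P Q := by ext1; funext k; exact map_add Dy _ _
  map_smul' c P := by ext1; funext k; exact map_smul Dy _ _

theorem dy_mul (P Q : PDO) : (P * Q).dy = P.dy * Q + P * Q.dy := by
  ext1; funext k
  obtain ⟨N, hP⟩ := P.exists_ordLE
  obtain ⟨M, hQ⟩ := Q.exists_ordLE
  rw [coeff_dy, coeff_add, coeff_mul_eq_sum hP hQ, coeff_mul_eq_sum hP.dy hQ,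
    coeff_mul_eq_sum hP hQ.dy, map_sum, ← Finset.sum_add_distrib]
  refine Finset.sum_congr rfl fun q _ => ?_
  simp only [mulTerm, coeff_dy, map_zsmul, Dy_mul, smul_add, Dx_pow_Dy]

theorem dy_monomial (a : SmoothFn) (n : ℤ) : (monomial a n).dy = monomial (Dy a) n := by
  ext1; funext k
  rw [coeff_dy, coeff_monomial, coeff_monomial]
  split_ifs
  · rfl
  · exact map_zero Dy

/-- The coefficientwise derivative with respect to `x`. -/
def dx (P : PDO) : PDO where
  coeff k := Dx (P.coeff k)
  bdd := by
    obtain ⟨N, hN⟩ := P.bdd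
    exact ⟨N, fun k hk => by rw [hN k hk, map_zero]⟩

@[simp] theorem coeff_dx (P : PDO) (k : ℤ) : P.dx.coeff k = Dx (P.coeff k) := rfl

theorem dx_monomial (a : SmoothFn) (n : ℤ) : (monomial a n).dx = monomial (Dx a) n := by
  ext1; funext k
  rw [coeff_dx, coeff_monomial, coeff_monomial]
  split_ifs
  · rfl
  · exact map_zero Dx

theorem coeff_d_mul (P : PDO) (k : ℤ) :
    (monomial 1 1 * P).coeff k = P.coeff (k - 1) + Dx (P.coeff k) := by
  rw [coeff_mul, finsum_eq_sum_of_support_subset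
    (s := {((1, 0) : ℤ × ℕ), ((1, 1) : ℤ × ℕ)})]
  · rw [Finset.sum_pair (by simp)]
    simp [mulTerm]
  · rintro ⟨m, i⟩ hq
    have hm : m = 1 := by
      by_contra hm
      exact hq (by simp [mulTerm, coeff_monomial_ne 1 hm])
    subst hm
    have hi : i < 2 := by
      by_contra hi
      apply hq
      have h := Ring.choose_natCast (R := ℤ) 1 i
      rw [Nat.choose_eq_zero_of_lt (by omega), Nat.cast_one, Nat.cast_zero] at h
      simp [mulTerm, h]
    interval_cases i <;> simp

/-- `[∂, P] = P_x`. -/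
theorem d_mul (P : PDO) : monomial 1 1 * P = P * monomial 1 1 + P.dx := by
  ext1; funext k
  rw [coeff_d_mul, coeff_add, coeff_mul_monomial_one, coeff_dx]

theorem monomial_one_pow (m : ℕ) : (monomial 1 1 : PDO) ^ m = monomial 1 m := by
  induction m with
  | zero => rfl
  | succ m ih => rw [pow_succ, ih, monomial_mul_monomial_one]; simp

/-- The operators with rapidly decreasing coefficients. -/
def RapidOp : Submodule ℝ PDO where
  carrier := {P | ∀ k, P.coeff k ∈ RapidDecay}
  zero_mem' _ := RapidDecay.zero_mem
  add_mem' hP hQ k := RapidDecay.add_mem (hP k) (hQ k)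
  smul_mem' c _ hP k := RapidDecay.smul_mem c (hP k)

theorem coeff_mul_mem {P Q : PDO} {k : ℤ} (T : AddSubgroup SmoothFn)
    (h : ∀ m n i, P.coeff m * (Dx ^ i) (Q.coeff n) ∈ T) : (P * Q).coeff k ∈ T := by
  rw [coeff_mul]
  exact finsum_induction _ T.zero_mem (fun _ _ => T.add_mem) fun q => T.zsmul_mem (h _ _ _) _

/-- The operators whose coefficients are multipliers of `RapidDecay`. -/
def MultiplierOp : Subalgebra ℝ PDO where
  carrier := {P | ∀ k, P.coeff k ∈ Multiplier}
  mul_mem' hP hQ _ := coeff_mul_mem Multiplier.toSubring.toAddSubgroup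
    fun m n i => Multiplier.mul_mem (hP m) (Dx_pow_mem_multiplier (hQ n) i)
  add_mem' hP hQ k := Multiplier.add_mem (hP k) (hQ k)
  algebraMap_mem' c k := by
    rw [Algebra.algebraMap_eq_smul_one, coeff_smul, one_def, coeff_monomial]
    refine Multiplier.smul_mem ?_ c
    split_ifs
    · exact Multiplier.one_mem
    · exact Multiplier.zero_mem

theorem rapidOp_mul_mem {P Q : PDO} (hP : P ∈ RapidOp) (hQ : Q ∈ MultiplierOp) :
    P * Q ∈ RapidOp := fun _ => coeff_mul_mem RapidDecay.toAddSubgroup fun m n i => by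
  rw [mul_comm]
  exact Dx_pow_mem_multiplier (hQ n) i _ (hP m)

theorem multiplierOp_mul_mem {P Q : PDO} (hP : P ∈ MultiplierOp) (hQ : Q ∈ RapidOp) :
    P * Q ∈ RapidOp := fun _ => coeff_mul_mem RapidDecay.toAddSubgroup fun m n i =>
  hP m _ (Dx_pow_mem (hQ n) i)

theorem mem_multiplierOp_of_rapidOp {P : PDO} (hP : P ∈ RapidOp) : P ∈ MultiplierOp :=
  fun k => mem_multiplier_of_mem (hP k)

theorem comm_mem_rapidOp_left {P Q : PDO} (hP : P ∈ RapidOp) (hQ : Q ∈ MultiplierOp) :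
    comm P Q ∈ RapidOp := sub_mem (rapidOp_mul_mem hP hQ) (multiplierOp_mul_mem hQ hP)

theorem comm_mem_rapidOp_right {P Q : PDO} (hP : P ∈ MultiplierOp) (hQ : Q ∈ RapidOp) :
    comm P Q ∈ RapidOp := sub_mem (multiplierOp_mul_mem hP hQ) (rapidOp_mul_mem hQ hP)

theorem monomial_mem_rapidOp {a : SmoothFn} (ha : a ∈ RapidDecay) (n : ℤ) :
    monomial a n ∈ RapidOp := fun k => by
  rw [coeff_monomial]
  split_ifs
  · exact ha
  · exact RapidDecay.zero_mem

theorem monomial_mem_multiplierOp {a : SmoothFn} (ha : a ∈ Multiplier) (n : ℤ) :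
    monomial a n ∈ MultiplierOp := fun k => by
  rw [coeff_monomial]
  split_ifs
  · exact ha
  · exact Multiplier.zero_mem

/-- The differential operators. -/
def DiffOp : Subalgebra ℝ PDO where
  carrier := {P | ∀ k, k < 0 → P.coeff k = 0}
  mul_mem' {_ Q} hP hQ k hk := by
    rw [coeff_mul, finsum_congr (g := fun _ => 0), finsum_zero]
    rintro ⟨m, i⟩
    by_cases hm : m < 0
    · simp [mulTerm, hP m hm]
    by_cases hn : k - m + (i : ℤ) < 0
    · simp [mulTerm, hQ _ hn]
    obtain ⟨m', rfl⟩ := Int.eq_ofNat_of_zero_le (not_lt.1 hm)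
    -- Here k - m' + i ≥ 0 while k < 0, so i > m' and the binomial coefficient vanishes.
    have h := Ring.choose_natCast (R := ℤ) m' i
    rw [Nat.choose_eq_zero_of_lt (by omega), Nat.cast_zero] at h
    simp only [mulTerm]
    rw [h, zero_smul]
  add_mem' hP hQ k hk := by rw [coeff_add, hP k hk, hQ k hk, add_zero]
  algebraMap_mem' c k hk := by
    rw [Algebra.algebraMap_eq_smul_one, coeff_smul, one_def, coeff_monomial_ne _ (by omega),
      smul_zero]

theorem monomial_mem_diffOp (a : SmoothFn) {n : ℤ} (hn : 0 ≤ n) : monomial a n ∈ DiffOp :=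
  fun _ hk => coeff_monomial_ne a (by omega)

theorem comm_mem_diffOp {P Q : PDO} (hP : P ∈ DiffOp) (hQ : Q ∈ DiffOp) : comm P Q ∈ DiffOp :=
  sub_mem (mul_mem hP hQ) (mul_mem hQ hP)

theorem dy_mem_diffOp {P : PDO} (hP : P ∈ DiffOp) : P.dy ∈ DiffOp := fun k hk => by
  rw [coeff_dy, hP k hk, map_zero]

theorem pos_mem_diffOp (P : PDO) : P.pos ∈ DiffOp := fun _ hk => if_neg (by omega)

theorem pos_of_mem_diffOp {P : PDO} (hP : P ∈ DiffOp) : P.pos = P := by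
  ext1; funext k
  rw [coeff_pos]
  split_ifs with h
  · rfl
  · exact (hP k (not_le.1 h)).symm

theorem OrdLE.pos {P : PDO} {N : ℤ} (hP : OrdLE P N) : OrdLE P.pos N := fun k hk => by
  rw [coeff_pos, hP k hk, ite_self]

theorem ordLE_sub_pos (P : PDO) : OrdLE (P - P.pos) (-1) := fun k hk => by
  rw [coeff_sub, coeff_pos, if_pos (by omega), sub_self]

/-- A differential P₀ contributes nothing in negative orders, so the negative part of P is that of P
- P₀. -/
theorem sub_pos_mem_rapidOp {P P₀ : PDO} (h : P - P₀ ∈ RapidOp) (h₀ : P₀ ∈ DiffOp) :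
    P - P.pos ∈ RapidOp := fun k => by
  rw [coeff_sub, coeff_pos]
  split_ifs with hk
  · rw [sub_self]
    exact RapidDecay.zero_mem
  · have := h k
    rwa [coeff_sub, h₀ k (not_le.1 hk)] at this

end PDO

open PDO

/-! ### The derivation ∇ and its injectivity. -/

theorem A₂_mem_diffOp (u : RapidDecay) : A₂ u ∈ DiffOp :=
  add_mem (monomial_mem_diffOp _ (by norm_num)) (monomial_mem_diffOp _ le_rfl)

theorem A₂_mem_multiplierOp (u : RapidDecay) : A₂ u ∈ MultiplierOp :=
  add_mem (monomial_mem_multiplierOp Multiplier.one_mem _)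
    (mem_multiplierOp_of_rapidOp (monomial_mem_rapidOp (RapidDecay.smul_mem _ u.2) _))

/-- The derivation `P ↦ P_y - [A₂, P]`. -/
def nabla (u : RapidDecay) : PDO →ₗ[ℝ] PDO :=
  dyLin - (LinearMap.mulLeft ℝ (A₂ u) - LinearMap.mulRight ℝ (A₂ u))

theorem nabla_apply (u : RapidDecay) (P : PDO) : nabla u P = P.dy - comm (A₂ u) P := rfl

theorem nabla_mul (u : RapidDecay) (P Q : PDO) :
    nabla u (P * Q) = nabla u P * Q + P * nabla u Q := by
  rw [nabla_apply, nabla_apply, nabla_apply, dy_mul, comm_eq, comm_eq, comm_eq]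
  noncomm_ring

theorem nabla_comm (u : RapidDecay) (P Q : PDO) :
    nabla u (comm P Q) = comm (nabla u P) Q + comm P (nabla u Q) := by
  rw [comm_eq, comm_eq, comm_eq, map_sub, nabla_mul, nabla_mul]
  abel

theorem nabla_one (u : RapidDecay) : nabla u 1 = 0 := by
  have h := nabla_mul u 1 1
  simpa using h

theorem nabla_mul_eq_zero {u : RapidDecay} {P Q : PDO} (hP : nabla u P = 0) (hQ : nabla u Q = 0) :
    nabla u (P * Q) = 0 := by
  rw [nabla_mul, hP, hQ, zero_mul, mul_zero, add_zero]

theorem nabla_pow_eq_zero {u : RapidDecay} {P : PDO} (hP : nabla u P = 0) (m : ℕ) :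
    nabla u (P ^ m) = 0 := by
  induction m with
  | zero => exact nabla_one u
  | succ m ih => rw [pow_succ]; exact nabla_mul_eq_zero ih hP

theorem nabla_mem_rapidOp (u : RapidDecay) {P : PDO} (hP : P ∈ RapidOp) : nabla u P ∈ RapidOp :=
  sub_mem (fun k => Dy_mem (hP k)) (comm_mem_rapidOp_right (A₂_mem_multiplierOp u) hP)

theorem nabla_mem_diffOp (u : RapidDecay) {P : PDO} (hP : P ∈ DiffOp) : nabla u P ∈ DiffOp :=
  sub_mem (dy_mem_diffOp hP) (comm_mem_diffOp (A₂_mem_diffOp u) hP)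

theorem A₂_eq (u : RapidDecay) :
    A₂ u = monomial 1 1 * monomial 1 1 + monomial ((2 : ℝ) • u.1) 0 := by
  rw [monomial_mul_monomial_one]
  rfl

/-- Expanding [∂², P] by ∂P = P∂ + P_x isolates -2 P_x ∂, the only term that can raise the order. -/
theorem nabla_eq (u : RapidDecay) (P : PDO) :
    nabla u P = P.dy - ((2 : ℝ) • (P.dx * monomial 1 1) + P.dx.dx) -
      comm (monomial ((2 : ℝ) • u.1) 0) P := by
  have h : monomial 1 1 * monomial 1 1 * P = P * (monomial 1 1 * monomial 1 1) +
      ((2 : ℝ) • (P.dx * monomial 1 1) + P.dx.dx) := by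
    rw [mul_assoc, d_mul P, mul_add, ← mul_assoc, d_mul P, d_mul P.dx, two_smul]
    noncomm_ring
  rw [nabla_apply, A₂_eq, comm_eq, comm_eq, add_mul, h]
  noncomm_ring

theorem coeff_nabla_of_ordLE (u : RapidDecay) {P : PDO} {N : ℤ} (hP : OrdLE P N) :
    (nabla u P).coeff (N + 1) = -((2 : ℝ) • Dx (P.coeff N)) := by
  have hc : OrdLE (comm (monomial ((2 : ℝ) • u.1) 0) P) N :=
    (((ordLE_monomial _ _).mul hP).mono (by omega)).sub
      ((hP.mul (ordLE_monomial _ _)).mono (by omega))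
  rw [nabla_eq]
  simp only [coeff_sub, coeff_add, coeff_smul, coeff_dy, coeff_mul_monomial_one, coeff_dx,
    add_sub_cancel_right, hP (N + 1) (by omega), hc (N + 1) (by omega), map_zero]
  simp

theorem ordLE_nabla (u : RapidDecay) {P : PDO} {N : ℤ} (hP : OrdLE P N) :
    OrdLE (nabla u P) (N + 1) := by
  intro k hk
  have h := coeff_nabla_of_ordLE u (hP.mono (M := k - 1) (by omega))
  rwa [sub_add_cancel, hP (k - 1) (by omega), map_zero, smul_zero, neg_zero] at h

/-- The leading coefficient of a decaying operator vanishes if `nabla` does not raise the order. -/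
theorem coeff_eq_zero_of_nabla {u : RapidDecay} {P : PDO} {N : ℤ} (hP : P ∈ RapidOp)
    (hN : OrdLE P N) (h : OrdLE (nabla u P) N) : P.coeff N = 0 := by
  refine eq_zero_of_Dx_eq_zero (hP N) ?_
  have h1 := coeff_nabla_of_ordLE u hN
  rw [h _ (by omega), eq_comm, neg_eq_zero] at h1
  exact (smul_eq_zero.1 h1).resolve_left two_ne_zero

/-- Starting from any a priori order bound, the coefficients above N are removed one at a time from
the top. -/
theorem ordLE_of_ordLE_nabla {u : RapidDecay} {P : PDO} {N : ℤ} (hP : P ∈ RapidOp)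
    (h : OrdLE (nabla u P) (N + 1)) : OrdLE P N := by
  obtain ⟨M, hM⟩ := P.exists_ordLE
  have key : ∀ d : ℕ, OrdLE P (N + d) → OrdLE P N := by
    intro d
    induction d with
    | zero => intro h; simpa using h
    | succ d ih =>
      intro hd
      refine ih fun k hk => ?_
      by_cases hk' : k = N + (d + 1 : ℕ)
      · rw [hk']
        exact coeff_eq_zero_of_nabla hP hd (h.mono (by push_cast; omega))
      · exact hd k (by push_cast at hk' ⊢; omega)
  exact key (M - N).toNat (hM.mono (by omega))

theorem eq_zero_of_nabla_eq_zero {u : RapidDecay} {P : PDO} (hP : P ∈ RapidOp)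
    (h : nabla u P = 0) : P = 0 := by
  ext1; funext k
  exact ordLE_of_ordLE_nabla (u := u) (N := k - 1) hP (by rw [h]; exact ordLE_zero _) k (by omega)

theorem eq_of_nabla_eq {u : RapidDecay} {P Q : PDO} (h : P - Q ∈ RapidOp)
    (hn : nabla u P = nabla u Q) : P = Q :=
  sub_eq_zero.1 (eq_zero_of_nabla_eq_zero (u := u) h (by rw [map_sub, hn, sub_self]))

/-- The bound on ∇P forces P to have order at most -1, where a differential operator has no
coefficients. This yields uniqueness of the flows and their Lie products. -/
theorem eq_zero_of_mem_diffOp {u : RapidDecay} {P : PDO} (hP : P ∈ RapidOp) (hd : P ∈ DiffOp)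
    (h : OrdLE (nabla u P) 0) : P = 0 := by
  ext1; funext k
  by_cases hk : k < 0
  · exact hd k hk
  · exact ordLE_of_ordLE_nabla (N := -1) hP h k (by omega)

/-! ### Polynomial dependence on a parameter. -/

/-- The value at 2ε minus 2^n times the value at ε eliminates the top coefficient and multiplies
each lower one by 2^i - 2^n ≠ 0. -/
theorem mem_of_forall_sum_mem {V : Type*} [AddCommGroup V] [Module ℝ V] (W : Submodule ℝ V)
    (n : ℕ) : ∀ b : ℕ → V, (∀ ε : ℝ, ∑ i ∈ Finset.range n, ε ^ i • b i ∈ W) →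
      ∀ i < n, b i ∈ W := by
  induction n with
  | zero => intro b _ i hi; omega
  | succ n ih =>
    intro b h
    have hlt : ∀ i < n, b i ∈ W := by
      intro i hi
      have h1 : ((2 : ℝ) ^ i - 2 ^ n) • b i ∈ W := by
        refine ih (fun i => ((2 : ℝ) ^ i - 2 ^ n) • b i) (fun ε => ?_) i hi
        have h2 := W.sub_mem (h (2 * ε)) (W.smul_mem ((2 : ℝ) ^ n) (h ε))
        rw [Finset.smul_sum, ← Finset.sum_sub_distrib, Finset.sum_range_succ] at h2
        convert h2 using 1
        rw [mul_pow, mul_smul, sub_self, add_zero]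
        refine Finset.sum_congr rfl fun i _ => ?_
        rw [mul_pow, mul_smul, sub_smul, smul_sub, smul_comm (ε ^ i), smul_comm (ε ^ i)]
      have h3 : (2 : ℝ) ^ i - 2 ^ n ≠ 0 := by
        have := pow_lt_pow_right₀ (one_lt_two (α := ℝ)) hi
        linarith
      exact (W.smul_mem_iff h3).1 h1
    intro i hi
    rcases Nat.lt_succ_iff_lt_or_eq.1 hi with h' | rfl
    · exact hlt i h'
    · have h1 := h 1
      simp only [one_pow, one_smul] at h1
      rw [Finset.sum_range_succ] at h1
      exact (W.add_mem_iff_right (W.sum_mem fun j hj => hlt j (Finset.mem_range.1 hj))).1 h1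

/-- `f` is polynomial in `ε`, with derivative `a` at `ε = 0`. -/
def HasPolyDeriv (f : ℝ → SmoothFn) (a : SmoothFn) : Prop :=
  ∃ p : Polynomial SmoothFn, (∀ ε, f ε = p.eval (algebraMap ℝ SmoothFn ε)) ∧ a = p.coeff 1

namespace HasPolyDeriv

variable {f g : ℝ → SmoothFn} {a b : SmoothFn}

theorem const (c : SmoothFn) : HasPolyDeriv (fun _ => c) 0 :=
  ⟨Polynomial.C c, fun ε => by simp, by simp⟩

theorem smul_const (c : SmoothFn) : HasPolyDeriv (fun ε => ε • c) c :=
  ⟨Polynomial.X * Polynomial.C c, fun ε => by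
    rw [Polynomial.eval_mul, Polynomial.eval_X, Polynomial.eval_C]
    exact Algebra.smul_def ε c, by simp⟩

theorem congr (hf : HasPolyDeriv f a) (h : ∀ ε, g ε = f ε) : HasPolyDeriv g a := by
  rwa [funext h]

theorem add (hf : HasPolyDeriv f a) (hg : HasPolyDeriv g b) :
    HasPolyDeriv (fun ε => f ε + g ε) (a + b) := by
  obtain ⟨p, hp, rfl⟩ := hf
  obtain ⟨q, hq, rfl⟩ := hg
  exact ⟨p + q, fun ε => by simp only [Polynomial.eval_add, hp, hq], by rw [Polynomial.coeff_add]⟩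

theorem sub (hf : HasPolyDeriv f a) (hg : HasPolyDeriv g b) :
    HasPolyDeriv (fun ε => f ε - g ε) (a - b) := by
  obtain ⟨p, hp, rfl⟩ := hf
  obtain ⟨q, hq, rfl⟩ := hg
  exact ⟨p - q, fun ε => by simp only [Polynomial.eval_sub, hp, hq], by rw [Polynomial.coeff_sub]⟩

theorem mul (hf : HasPolyDeriv f a) (hg : HasPolyDeriv g b) :
    HasPolyDeriv (fun ε => f ε * g ε) (a * g 0 + f 0 * b) := by
  obtain ⟨p, hp, rfl⟩ := hf
  obtain ⟨q, hq, rfl⟩ := hg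
  refine ⟨p * q, fun ε => by simp only [Polynomial.eval_mul, hp, hq], ?_⟩
  rw [hp, hq, map_zero, ← Polynomial.coeff_zero_eq_eval_zero, ← Polynomial.coeff_zero_eq_eval_zero,
    Polynomial.mul_coeff_one]
  ring

theorem linearMap (T : SmoothFn →ₗ[ℝ] SmoothFn) (hf : HasPolyDeriv f a) :
    HasPolyDeriv (fun ε => T (f ε)) (T a) := by
  obtain ⟨p, hp, rfl⟩ := hf
  refine ⟨∑ i ∈ Finset.range (p.natDegree + 1), Polynomial.monomial i (T (p.coeff i)),
    fun ε => ?_, ?_⟩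
  · simp only [hp]
    rw [Polynomial.eval_eq_sum_range, map_sum, Polynomial.eval_finsetSum]
    refine Finset.sum_congr rfl fun i _ => ?_
    rw [Polynomial.eval_monomial, ← map_pow, mul_comm, ← Algebra.smul_def, map_smul,
      mul_comm, ← Algebra.smul_def]
  · simp only [Polynomial.finsetSum_coeff, Polynomial.coeff_monomial, Finset.sum_ite_eq',
      Finset.mem_range]
    split_ifs with h
    · rfl
    · rw [Polynomial.coeff_eq_zero_of_natDegree_lt (by omega), map_zero]

theorem zsmul (n : ℤ) (hf : HasPolyDeriv f a) : HasPolyDeriv (fun ε => n • f ε) (n • a) := by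
  have := hf.linearMap ((n : ℝ) • LinearMap.id)
  simpa only [LinearMap.smul_apply, LinearMap.id_apply, Int.cast_smul_eq_zsmul] using this

theorem sum {ι : Type*} (s : Finset ι) {f : ι → ℝ → SmoothFn} {a : ι → SmoothFn}
    (h : ∀ i ∈ s, HasPolyDeriv (f i) (a i)) :
    HasPolyDeriv (fun ε => ∑ i ∈ s, f i ε) (∑ i ∈ s, a i) := by
  classical
  induction s using Finset.induction_on with
  | empty => exact const 0
  | insert i s hi ih =>
    simp only [Finset.sum_insert hi]
    exact (h i (Finset.mem_insert_self _ _)).add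
      (ih fun j hj => h j (Finset.mem_insert_of_mem hj))

/-- Evaluation at a point. -/
def evalAt (x : ℝ × ℝ) : SmoothFn →+* ℝ :=
  (Pi.evalRingHom (fun _ : ℝ × ℝ => ℝ) x).comp SmoothFn.val.toRingHom

theorem hasDerivAt (hf : HasPolyDeriv f a) (x : ℝ × ℝ) :
    HasDerivAt (fun ε => (f ε).1 x) (a.1 x) 0 := by
  obtain ⟨p, hp, rfl⟩ := hf
  have h1 : (fun ε => (f ε).1 x) = fun ε => (p.map (evalAt x)).eval ε := by
    funext ε
    rw [hp, Polynomial.eval_map, Polynomial.eval₂_eq_sum_range, Polynomial.eval_eq_sum_range]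
    change evalAt x _ = _
    rw [map_sum]
    refine Finset.sum_congr rfl fun i _ => ?_
    rw [map_mul, map_pow]
    rfl
  have h2 : (p.coeff 1).1 x = (p.map (evalAt x)).derivative.eval 0 := by
    rw [← Polynomial.coeff_zero_eq_eval_zero, Polynomial.coeff_derivative, Polynomial.coeff_map]
    simp [evalAt]
  rw [h1, h2]
  exact Polynomial.hasDerivAt _ _

theorem unique (hf : HasPolyDeriv f a) (hg : HasPolyDeriv f b) : a = b :=
  Subtype.ext (funext fun x => (hf.hasDerivAt x).unique (hg.hasDerivAt x))

/-- A pointwise derivative of decaying functions need not decay; a coefficient of a polynomial curve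
does, being recoverable linearly from the values. -/
theorem mem (W : Submodule ℝ SmoothFn) (hf : HasPolyDeriv f a) (h : ∀ ε, f ε ∈ W) : a ∈ W := by
  obtain ⟨p, hp, rfl⟩ := hf
  -- The bound `natDegree + 2` keeps index 1 in range even for constant polynomials.
  refine mem_of_forall_sum_mem W (p.natDegree + 2) p.coeff (fun ε => ?_) 1 (by omega)
  have h1 := h ε
  rw [hp, Polynomial.eval_eq_sum_range' (n := p.natDegree + 2) (by omega)] at h1
  convert h1 using 2 with i
  rw [← map_pow, mul_comm, ← Algebra.smul_def]

end HasPolyDeriv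

/-- The operators `F ε` are of bounded order and polynomial in `ε` (coefficientwise), with
derivative `F'` at `ε = 0`. -/
def HasOpPolyDeriv (F : ℝ → PDO) (F' : PDO) : Prop :=
  (∃ N, (∀ ε, OrdLE (F ε) N) ∧ OrdLE F' N) ∧
    ∀ k, HasPolyDeriv (fun ε => (F ε).coeff k) (F'.coeff k)

namespace HasOpPolyDeriv

variable {F G : ℝ → PDO} {F' G' : PDO}

theorem const (P : PDO) : HasOpPolyDeriv (fun _ => P) 0 := by
  obtain ⟨N, hN⟩ := P.exists_ordLE
  exact ⟨⟨N, fun _ => hN, ordLE_zero N⟩, fun k => HasPolyDeriv.const _⟩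

theorem common_ordLE (hF : HasOpPolyDeriv F F') (hG : HasOpPolyDeriv G G') :
    ∃ N, ((∀ ε, OrdLE (F ε) N) ∧ OrdLE F' N) ∧ (∀ ε, OrdLE (G ε) N) ∧ OrdLE G' N := by
  obtain ⟨N, hN, hN'⟩ := hF.1
  obtain ⟨M, hM, hM'⟩ := hG.1
  exact ⟨max N M, ⟨fun ε => (hN ε).mono (le_max_left _ _), hN'.mono (le_max_left _ _)⟩,
    fun ε => (hM ε).mono (le_max_right _ _), hM'.mono (le_max_right _ _)⟩

theorem add (hF : HasOpPolyDeriv F F') (hG : HasOpPolyDeriv G G') :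
    HasOpPolyDeriv (fun ε => F ε + G ε) (F' + G') := by
  obtain ⟨N, ⟨h1, h2⟩, h3, h4⟩ := hF.common_ordLE hG
  exact ⟨⟨N, fun ε => (h1 ε).add (h3 ε), h2.add h4⟩, fun k => (hF.2 k).add (hG.2 k)⟩

theorem sub (hF : HasOpPolyDeriv F F') (hG : HasOpPolyDeriv G G') :
    HasOpPolyDeriv (fun ε => F ε - G ε) (F' - G') := by
  obtain ⟨N, ⟨h1, h2⟩, h3, h4⟩ := hF.common_ordLE hG
  exact ⟨⟨N, fun ε => (h1 ε).sub (h3 ε), h2.sub h4⟩, fun k => (hF.2 k).sub (hG.2 k)⟩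

theorem mul (hF : HasOpPolyDeriv F F') (hG : HasOpPolyDeriv G G') :
    HasOpPolyDeriv (fun ε => F ε * G ε) (F' * G 0 + F 0 * G') := by
  obtain ⟨N, ⟨h1, h2⟩, h3, h4⟩ := hF.common_ordLE hG
  refine ⟨⟨N + N, fun ε => (h1 ε).mul (h3 ε), (h2.mul (h3 0)).add ((h1 0).mul h4)⟩, fun k => ?_⟩
  rw [coeff_add, coeff_mul_eq_sum h2 (h3 0), coeff_mul_eq_sum (h1 0) h4, ← Finset.sum_add_distrib]
  have : (fun ε => (F ε * G ε).coeff k) =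
      fun ε => ∑ q ∈ mulBox N N k, mulTerm (F ε) (G ε) k q :=
    funext fun ε => coeff_mul_eq_sum (h1 ε) (h3 ε) k
  rw [this]
  refine HasPolyDeriv.sum _ fun q _ => ?_
  simp only [mulTerm]
  rw [← smul_add]
  exact ((hF.2 _).mul ((hG.2 _).linearMap _)).zsmul _

theorem comm (hF : HasOpPolyDeriv F F') (hG : HasOpPolyDeriv G G') :
    HasOpPolyDeriv (fun ε => comm (F ε) (G ε)) (PDO.comm F' (G 0) + PDO.comm (F 0) G') := by
  have h := (hF.mul hG).sub (hG.mul hF)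
  have e : PDO.comm F' (G 0) + PDO.comm (F 0) G' =
      F' * G 0 + F 0 * G' - (G' * F 0 + G 0 * F') := by
    rw [comm_eq, comm_eq]
    abel
  rw [e]
  exact h

theorem dy (hF : HasOpPolyDeriv F F') : HasOpPolyDeriv (fun ε => (F ε).dy) F'.dy := by
  obtain ⟨⟨N, h1, h2⟩, h⟩ := hF
  exact ⟨⟨N, fun ε => (h1 ε).dy, h2.dy⟩, fun k => (h k).linearMap Dy⟩

theorem pos (hF : HasOpPolyDeriv F F') : HasOpPolyDeriv (fun ε => (F ε).pos) F'.pos := by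
  obtain ⟨⟨N, h1, h2⟩, h⟩ := hF
  refine ⟨⟨N, fun ε => (h1 ε).pos, h2.pos⟩, fun k => ?_⟩
  by_cases hk : 0 ≤ k
  · simpa only [coeff_pos, if_pos hk] using h k
  · simpa only [coeff_pos, if_neg hk] using HasPolyDeriv.const 0

theorem monomial {f : ℝ → SmoothFn} {a : SmoothFn} (hf : HasPolyDeriv f a) (n : ℤ) :
    HasOpPolyDeriv (fun ε => monomial (f ε) n) (PDO.monomial a n) := by
  refine ⟨⟨n, fun ε => ordLE_monomial _ n, ordLE_monomial _ n⟩, fun k => ?_⟩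
  by_cases hk : k = n
  · simpa only [coeff_monomial, if_pos hk] using hf
  · simpa only [coeff_monomial, if_neg hk] using HasPolyDeriv.const 0

theorem unique (hF : HasOpPolyDeriv F F') (hG : HasOpPolyDeriv F G') : F' = G' := by
  ext1; funext k
  exact (hF.2 k).unique (hG.2 k)

theorem mem_rapidOp (hF : HasOpPolyDeriv F F') (h : ∀ ε, F ε ∈ RapidOp) : F' ∈ RapidOp :=
  fun k => (hF.2 k).mem RapidDecay fun ε => h ε k

theorem mem_diffOp (hF : HasOpPolyDeriv F F') (h : ∀ ε, F ε ∈ DiffOp) : F' ∈ DiffOp :=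
  fun k hk => (hF.2 k).mem ⊥ fun ε => h ε k hk

end HasOpPolyDeriv

theorem hasOpPolyDeriv_A₂ (u g : RapidDecay) :
    HasOpPolyDeriv (fun ε => A₂ (u + ε • g)) (monomial ((2 : ℝ) • g.1) 0) := by
  have h1 : HasPolyDeriv (fun ε : ℝ => (2 : ℝ) • (u.1 + ε • g.1)) ((2 : ℝ) • g.1) := by
    have h := ((HasPolyDeriv.const u.1).add (HasPolyDeriv.smul_const g.1)).linearMap
      ((2 : ℝ) • LinearMap.id)
    simpa using h
  have h2 := (HasOpPolyDeriv.const (monomial 1 2)).add (HasOpPolyDeriv.monomial h1 0)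
  rw [zero_add] at h2
  exact h2

/-- The derivation itself moves with u through A₂, whose variation 2g produces the commutator term.
-/
theorem HasOpPolyDeriv.nabla {F : ℝ → PDO} {F' : PDO} (hF : HasOpPolyDeriv F F')
    (u g : RapidDecay) : HasOpPolyDeriv (fun ε => nabla (u + ε • g) (F ε))
      (nabla u F' - PDO.comm (PDO.monomial ((2 : ℝ) • g.1) 0) (F 0)) := by
  have h := hF.dy.sub ((hasOpPolyDeriv_A₂ u g).comm hF)
  have e : KP.nabla u F' - PDO.comm (PDO.monomial ((2 : ℝ) • g.1) 0) (F 0) =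
      F'.dy - (PDO.comm (PDO.monomial ((2 : ℝ) • g.1) 0) (F 0) +
        PDO.comm (A₂ (u + (0 : ℝ) • g)) F') := by
    rw [zero_smul, add_zero, nabla_apply]
    abel
  rw [e]
  exact h

/-- The operators `F ε` are of bounded order and polynomial in `ε`. -/
def IsPolyCurve (F : ℝ → PDO) : Prop := ∃ F', HasOpPolyDeriv F F'

theorem isPolyCurve_of_coeff {F : ℝ → PDO} {N : ℤ} (hN : ∀ ε, OrdLE (F ε) N)
    (h : ∀ k, ∃ a, HasPolyDeriv (fun ε => (F ε).coeff k) a) : IsPolyCurve F := by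
  choose a ha using h
  have h0 : ∀ k, N < k → a k = 0 := fun k hk =>
    (ha k).mem ⊥ fun ε => hN ε k hk
  exact ⟨⟨a, N, h0⟩, ⟨N, hN, h0⟩, ha⟩

/-! ### Solving ∇P = R order by order. -/

section Solution

variable (J : SmoothFn →ₗ[ℝ] SmoothFn) (v : RapidDecay) (N : ℤ) (R : PDO)

/-- What remains of `R` after solving `nabla v P = R` for the `j` leading coefficients of `P`. -/
def residual : ℕ → PDO
  | 0 => R
  | j + 1 => residual j -
    nabla v (monomial (-((1 / 2 : ℝ) • J ((residual j).coeff (N - j + 1)))) (N - j))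

/-- The coefficient of `∂^(N-j)` in the solution of `nabla v P = R`. -/
def solutionCoeff (j : ℕ) : SmoothFn :=
  -((1 / 2 : ℝ) • J ((residual J v N R j).coeff (N - j + 1)))

/-- The solution of order `N` of `nabla v P = R`. -/
def solution : PDO where
  coeff k := if k ≤ N then solutionCoeff J v N R (N - k).toNat else 0
  bdd := ⟨N, fun k hk => if_neg (by omega)⟩

variable {J v N R}

theorem solutionCoeff_mem (hJ : ∀ f ∈ RapidDecay, J f ∈ RapidDecay ∧ Dx (J f) = f) {j : ℕ}
    (h : residual J v N R j ∈ RapidOp) : solutionCoeff J v N R j ∈ RapidDecay :=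
  neg_mem (RapidDecay.smul_mem _ (hJ _ (h _)).1)

/-- The factor -1/2 in `solutionCoeff` undoes the -2 of `coeff_nabla_of_ordLE`, so each step cancels
exactly the leading coefficient of the residual. -/
theorem residual_spec (hJ : ∀ f ∈ RapidDecay, J f ∈ RapidDecay ∧ Dx (J f) = f)
    (hR : R ∈ RapidOp) (hN : OrdLE R (N + 1)) (j : ℕ) :
    residual J v N R j ∈ RapidOp ∧ OrdLE (residual J v N R j) (N - j + 1) := by
  induction j with
  | zero => exact ⟨hR, by simpa [residual] using hN⟩
  | succ j ih =>
    have hm := solutionCoeff_mem hJ ih.1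
    refine ⟨sub_mem ih.1 (nabla_mem_rapidOp v (monomial_mem_rapidOp hm _)), fun k hk => ?_⟩
    have ho := ordLE_monomial (solutionCoeff J v N R j) (N - j)
    change (residual J v N R j).coeff k -
      (nabla v (monomial (solutionCoeff J v N R j) (N - j))).coeff k = 0
    by_cases hk' : k = N - j + 1
    · rw [hk', coeff_nabla_of_ordLE v ho, coeff_monomial_self, solutionCoeff, map_neg, map_smul,
        (hJ _ (ih.1 _)).2, smul_neg, neg_neg, smul_smul]
      norm_num
    · push_cast at hk
      rw [ih.2 k (by omega), ordLE_nabla v ho k (by omega), sub_zero]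

theorem residual_eq (j : ℕ) : residual J v N R j =
    R - nabla v (∑ i ∈ Finset.range j, monomial (solutionCoeff J v N R i) (N - i)) := by
  induction j with
  | zero => simp [residual]
  | succ j ih =>
    rw [residual, Finset.sum_range_succ, map_add, ← sub_sub, ← ih]
    rfl

theorem ordLE_solution : OrdLE (solution J v N R) N := fun _ hk => if_neg (by omega)

theorem solution_mem (hJ : ∀ f ∈ RapidDecay, J f ∈ RapidDecay ∧ Dx (J f) = f)
    (hR : R ∈ RapidOp) (hN : OrdLE R (N + 1)) : solution J v N R ∈ RapidOp := by
  intro k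
  change (if k ≤ N then solutionCoeff J v N R (N - k).toNat else 0) ∈ RapidDecay
  split_ifs
  · exact solutionCoeff_mem hJ (residual_spec hJ hR hN _).1
  · exact RapidDecay.zero_mem

/-- After j steps the residual has order at most N - j + 1, and so has ∇ of the unsolved tail; the
defect thus has order below every integer. -/
theorem nabla_solution (hJ : ∀ f ∈ RapidDecay, J f ∈ RapidDecay ∧ Dx (J f) = f)
    (hR : R ∈ RapidOp) (hN : OrdLE R (N + 1)) : nabla v (solution J v N R) = R := by
  have key : ∀ j : ℕ, OrdLE (R - nabla v (solution J v N R)) (N - j + 1) := by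
    intro j
    set S := ∑ i ∈ Finset.range j, monomial (solutionCoeff J v N R i) (N - i) with hS
    have h1 : R - nabla v (solution J v N R) =
        residual J v N R j - nabla v (solution J v N R - S) := by
      rw [residual_eq, map_sub]
      abel
    rw [h1]
    refine (residual_spec hJ hR hN j).2.sub (ordLE_nabla v fun k hk => ?_)
    rw [coeff_sub, hS, coeff_sum]
    simp only [coeff_monomial]
    change (if k ≤ N then solutionCoeff J v N R (N - k).toNat else 0) - _ = 0
    split_ifs with hkN
    · rw [Finset.sum_eq_single (N - k).toNat]
      · rw [if_pos (by omega), sub_self]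
      · intro i _ hi
        exact if_neg (by omega)
      · intro h
        exact absurd (Finset.mem_range.2 (by omega)) h
    · rw [Finset.sum_eq_zero, sub_zero]
      intro i _
      exact if_neg (by omega)
  refine (sub_eq_zero.1 ?_).symm
  ext1; funext k
  exact key (N + 1 - k + 1).toNat k (by omega)

end Solution

/-- Each step uses only a coefficient, the linear map J, ∇ and a subtraction, all of which preserve
polynomial dependence on ε. -/
theorem isPolyCurve_residual (J : SmoothFn →ₗ[ℝ] SmoothFn) (u g : RapidDecay) (N : ℤ)
    {R : ℝ → PDO} (hR : IsPolyCurve R) (j : ℕ) :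
    IsPolyCurve fun ε => residual J (u + ε • g) N (R ε) j := by
  induction j with
  | zero => exact hR
  | succ j ih =>
    obtain ⟨F', hF⟩ := ih
    have h1 := (hF.2 (N - j + 1)).linearMap (-((1 / 2 : ℝ) • J))
    exact ⟨_, hF.sub ((HasOpPolyDeriv.monomial h1 (N - j)).nabla u g)⟩

theorem isPolyCurve_solution (J : SmoothFn →ₗ[ℝ] SmoothFn) (u g : RapidDecay) (N : ℤ)
    {R : ℝ → PDO} (hR : IsPolyCurve R) :
    IsPolyCurve fun ε => solution J (u + ε • g) N (R ε) := by
  refine isPolyCurve_of_coeff (fun ε => ordLE_solution) fun k => ?_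
  by_cases hk : k ≤ N
  · obtain ⟨F', hF⟩ := isPolyCurve_residual J u g N hR (N - k).toNat
    refine ⟨_, ((hF.2 (N - (N - k).toNat + 1)).linearMap (-((1 / 2 : ℝ) • J))).congr ?_⟩
    intro ε
    exact if_pos hk
  · exact ⟨0, (HasPolyDeriv.const 0).congr fun ε => if_neg hk⟩

/-! ### Dressed operators. -/

/-- `X = X(u)` is annihilated by `nabla`, with asymptotic value `X₀`. -/
structure IsDressing (X : RapidDecay → PDO) (X₀ : PDO) : Prop where
  sub_mem : ∀ u, X u - X₀ ∈ RapidOp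
  nabla_eq : ∀ u, nabla u (X u) = 0
  poly : ∀ u g : RapidDecay, IsPolyCurve fun ε : ℝ => X (u + ε • g)

theorem mem_multiplierOp_of_sub {P P₀ : PDO} (h : P - P₀ ∈ RapidOp) (h₀ : P₀ ∈ MultiplierOp) :
    P ∈ MultiplierOp := by
  rw [← sub_add_cancel P P₀]
  exact add_mem (mem_multiplierOp_of_rapidOp h) h₀

namespace IsDressing

variable {X Y : RapidDecay → PDO} {X₀ Y₀ : PDO}

theorem one : IsDressing (fun _ => 1) 1 where
  sub_mem _ := by rw [sub_self]; exact zero_mem _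
  nabla_eq u := nabla_one u
  poly _ _ := ⟨0, HasOpPolyDeriv.const 1⟩

theorem mul (hX : IsDressing X X₀) (hY : IsDressing Y Y₀) (hX₀ : X₀ ∈ MultiplierOp)
    (hY₀ : Y₀ ∈ MultiplierOp) : IsDressing (fun u => X u * Y u) (X₀ * Y₀) where
  sub_mem u := by
    have h : X u * Y u - X₀ * Y₀ = (X u - X₀) * Y u + X₀ * (Y u - Y₀) := by noncomm_ring
    rw [h]
    exact add_mem (rapidOp_mul_mem (hX.sub_mem u) (mem_multiplierOp_of_sub (hY.sub_mem u) hY₀))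
      (multiplierOp_mul_mem hX₀ (hY.sub_mem u))
  nabla_eq u := nabla_mul_eq_zero (hX.nabla_eq u) (hY.nabla_eq u)
  poly u g := by
    obtain ⟨X', hX'⟩ := hX.poly u g
    obtain ⟨Y', hY'⟩ := hY.poly u g
    exact ⟨_, hX'.mul hY'⟩

theorem pow (hX : IsDressing X X₀) (hX₀ : X₀ ∈ MultiplierOp) (m : ℕ) :
    IsDressing (fun u => X u ^ m) (X₀ ^ m) := by
  induction m with
  | zero => simpa only [pow_zero] using one
  | succ m ih => simpa only [pow_succ] using ih.mul hX (pow_mem hX₀ m) hX₀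

theorem apply_zero (hX : IsDressing X X₀) (h : nabla 0 X₀ = 0) : X 0 = X₀ :=
  eq_of_nabla_eq (u := 0) (hX.sub_mem 0) (by rw [hX.nabla_eq, h])

/-- The variation of a dressed operator. -/
theorem exists_variation (hX : IsDressing X X₀) (u g : RapidDecay) :
    ∃ P, HasOpPolyDeriv (fun ε : ℝ => X (u + ε • g)) P ∧ P ∈ RapidOp ∧
      nabla u P = comm (monomial ((2 : ℝ) • g.1) 0) (X u) := by
  obtain ⟨P, hP⟩ := hX.poly u g
  refine ⟨P, hP, ?_, ?_⟩
  · have h := hP.sub (HasOpPolyDeriv.const X₀)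
    rw [sub_zero] at h
    exact h.mem_rapidOp fun ε => hX.sub_mem _
  · have h := hP.nabla u g
    simp only [hX.nabla_eq, zero_smul, add_zero] at h
    exact sub_eq_zero.1 (h.unique (HasOpPolyDeriv.const 0))

end IsDressing

/-- The correction X - X₀ is the solution of ∇P = -∇X₀. -/
theorem exists_isDressing {X₀ : PDO} (N : ℤ)
    (h : ∀ u, nabla u X₀ ∈ RapidOp ∧ OrdLE (nabla u X₀) (N + 1)) :
    ∃ X, IsDressing X X₀ ∧ ∀ u, OrdLE (X u - X₀) N := by
  obtain ⟨J, hJ⟩ := exists_invDx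
  have hR : ∀ u, -nabla u X₀ ∈ RapidOp := fun u => neg_mem (h u).1
  have hN : ∀ u, OrdLE (-nabla u X₀) (N + 1) := fun u => (h u).2.neg
  refine ⟨fun u => X₀ + solution J u N (-nabla u X₀), ⟨fun u => ?_, fun u => ?_, fun u g => ?_⟩,
    fun u => ?_⟩
  · rw [add_sub_cancel_left]
    exact solution_mem hJ (hR u) (hN u)
  · rw [map_add, nabla_solution hJ (hR u) (hN u), add_neg_cancel]
  · have h1 := (HasOpPolyDeriv.const 0).sub ((HasOpPolyDeriv.const X₀).nabla u g)
    simp only [zero_sub] at h1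
    obtain ⟨F', hF'⟩ := isPolyCurve_solution J u g N ⟨_, h1⟩
    exact ⟨_, (HasOpPolyDeriv.const X₀).add hF'⟩
  · rw [add_sub_cancel_left]
    exact ordLE_solution

/-! ### The Lax operator. -/

theorem nabla_d (u : RapidDecay) :
    nabla u (monomial 1 1) = monomial ((2 : ℝ) • Dx u.1) 0 := by
  have h := d_mul (monomial ((2 : ℝ) • u.1) 0)
  rw [dx_monomial, map_smul] at h
  rw [nabla_eq, comm_eq, h, dy_monomial, Dy_one, dx_monomial, Dx_one, dx_monomial, map_zero,
    monomial_zero, zero_mul]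
  simp

/-- The normalisation of the ∂⁻¹ coefficient is automatic: with c that coefficient, order 0 of ∇L =
0 reads 2 u_x - 2 c_x = 0, and decay gives c = u. -/
theorem isLaxOperator_iff {L : RapidDecay → PDO} : IsLaxOperator L ↔
    ∀ u, L u - monomial 1 1 ∈ RapidOp ∧ OrdLE (L u - monomial 1 1) (-1) ∧ nabla u (L u) = 0 := by
  constructor
  · intro h u
    have h1 : ∀ k, -1 < k → (L u - monomial 1 1).coeff k = 0 := by
      intro k hk
      rw [coeff_sub]
      rcases lt_trichotomy k 1 with hk' | rfl | hk'
      · obtain rfl : k = 0 := by omega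
        rw [h.coeff_zero, coeff_monomial_ne _ (by norm_num), sub_zero]
      · rw [h.coeff_one, coeff_monomial_self, sub_self]
      · rw [h.coeff_of_gt u k hk', coeff_monomial_ne _ (by omega), sub_zero]
    refine ⟨fun k => ?_, h1, ?_⟩
    · by_cases hk : k < 0
      · rw [coeff_sub, coeff_monomial_ne _ (by omega), sub_zero]
        exact h.coeff_neg u k hk
      · rw [h1 k (by omega)]
        exact RapidDecay.zero_mem
    · rw [nabla_apply, h.compat_y, sub_self]
  · intro h
    have h1 : ∀ u k, -1 < k → (L u).coeff k = (monomial 1 1 : PDO).coeff k :=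
      fun u k hk => sub_eq_zero.1 ((h u).2.1 k hk)
    have h2 : ∀ u k, k ≠ 1 → (L u).coeff k = (L u - monomial 1 1).coeff k := fun u k hk => by
      rw [coeff_sub, coeff_monomial_ne _ hk, sub_zero]
    refine ⟨fun u k hk => ?_, fun u => ?_, fun u => ?_, fun u => ?_, fun u k hk => ?_, fun u => ?_⟩
    · rw [h1 u k (by omega), coeff_monomial_ne _ (by omega)]
    · rw [h1 u 1 (by omega), coeff_monomial_self]
    · rw [h1 u 0 (by omega), coeff_monomial_ne _ (by omega)]
    · have h3 := coeff_nabla_of_ordLE u (h u).2.1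
      rw [map_sub, (h u).2.2, nabla_d, zero_sub] at h3
      have h4 : Dx ((L u - monomial 1 1).coeff (-1)) = Dx u.1 := by
        have h5 : (2 : ℝ) • Dx u.1 = (2 : ℝ) • Dx ((L u - monomial 1 1).coeff (-1)) := by
          simpa using h3
        exact (smul_right_injective _ two_ne_zero h5).symm
      rw [h2 u (-1) (by norm_num)]
      refine sub_eq_zero.1 (eq_zero_of_Dx_eq_zero (sub_mem ((h u).1 _) u.2) ?_)
      rw [map_sub, h4, sub_self]
    · rw [h2 u k (by omega)]
      exact (h u).1 k
    · exact sub_eq_zero.1 (h u).2.2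

theorem d_mem_multiplierOp (n : ℤ) : monomial 1 n ∈ MultiplierOp :=
  monomial_mem_multiplierOp Multiplier.one_mem n

theorem exists_isLaxOperator : ∃ L, IsLaxOperator L ∧ IsDressing L (monomial 1 1) := by
  obtain ⟨L, hL, hL'⟩ := exists_isDressing (X₀ := monomial 1 1) (-1) fun u => by
    rw [nabla_d]
    exact ⟨monomial_mem_rapidOp (RapidDecay.smul_mem _ (Dx_mem u.2)) 0, ordLE_monomial _ _⟩
  exact ⟨L, isLaxOperator_iff.2 fun u => ⟨hL.sub_mem u, hL' u, hL.nabla_eq u⟩, hL⟩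

theorem IsLaxOperator.unique {L L' : RapidDecay → PDO} (h : IsLaxOperator L)
    (h' : IsLaxOperator L') : L = L' := by
  rw [isLaxOperator_iff] at h h'
  funext u
  refine eq_of_nabla_eq (u := u) ?_ ((h u).2.2.trans (h' u).2.2.symm)
  have e : L u - L' u = (L u - monomial 1 1) - (L' u - monomial 1 1) := by abel
  rw [e]
  exact sub_mem (h u).1 (h' u).1

theorem isLaxOperator_laxL : IsLaxOperator laxL :=
  Classical.epsilon_spec (exists_isLaxOperator.imp fun _ h => h.1)

theorem isDressing_laxL : IsDressing laxL (monomial 1 1) := by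
  obtain ⟨L, h, hL⟩ := exists_isLaxOperator
  rwa [isLaxOperator_laxL.unique h]

theorem ordLE_laxL (u : RapidDecay) : OrdLE (laxL u) 1 := isLaxOperator_laxL.coeff_of_gt u

/-! ### The Orlov–Schulman operator. -/

theorem nonisoAsymp_one : nonisoAsymp 1 = monomial ((2 : ℝ) • yFn) 1 + monomial xFn 0 := by
  simp [nonisoAsymp]

theorem dx_nonisoAsymp_one : (nonisoAsymp 1).dx = 1 := by
  rw [nonisoAsymp_one]
  ext1; funext k
  rw [coeff_dx, coeff_add, map_add, ← coeff_dx, ← coeff_dx, dx_monomial, dx_monomial, map_smul,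
    Dx_yFn, Dx_xFn, smul_zero, monomial_zero, coeff_zero, zero_add]
  rfl

/-- The relation `[∂, x + 2 y ∂] = 1`. -/
theorem d_mul_nonisoAsymp_one :
    monomial 1 1 * nonisoAsymp 1 = nonisoAsymp 1 * monomial 1 1 + 1 := by
  rw [d_mul, dx_nonisoAsymp_one]

/-- Factoring out x + 2y∂ reduces all computations with these operators to [∂, x + 2y∂] = 1. -/
theorem nonisoAsymp_succ (m : ℕ) :
    nonisoAsymp (m + 1) = nonisoAsymp 1 * monomial 1 1 ^ m := by
  rw [nonisoAsymp_one, add_mul, monomial_one_pow, monomial_mul_monomial_one,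
    monomial_mul_monomial_one, nonisoAsymp]
  push_cast
  rw [add_sub_cancel_right, add_comm (m : ℤ) 1, zero_add]

theorem nonisoAsymp_one_mem_multiplierOp : nonisoAsymp 1 ∈ MultiplierOp := by
  rw [nonisoAsymp_one]
  exact add_mem (monomial_mem_multiplierOp (Multiplier.smul_mem yFn_mem_multiplier _) _)
    (monomial_mem_multiplierOp xFn_mem_multiplier _)

theorem nonisoAsymp_one_mem_diffOp : nonisoAsymp 1 ∈ DiffOp := by
  rw [nonisoAsymp_one]
  exact add_mem (monomial_mem_diffOp _ (by norm_num)) (monomial_mem_diffOp _ le_rfl)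

theorem ordLE_nonisoAsymp_one : OrdLE (nonisoAsymp 1) 1 := by
  rw [nonisoAsymp_one]
  exact (ordLE_monomial _ _).add ((ordLE_monomial _ _).mono (by norm_num))

/-- The coefficient 2y is tuned so that the y-derivative 2∂ cancels [∂², x] = 2∂; only the
commutator with 2u survives. -/
theorem nabla_nonisoAsymp_one (u : RapidDecay) :
    nabla u (nonisoAsymp 1) = -comm (monomial ((2 : ℝ) • u.1) 0) (nonisoAsymp 1) := by
  have h : (nonisoAsymp 1).dy = (2 : ℝ) • monomial 1 1 := by
    rw [nonisoAsymp_one]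
    ext1; funext k
    rw [coeff_dy, coeff_add, map_add, ← coeff_dy, ← coeff_dy, dy_monomial, dy_monomial, map_smul,
      Dy_yFn, Dy_xFn, monomial_zero, coeff_zero, add_zero, monomial_smul]
  rw [nabla_eq, h, dx_nonisoAsymp_one, one_def, dx_monomial, Dx_one, monomial_zero, ← one_def,
    one_mul, add_zero, sub_self, zero_sub]

theorem exists_orlov : ∃ M, IsDressing M (nonisoAsymp 1) ∧ ∀ u, OrdLE (M u) 1 := by
  obtain ⟨M, hM, hM'⟩ := exists_isDressing (X₀ := nonisoAsymp 1) 0 fun u => by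
    rw [nabla_nonisoAsymp_one]
    have h := ordLE_monomial ((2 : ℝ) • u.1) 0
    exact ⟨neg_mem (comm_mem_rapidOp_left
      (monomial_mem_rapidOp (RapidDecay.smul_mem _ u.2) 0) nonisoAsymp_one_mem_multiplierOp),
      ((h.mul ordLE_nonisoAsymp_one).sub ((ordLE_nonisoAsymp_one.mul h).mono (by norm_num))).neg⟩
  refine ⟨M, hM, fun u => ?_⟩
  rw [← sub_add_cancel (M u) (nonisoAsymp 1)]
  exact ((hM' u).mono (by norm_num)).add ordLE_nonisoAsymp_one

/-- The Orlov–Schulman operator, with asymptotic value `x + 2 y ∂`. -/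
def orlov : RapidDecay → PDO := exists_orlov.choose

theorem isDressing_orlov : IsDressing orlov (nonisoAsymp 1) := exists_orlov.choose_spec.1

theorem ordLE_orlov (u : RapidDecay) : OrdLE (orlov u) 1 := exists_orlov.choose_spec.2 u

theorem comm_sub_comm (P Q P₀ Q₀ : PDO) :
    comm P Q - comm P₀ Q₀ = comm (P - P₀) Q + comm P₀ (Q - Q₀) := by
  simp only [comm_eq]
  noncomm_ring

theorem comm_sub_comm_mem_rapidOp {P Q P₀ Q₀ : PDO} (hP : P - P₀ ∈ RapidOp)
    (hQ : Q - Q₀ ∈ RapidOp) (hP₀ : P₀ ∈ MultiplierOp) (hQ₀ : Q₀ ∈ MultiplierOp) :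
    comm P Q - comm P₀ Q₀ ∈ RapidOp := by
  rw [comm_sub_comm]
  exact add_mem (comm_mem_rapidOp_left hP (mem_multiplierOp_of_sub hQ hQ₀))
    (comm_mem_rapidOp_right hP₀ hQ)

/-- Both sides are killed by ∇ and share the asymptotic value [∂, x + 2y∂] = 1. -/
theorem comm_laxL_orlov (u : RapidDecay) : comm (laxL u) (orlov u) = 1 := by
  have h0 : comm (monomial 1 1) (nonisoAsymp 1) = 1 := by
    rw [comm_eq, d_mul_nonisoAsymp_one, add_sub_cancel_left]
  refine eq_of_nabla_eq (u := u) ?_ ?_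
  · have := comm_sub_comm_mem_rapidOp (isDressing_laxL.sub_mem u) (isDressing_orlov.sub_mem u)
      (d_mem_multiplierOp 1) nonisoAsymp_one_mem_multiplierOp
    rwa [h0] at this
  · rw [nabla_comm, isDressing_laxL.nabla_eq, isDressing_orlov.nabla_eq, nabla_one]
    simp [comm_eq]

/-! ### Differential operators and the flows they define. -/

/-- `X = X(u)` is a differential operator with asymptotic value `X₀`, and
`X_y - [A₂, X] = 2 φ`. -/
structure IsFlowPair (X : RapidDecay → PDO) (X₀ : PDO) (φ : RapidDecay → RapidDecay) : Prop where
  mem_diffOp : ∀ u, X u ∈ DiffOp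
  sub_mem : ∀ u, X u - X₀ ∈ RapidOp
  nabla_eq : ∀ u, nabla u (X u) = monomial ((2 : ℝ) • (φ u).1) 0

theorem eq_of_monomial_two_smul_eq {f g : RapidDecay}
    (h : monomial ((2 : ℝ) • f.1) 0 = monomial ((2 : ℝ) • g.1) 0) : f = g := by
  have h1 := congrArg (fun P : PDO => P.coeff 0) h
  simp only [coeff_monomial_self] at h1
  exact Subtype.ext (smul_right_injective _ two_ne_zero h1)

theorem eq_monomial_of_ordLE_zero {P : PDO} (h : OrdLE P 0) (hd : P ∈ DiffOp) :
    P = monomial (P.coeff 0) 0 := by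
  ext1; funext k
  rcases lt_trichotomy k 0 with hk | rfl | hk
  · rw [hd k hk, coeff_monomial_ne _ (by omega)]
  · rw [coeff_monomial_self]
  · rw [h k hk, coeff_monomial_ne _ (by omega)]

theorem IsFlowPair.unique {X X' : RapidDecay → PDO} {X₀ : PDO} {φ φ' : RapidDecay → RapidDecay}
    (h : IsFlowPair X X₀ φ) (h' : IsFlowPair X' X₀ φ') : X = X' ∧ φ = φ' := by
  have hX : X = X' := by
    funext u
    refine sub_eq_zero.1 (eq_zero_of_mem_diffOp (u := u) ?_
      (_root_.sub_mem (h.mem_diffOp u) (h'.mem_diffOp u)) ?_)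
    · have e : X u - X' u = (X u - X₀) - (X' u - X₀) := by abel
      rw [e]
      exact _root_.sub_mem (h.sub_mem u) (h'.sub_mem u)
    · rw [map_sub, h.nabla_eq, h'.nabla_eq]
      exact (ordLE_monomial _ _).sub (ordLE_monomial _ _)
  refine ⟨hX, funext fun u => eq_of_monomial_two_smul_eq ?_⟩
  rw [← h.nabla_eq, ← h'.nabla_eq, hX]

/-- Since ∇(Z_+) = -∇(Z - Z_+), the result is at once a differential operator and of order at most
0, hence a function. It decays because the negative part of Z does. -/
theorem IsDressing.exists_isFlowPair {Z : RapidDecay → PDO} {Z₀ : PDO} (hZ : IsDressing Z Z₀)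
    (h₀ : Z₀ ∈ DiffOp) : ∃ φ, IsFlowPair (fun u => (Z u).pos) Z₀ φ := by
  have hm : ∀ u, Z u - (Z u).pos ∈ RapidOp := fun u => sub_pos_mem_rapidOp (hZ.sub_mem u) h₀
  have hn : ∀ u, nabla u (Z u).pos = -nabla u (Z u - (Z u).pos) := fun u => by
    rw [map_sub, hZ.nabla_eq, zero_sub, neg_neg]
  have hr : ∀ u, nabla u (Z u).pos ∈ RapidOp := fun u => by
    rw [hn]
    exact neg_mem (nabla_mem_rapidOp u (hm u))
  refine ⟨fun u => ⟨(1 / 2 : ℝ) • (nabla u (Z u).pos).coeff 0, RapidDecay.smul_mem _ (hr u 0)⟩,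
    fun u => pos_mem_diffOp _, fun u => ?_, fun u => ?_⟩
  · have e : (Z u).pos - Z₀ = (Z u - Z₀) - (Z u - (Z u).pos) := by abel
    rw [e]
    exact _root_.sub_mem (hZ.sub_mem u) (hm u)
  · have h0 : OrdLE (nabla u (Z u).pos) 0 := by
      rw [hn]
      exact (ordLE_nabla u (ordLE_sub_pos _)).neg
    rw [smul_smul, show (2 : ℝ) * (1 / 2) = 1 by norm_num, one_smul]
    exact eq_monomial_of_ordLE_zero h0 (nabla_mem_diffOp u (pos_mem_diffOp _))

theorem HasOpPolyDeriv.hasOpGateaux {F : RapidDecay → PDO} {u g : RapidDecay} {P : PDO}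
    (h : HasOpPolyDeriv (fun ε : ℝ => F (u + ε • g)) P) : HasOpGateaux F u g P :=
  fun k p => (h.2 k).hasDerivAt p

theorem HasOpGateaux.unique {F : RapidDecay → PDO} {u g : RapidDecay} {P Q : PDO}
    (hP : HasOpGateaux F u g P) (hQ : HasOpGateaux F u g Q) : P = Q := by
  ext1; funext k
  exact Subtype.ext (funext fun p => (hP k p).unique (hQ k p))

/-- The Lax equation `L'[φ] = [X, L] + C` for `X = Z_+`, `[Z, L] = -C`. -/
theorem hasOpGateaux_laxL {Z : RapidDecay → PDO} {Z₀ : PDO} {φ : RapidDecay → RapidDecay}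
    (hZ : IsDressing Z Z₀) (h₀ : Z₀ ∈ DiffOp) (hφ : IsFlowPair (fun u => (Z u).pos) Z₀ φ)
    (u : RapidDecay) {C : PDO} (hC : comm (Z u) (laxL u) = -C) :
    HasOpGateaux laxL u (φ u) (comm (Z u).pos (laxL u) + C) := by
  obtain ⟨P, hP, hPr, hPn⟩ := isDressing_laxL.exists_variation u (φ u)
  have hCn : nabla u C = 0 := by
    rw [← neg_eq_iff_eq_neg.2 hC, map_neg, nabla_comm, hZ.nabla_eq, isDressing_laxL.nabla_eq]
    simp [comm_eq]
  -- This form exhibits the decay of the coefficients, which the uniqueness argument needs.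
  have hN : comm (Z u).pos (laxL u) + C = -comm (Z u - (Z u).pos) (laxL u) := by
    rw [← neg_eq_iff_eq_neg.2 hC]
    simp only [comm_eq]
    noncomm_ring
  have hr : comm (Z u).pos (laxL u) + C ∈ RapidOp := by
    rw [hN]
    exact neg_mem (comm_mem_rapidOp_left (sub_pos_mem_rapidOp (hZ.sub_mem u) h₀)
      (mem_multiplierOp_of_sub (isDressing_laxL.sub_mem u) (d_mem_multiplierOp 1)))
  have : comm (Z u).pos (laxL u) + C = P := by
    -- Both sides have image [2φ, L] under ∇.
    refine eq_of_nabla_eq (u := u) (sub_mem hr hPr) ?_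
    rw [map_add, hCn, nabla_comm, hφ.nabla_eq, isDressing_laxL.nabla_eq, hPn]
    simp [comm_eq]
  rw [this]
  exact hP.hasOpGateaux

theorem IsFlowPair.hasOpGateaux_A₂ {X : RapidDecay → PDO} {X₀ : PDO} {φ : RapidDecay → RapidDecay}
    (h : IsFlowPair X X₀ φ) (u : RapidDecay) :
    HasOpGateaux A₂ u (φ u) ((X u).dy - comm (A₂ u) (X u)) := by
  rw [← nabla_apply, h.nabla_eq]
  exact (hasOpPolyDeriv_A₂ u (φ u)).hasOpGateaux

theorem isFlowPair_of_hasAsymptotics {m : ℕ} {A : RapidDecay → PDO} {A₀ : PDO}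
    {φ : RapidDecay → RapidDecay} (h : HasAsymptotics m A A₀)
    (hyt : ∀ u, HasOpGateaux A₂ u (φ u) ((A u).dy - comm (A₂ u) (A u))) : IsFlowPair A A₀ φ where
  mem_diffOp u k hk := h.coeff_eq_zero u k (Or.inl hk)
  sub_mem u := h.sub_mem u
  nabla_eq u := (hyt u).unique (hasOpPolyDeriv_A₂ u (φ u)).hasOpGateaux

theorem IsDressing.hasAsymptotics {Z : RapidDecay → PDO} {Z₀ : PDO} {φ : RapidDecay → RapidDecay}
    {m : ℕ} (hZ : IsDressing Z Z₀) (h₀ : Z₀ ∈ DiffOp)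
    (hφ : IsFlowPair (fun u => (Z u).pos) Z₀ φ) (hn : nabla 0 Z₀ = 0)
    (hm : ∀ u, OrdLE (Z u) m) : HasAsymptotics m (fun u => (Z u).pos) Z₀ where
  coeff_eq_zero u k hk := by
    rcases hk with hk | hk
    · exact hφ.mem_diffOp u k hk
    · exact (hm u).pos k hk
  at_zero := by
    rw [hZ.apply_zero hn, pos_of_mem_diffOp h₀]
  sub_mem u := hφ.sub_mem u

/-! ### Existence and uniqueness of the Lax triads. -/

/-- `A_m = (L^m)_+`. -/
def laxPowPos (m : ℕ) (u : RapidDecay) : PDO := (laxL u ^ m).pos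

/-- `B_m = (M L^(m-1))_+`, with the Orlov–Schulman operator `M`. -/
def orlovPowPos (m : ℕ) (u : RapidDecay) : PDO := (orlov u * laxL u ^ (m - 1)).pos

theorem isDressing_laxL_pow (m : ℕ) : IsDressing (fun u => laxL u ^ m) (monomial 1 m) := by
  rw [← monomial_one_pow]
  exact isDressing_laxL.pow (d_mem_multiplierOp 1) m

theorem nonisoAsymp_eq {m : ℕ} (hm : 1 ≤ m) :
    nonisoAsymp m = nonisoAsymp 1 * monomial 1 1 ^ (m - 1) := by
  rw [← nonisoAsymp_succ, Nat.sub_add_cancel hm]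

theorem isDressing_orlov_mul {m : ℕ} (hm : 1 ≤ m) :
    IsDressing (fun u => orlov u * laxL u ^ (m - 1)) (nonisoAsymp m) := by
  rw [nonisoAsymp_eq hm]
  exact isDressing_orlov.mul (isDressing_laxL.pow (d_mem_multiplierOp 1) _)
    nonisoAsymp_one_mem_multiplierOp (pow_mem (d_mem_multiplierOp 1) _)

theorem d_mem_diffOp : (monomial 1 1 : PDO) ∈ DiffOp := monomial_mem_diffOp _ (by norm_num)

theorem nonisoAsymp_mem_diffOp {m : ℕ} (hm : 1 ≤ m) : nonisoAsymp m ∈ DiffOp := by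
  rw [nonisoAsymp_eq hm]
  exact mul_mem nonisoAsymp_one_mem_diffOp (pow_mem d_mem_diffOp _)

theorem nonisoAsymp_mem_multiplierOp {m : ℕ} (hm : 1 ≤ m) : nonisoAsymp m ∈ MultiplierOp := by
  rw [nonisoAsymp_eq hm]
  exact mul_mem nonisoAsymp_one_mem_multiplierOp (pow_mem (d_mem_multiplierOp 1) _)

theorem exists_isFlowPair_laxPowPos (m : ℕ) : ∃ φ, IsFlowPair (laxPowPos m) (monomial 1 m) φ :=
  (isDressing_laxL_pow m).exists_isFlowPair (monomial_mem_diffOp _ (by omega))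

theorem exists_isFlowPair_orlovPowPos {m : ℕ} (hm : 1 ≤ m) :
    ∃ φ, IsFlowPair (orlovPowPos m) (nonisoAsymp m) φ :=
  (isDressing_orlov_mul hm).exists_isFlowPair (nonisoAsymp_mem_diffOp hm)

theorem nabla_zero_d_pow (m : ℕ) : nabla 0 (monomial 1 1 ^ m) = 0 := by
  refine nabla_pow_eq_zero ?_ m
  rw [nabla_d, Submodule.coe_zero, map_zero, smul_zero, monomial_zero]

theorem nabla_zero_nonisoAsymp {m : ℕ} (hm : 1 ≤ m) : nabla 0 (nonisoAsymp m) = 0 := by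
  rw [nonisoAsymp_eq hm]
  refine nabla_mul_eq_zero ?_ (nabla_zero_d_pow _)
  rw [nabla_nonisoAsymp_one, Submodule.coe_zero, smul_zero, monomial_zero]
  simp [comm_eq]

theorem ordLE_laxL_pow (u : RapidDecay) (m : ℕ) : OrdLE (laxL u ^ m) m := by
  have h := (ordLE_laxL u).pow m
  rwa [pow_eq, mul_one] at h

theorem ordLE_laxL_pow_sub (u : RapidDecay) (m : ℕ) :
    OrdLE (laxL u ^ m - monomial 1 1 ^ m) (m - 1) := by
  induction m with
  | zero => rw [pow_zero, pow_zero, sub_self]; exact ordLE_zero _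
  | succ m ih =>
    have e : laxL u ^ (m + 1) - monomial 1 1 ^ (m + 1) =
        laxL u ^ m * (laxL u - monomial 1 1) +
          (laxL u ^ m - monomial 1 1 ^ m) * monomial 1 1 := by
      rw [pow_succ, pow_succ]
      noncomm_ring
    rw [e]
    refine OrdLE.add (((ordLE_laxL_pow u m).mul
      (isLaxOperator_iff.1 isLaxOperator_laxL u).2.1).mono ?_)
      ((ih.mul (ordLE_monomial _ _)).mono ?_) <;> push_cast <;> omega

theorem comm_pow_self (P : PDO) (m : ℕ) : comm (P ^ m) P = 0 := by
  rw [comm_eq, ← pow_succ, ← pow_succ', sub_self]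

/-- A consequence of [L, M] = 1; it is the source of the inhomogeneous term corresponding to η_t =
η^(m-1). -/
theorem comm_orlov_mul_laxL (u : RapidDecay) (m : ℕ) :
    comm (orlov u * laxL u ^ m) (laxL u) = -laxL u ^ m := by
  have h := comm_laxL_orlov u
  rw [comm_eq, sub_eq_iff_eq_add] at h
  rw [comm_eq, mul_assoc, ← pow_succ, pow_succ', ← mul_assoc, ← mul_assoc, h, add_mul, one_mul]
  abel

theorem isIsospectralTriad_laxPowPos {m : ℕ} {φ : RapidDecay → RapidDecay}
    (h : IsFlowPair (laxPowPos m) (monomial 1 m) φ) : IsIsospectralTriad m laxL (laxPowPos m) φ where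
  asymptotics := (isDressing_laxL_pow m).hasAsymptotics (monomial_mem_diffOp _ (by omega)) h
    (by rw [← monomial_one_pow]; exact nabla_zero_d_pow m) fun u => ordLE_laxL_pow u m
  leading u := by
    have h1 := ordLE_laxL_pow_sub u m m (by omega)
    rw [monomial_one_pow, coeff_sub, coeff_monomial_self, sub_eq_zero] at h1
    rw [laxPowPos, coeff_pos, if_pos (by omega), h1]
  compat_y := isLaxOperator_laxL.compat_y
  compat_t u := by
    have h1 := hasOpGateaux_laxL (isDressing_laxL_pow m) (monomial_mem_diffOp _ (by omega)) h u
      (C := 0) (by rw [comm_pow_self, neg_zero])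
    rwa [add_zero] at h1
  compat_yt := h.hasOpGateaux_A₂

theorem isNonisospectralTriad_orlovPowPos {m : ℕ} (hm : 1 ≤ m) {φ : RapidDecay → RapidDecay}
    (h : IsFlowPair (orlovPowPos m) (nonisoAsymp m) φ) :
    IsNonisospectralTriad m laxL (orlovPowPos m) φ where
  asymptotics := (isDressing_orlov_mul hm).hasAsymptotics (nonisoAsymp_mem_diffOp hm) h
    (nabla_zero_nonisoAsymp hm) fun u =>
      ((ordLE_orlov u).mul (ordLE_laxL_pow u (m - 1))).mono (by omega)
  compat_y := isLaxOperator_laxL.compat_y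
  compat_t u := by
    rw [pow_eq]
    exact hasOpGateaux_laxL (isDressing_orlov_mul hm) (nonisoAsymp_mem_diffOp hm) h u
      (comm_orlov_mul_laxL u _)
  compat_yt := h.hasOpGateaux_A₂

theorem IsIsospectralTriad.isFlowPair {m : ℕ} {L A : RapidDecay → PDO}
    {K : RapidDecay → RapidDecay} (h : IsIsospectralTriad m L A K) :
    IsFlowPair A (monomial 1 m) K := isFlowPair_of_hasAsymptotics h.asymptotics h.compat_yt

theorem IsNonisospectralTriad.isFlowPair {m : ℕ} {L B : RapidDecay → PDO}
    {σ : RapidDecay → RapidDecay} (h : IsNonisospectralTriad m L B σ) :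
    IsFlowPair B (nonisoAsymp m) σ := isFlowPair_of_hasAsymptotics h.asymptotics h.compat_yt

theorem isIsospectralTriad_isoTriad (m : ℕ) :
    IsIsospectralTriad m laxL (isoTriad m).1 (isoTriad m).2 := by
  obtain ⟨φ, hφ⟩ := exists_isFlowPair_laxPowPos m
  exact Classical.epsilon_spec (p := fun q : (RapidDecay → PDO) × (RapidDecay → RapidDecay) =>
    IsIsospectralTriad m laxL q.1 q.2) ⟨(_, φ), isIsospectralTriad_laxPowPos hφ⟩

theorem isNonisospectralTriad_nonisoTriad {m : ℕ} (hm : 1 ≤ m) :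
    IsNonisospectralTriad m laxL (nonisoTriad m).1 (nonisoTriad m).2 := by
  obtain ⟨φ, hφ⟩ := exists_isFlowPair_orlovPowPos hm
  exact Classical.epsilon_spec (p := fun q : (RapidDecay → PDO) × (RapidDecay → RapidDecay) =>
    IsNonisospectralTriad m laxL q.1 q.2) ⟨(_, φ), isNonisospectralTriad_orlovPowPos hm hφ⟩

theorem opA_eq (m : ℕ) : opA m = laxPowPos m := by
  obtain ⟨φ, hφ⟩ := exists_isFlowPair_laxPowPos m
  exact ((isIsospectralTriad_isoTriad m).isFlowPair.unique hφ).1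

theorem opB_eq {m : ℕ} (hm : 1 ≤ m) : opB m = orlovPowPos m := by
  obtain ⟨φ, hφ⟩ := exists_isFlowPair_orlovPowPos hm
  exact ((isNonisospectralTriad_nonisoTriad hm).isFlowPair.unique hφ).1

/-! ### Gâteaux derivatives and Lie products of the flows. -/

section Flows

local instance : AddCommGroup RapidDecay := Submodule.addCommGroup _

local instance : AddCommGroup (RapidDecay → RapidDecay) := Pi.addCommGroup

local instance : AddCommGroup flowSpan := Submodule.addCommGroup _

theorem HasGateaux.unique {f : RapidDecay → RapidDecay} {u g a b : RapidDecay}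
    (ha : HasGateaux f u g a) (hb : HasGateaux f u g b) : a = b :=
  Subtype.ext (Subtype.ext (funext fun p => (ha p).unique (hb p)))

theorem HasGateaux.add {f f' : RapidDecay → RapidDecay} {u g a a' : RapidDecay}
    (ha : HasGateaux f u g a) (ha' : HasGateaux f' u g a') : HasGateaux (f + f') u g (a + a') :=
  fun p => (ha p).add (ha' p)

theorem HasGateaux.smul (c : ℝ) {f : RapidDecay → RapidDecay} {u g a : RapidDecay}
    (ha : HasGateaux f u g a) : HasGateaux (c • f) u g (c • a) :=
  fun p => (ha p).const_mul c

theorem hasGateaux_zero (u g : RapidDecay) : HasGateaux 0 u g 0 := fun _ => hasDerivAt_const _ _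

theorem HasOpPolyDeriv.sub_const_mem {X : RapidDecay → PDO} {X₀ : PDO}
    (h : ∀ u, X u - X₀ ∈ RapidOp) {u g : RapidDecay} {P : PDO}
    (hP : HasOpPolyDeriv (fun ε : ℝ => X (u + ε • g)) P) : P ∈ RapidOp := by
  have h' := hP.sub (HasOpPolyDeriv.const X₀)
  rw [sub_zero] at h'
  exact h'.mem_rapidOp fun ε => h _

/-- The derivative of a flow, in terms of the variation of its differential operator. -/
theorem IsFlowPair.exists_hasGateaux {X : RapidDecay → PDO} {X₀ : PDO}
    {φ : RapidDecay → RapidDecay} (h : IsFlowPair X X₀ φ) {u g : RapidDecay} {P : PDO}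
    (hP : HasOpPolyDeriv (fun ε : ℝ => X (u + ε • g)) P) :
    ∃ a, HasGateaux φ u g a ∧
      nabla u P = monomial ((2 : ℝ) • a.1) 0 + comm (monomial ((2 : ℝ) • g.1) 0) (X u) := by
  have hQ := hP.nabla u g
  simp only [h.nabla_eq, zero_smul, add_zero] at hQ
  set Q := nabla u P - comm (monomial ((2 : ℝ) • g.1) 0) (X u) with hQdef
  have hc := (hQ.2 0).linearMap ((1 / 2 : ℝ) • LinearMap.id)
  simp only [coeff_monomial_self, LinearMap.smul_apply, LinearMap.id_apply, smul_smul] at hc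
  rw [show (1 / 2 : ℝ) * 2 = 1 by norm_num] at hc
  simp only [one_smul] at hc
  have ha : (1 / 2 : ℝ) • Q.coeff 0 ∈ RapidDecay := hc.mem RapidDecay fun ε => (φ _).2
  refine ⟨⟨_, ha⟩, hc.hasDerivAt, ?_⟩
  have hd : Q ∈ DiffOp := hQ.mem_diffOp fun ε => monomial_mem_diffOp _ le_rfl
  have ho : OrdLE Q 0 := fun k hk =>
    (hQ.2 k).mem ⊥ fun ε => coeff_monomial_ne _ (by omega)
  rw [smul_smul, show (2 : ℝ) * (1 / 2) = 1 by norm_num, one_smul, ← eq_monomial_of_ordLE_zero ho hd, hQdef,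
    sub_add_cancel]

/-- Linearity in the direction is not automatic for Gâteaux derivatives. Here the defect of
linearity of the operator variations is differential and decaying, and ∇ sends it to a function, so
it vanishes together with the defect for the flow. -/
theorem IsFlowPair.exists_linear_gateaux {X : RapidDecay → PDO} {X₀ : PDO}
    {φ : RapidDecay → RapidDecay} (h : IsFlowPair X X₀ φ)
    (hX : ∀ u g : RapidDecay, IsPolyCurve fun ε : ℝ => X (u + ε • g)) (u : RapidDecay) :
    ∃ d : RapidDecay →ₗ[ℝ] RapidDecay, ∀ g, HasGateaux φ u g (d g) := by
  choose P hP using hX u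
  choose d hd hn using fun g => h.exists_hasGateaux (hP g)
  have hr : ∀ g, P g ∈ RapidOp := fun g => HasOpPolyDeriv.sub_const_mem h.sub_mem (hP g)
  have hD : ∀ g, P g ∈ DiffOp := fun g => (hP g).mem_diffOp fun ε => h.mem_diffOp _
  refine ⟨⟨⟨d, fun g g' => ?_⟩, fun c g => ?_⟩, hd⟩
  · have e : nabla u (P (g + g') - (P g + P g')) =
        monomial ((2 : ℝ) • (d (g + g') - (d g + d g')).1) 0 := by
      simp only [map_sub, map_add, hn, Submodule.coe_add, Submodule.coe_sub, smul_add, smul_sub,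
        monomial_add, monomial_sub, comm_eq, add_mul, mul_add]
      abel
    have e0 := eq_zero_of_mem_diffOp (u := u) (_root_.sub_mem (hr _) (add_mem (hr _) (hr _)))
      (_root_.sub_mem (hD _) (add_mem (hD _) (hD _))) (by rw [e]; exact ordLE_monomial _ _)
    rw [e0, map_zero] at e
    refine sub_eq_zero.1 (eq_of_monomial_two_smul_eq ?_)
    rw [← e, Submodule.coe_zero, smul_zero, monomial_zero]
  · have e : nabla u (P (c • g) - c • P g) =
        monomial ((2 : ℝ) • (d (c • g) - c • d g).1) 0 := by
      simp only [map_sub, map_smul, hn, Submodule.coe_smul, Submodule.coe_sub, smul_add, smul_sub,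
        smul_comm (2 : ℝ) c, monomial_sub, monomial_smul, comm_eq, smul_mul_assoc, mul_smul_comm]
      abel
    have e0 := eq_zero_of_mem_diffOp (u := u) (_root_.sub_mem (hr _) (RapidOp.smul_mem c (hr _)))
      (_root_.sub_mem (hD _) (DiffOp.smul_mem (hD _) c)) (by rw [e]; exact ordLE_monomial _ _)
    rw [e0, map_zero] at e
    refine sub_eq_zero.1 (eq_of_monomial_two_smul_eq ?_)
    change monomial ((2 : ℝ) • (d (c • g) - c • d g).1) 0 = _
    rw [← e, Submodule.coe_zero, smul_zero, monomial_zero]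

/-- The Lie product of two flows is determined by the commutator of the asymptotic operators. -/
theorem IsFlowPair.isLieProduct {X₁ X₂ X₃ : RapidDecay → PDO} {Y₁ Y₂ Y₃ : PDO}
    {φ₁ φ₂ φ₃ : RapidDecay → RapidDecay} (h₁ : IsFlowPair X₁ Y₁ φ₁) (h₂ : IsFlowPair X₂ Y₂ φ₂)
    (h₃ : IsFlowPair X₃ Y₃ φ₃)
    (p₁ : ∀ u g : RapidDecay, IsPolyCurve fun ε : ℝ => X₁ (u + ε • g))
    (p₂ : ∀ u g : RapidDecay, IsPolyCurve fun ε : ℝ => X₂ (u + ε • g))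
    (m₁ : Y₁ ∈ MultiplierOp) (m₂ : Y₂ ∈ MultiplierOp) (c : ℝ) (hc : comm Y₁ Y₂ = c • Y₃) :
    IsLieProduct φ₁ φ₂ (c • φ₃) := by
  intro u
  obtain ⟨P₁, hP₁⟩ := p₁ u (φ₂ u)
  obtain ⟨P₂, hP₂⟩ := p₂ u (φ₁ u)
  obtain ⟨a, ha, hna⟩ := h₁.exists_hasGateaux hP₁
  obtain ⟨b, hb, hnb⟩ := h₂.exists_hasGateaux hP₂
  refine ⟨a, b, ha, hb, ?_⟩
  -- The terms [2φ₂, X₁] and [2φ₁, X₂] from the variations cancel against ∇[X₁, X₂].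
  have e : nabla u (P₁ - P₂ + comm (X₁ u) (X₂ u) - c • X₃ u) =
      monomial ((2 : ℝ) • (a - b - c • φ₃ u).1) 0 := by
    rw [map_sub, map_add, map_sub, map_smul, nabla_comm, hna, hnb, h₁.nabla_eq, h₂.nabla_eq,
      h₃.nabla_eq]
    simp only [Submodule.coe_smul, Submodule.coe_sub, smul_sub, monomial_sub, monomial_smul,
      smul_comm (2 : ℝ) c, comm_eq]
    abel
  have hr : P₁ - P₂ + comm (X₁ u) (X₂ u) - c • X₃ u ∈ RapidOp := by
    -- The relation [Y₁, Y₂] = c Y₃ enters here: it removes the non-decaying part.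
    have e1 : P₁ - P₂ + comm (X₁ u) (X₂ u) - c • X₃ u =
        P₁ - P₂ + (comm (X₁ u) (X₂ u) - comm Y₁ Y₂) - c • (X₃ u - Y₃) := by
      rw [hc, smul_sub]
      abel
    rw [e1]
    exact _root_.sub_mem (add_mem (_root_.sub_mem (HasOpPolyDeriv.sub_const_mem h₁.sub_mem hP₁)
      (HasOpPolyDeriv.sub_const_mem h₂.sub_mem hP₂))
      (comm_sub_comm_mem_rapidOp (h₁.sub_mem u) (h₂.sub_mem u) m₁ m₂))
      (RapidOp.smul_mem c (h₃.sub_mem u))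
  have hd : P₁ - P₂ + comm (X₁ u) (X₂ u) - c • X₃ u ∈ DiffOp :=
    _root_.sub_mem (add_mem (_root_.sub_mem (hP₁.mem_diffOp fun ε => h₁.mem_diffOp _)
      (hP₂.mem_diffOp fun ε => h₂.mem_diffOp _))
      (comm_mem_diffOp (h₁.mem_diffOp u) (h₂.mem_diffOp u)))
      (DiffOp.smul_mem (h₃.mem_diffOp u) c)
  have e0 := eq_zero_of_mem_diffOp (u := u) hr hd (by rw [e]; exact ordLE_monomial _ _)
  rw [e0, map_zero] at e
  have e2 : a - b - c • φ₃ u = 0 := eq_of_monomial_two_smul_eq (by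
    rw [← e, Submodule.coe_zero, smul_zero, monomial_zero])
  exact (sub_eq_zero.1 e2).symm

theorem IsDressing.poly_pos {Z : RapidDecay → PDO} {Z₀ : PDO} (hZ : IsDressing Z Z₀)
    (u g : RapidDecay) : IsPolyCurve fun ε : ℝ => (Z (u + ε • g)).pos := by
  obtain ⟨F', hF'⟩ := hZ.poly u g
  exact ⟨_, hF'.pos⟩

/-- The convention K_0 = 0 fits the general pattern, as (L^0)_+ = 1 and ∇1 = 0; this covers the
index l + r - 2 = 0. -/
theorem isFlowPair_flowK (m : ℕ) : IsFlowPair (laxPowPos m) (monomial 1 m) (flowK m) := by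
  rcases Nat.eq_zero_or_pos m with rfl | hm
  · have h1 : laxPowPos 0 = fun _ => 1 := by
      funext u
      rw [laxPowPos, pow_zero, pos_of_mem_diffOp (one_mem _)]
    rw [h1]
    refine ⟨fun u => one_mem _, fun u => ?_, fun u => ?_⟩
    · rw [Nat.cast_zero, ← one_def, sub_self]
      exact zero_mem _
    · simp [flowK, nabla_one, monomial_zero]
  · have h := (isIsospectralTriad_isoTriad m).isFlowPair
    have e : (isoTriad m).1 = laxPowPos m := opA_eq m
    rwa [e, show (isoTriad m).2 = flowK m by rw [flowK, if_neg (by omega)]] at h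

theorem isFlowPair_flowσ {m : ℕ} (hm : 1 ≤ m) :
    IsFlowPair (orlovPowPos m) (nonisoAsymp m) (flowσ m) := by
  have h := (isNonisospectralTriad_nonisoTriad hm).isFlowPair
  have e : (nonisoTriad m).1 = orlovPowPos m := opB_eq hm
  rwa [e, show (nonisoTriad m).2 = flowσ m by rw [flowσ, if_neg (by omega)]] at h

theorem flowK_zero : flowK 0 = 0 := if_pos rfl

theorem flowσ_zero : flowσ 0 = 0 := if_pos rfl

theorem isLieProduct_flowK_flowK (l r : ℕ) : IsLieProduct (flowK l) (flowK r) 0 := by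
  have h := (isFlowPair_flowK l).isLieProduct (isFlowPair_flowK r) (isFlowPair_flowK 0)
    (isDressing_laxL_pow l).poly_pos (isDressing_laxL_pow r).poly_pos
    (d_mem_multiplierOp _) (d_mem_multiplierOp _) 0 (by
      rw [← monomial_one_pow, ← monomial_one_pow, comm_eq, ← pow_add, ← pow_add, add_comm,
        sub_self, zero_smul])
  rwa [zero_smul] at h

theorem d_pow_mul_nonisoAsymp_one (l : ℕ) :
    monomial 1 1 ^ l * nonisoAsymp 1 =
      nonisoAsymp 1 * monomial 1 1 ^ l + (l : ℝ) • monomial 1 1 ^ (l - 1) := by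
  induction l with
  | zero => simp
  | succ l ih =>
    rcases Nat.eq_zero_or_pos l with rfl | hl
    · simp [d_mul_nonisoAsymp_one]
    · obtain ⟨j, rfl⟩ := Nat.exists_eq_add_of_le' hl
      rw [pow_succ', mul_assoc, ih, mul_add, ← mul_assoc, d_mul_nonisoAsymp_one, mul_smul_comm]
      simp only [Nat.add_sub_cancel, ← pow_succ', add_mul, one_mul, mul_assoc]
      push_cast
      simp only [add_smul, one_smul]
      abel

theorem isLieProduct_flowK_flowσ {l r : ℕ} (hl : 1 ≤ l) (hr : 1 ≤ r) :
    IsLieProduct (flowK l) (flowσ r) ((l : ℝ) • flowK (l + r - 2)) := by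
  refine (isFlowPair_flowK l).isLieProduct (isFlowPair_flowσ hr) (isFlowPair_flowK _)
    (isDressing_laxL_pow l).poly_pos (isDressing_orlov_mul hr).poly_pos
    (d_mem_multiplierOp _) (nonisoAsymp_mem_multiplierOp hr) _ ?_
  rw [← monomial_one_pow, ← monomial_one_pow, nonisoAsymp_eq hr, comm_eq, ← mul_assoc,
    d_pow_mul_nonisoAsymp_one, add_mul, mul_assoc, mul_assoc, ← pow_add, ← pow_add, smul_mul_assoc,
    ← pow_add, add_comm (r - 1) l, add_sub_cancel_left]
  congr 2
  omega

/-- With S = x + 2y∂, the product S∂^a S∂^b is S²∂^(a+b) + a S∂^(a+b-1), whose first term is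
symmetric in a and b. The bound 3 ≤ l + r keeps the index l + r - 2 positive. -/
theorem comm_nonisoAsymp {l r : ℕ} (hl : 1 ≤ l) (hr : 1 ≤ r) (h : 3 ≤ l + r) :
    comm (nonisoAsymp l) (nonisoAsymp r) = ((l : ℝ) - r) • nonisoAsymp (l + r - 2) := by
  obtain ⟨a, rfl⟩ := Nat.exists_eq_add_of_le' hl
  obtain ⟨b, rfl⟩ := Nat.exists_eq_add_of_le' hr
  have key : ∀ a b : ℕ, 1 ≤ a + b → nonisoAsymp (a + 1) * nonisoAsymp (b + 1) =
      nonisoAsymp 1 * nonisoAsymp 1 * monomial 1 1 ^ (a + b) +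
        (a : ℝ) • (nonisoAsymp 1 * monomial 1 1 ^ (a + b - 1)) := by
    intro a b hab
    rw [nonisoAsymp_succ a, nonisoAsymp_succ b, mul_assoc, ← mul_assoc (monomial 1 1 ^ a),
      d_pow_mul_nonisoAsymp_one, add_mul, mul_add, smul_mul_assoc, mul_smul_comm, ← pow_add,
      mul_assoc (nonisoAsymp 1) (monomial 1 1 ^ a), ← pow_add, mul_assoc]
    rcases Nat.eq_zero_or_pos a with rfl | ha
    · simp
    · rw [show a - 1 + b = a + b - 1 by omega]
  rw [comm_eq, key a b (by omega), key b a (by omega), show a + 1 + (b + 1) - 2 = (a + b - 1) + 1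
    by omega, nonisoAsymp_succ (a + b - 1), add_comm b a, add_sub_add_left_eq_sub, ← sub_smul]
  push_cast
  congr 1
  ring

theorem isLieProduct_flowσ_flowσ {l r : ℕ} (hl : 1 ≤ l) (hr : 1 ≤ r) :
    IsLieProduct (flowσ l) (flowσ r) (((l : ℝ) - (r : ℝ)) • flowσ (l + r - 2)) := by
  by_cases h : 3 ≤ l + r
  · exact (isFlowPair_flowσ hl).isLieProduct (isFlowPair_flowσ hr) (isFlowPair_flowσ (by omega))
      (isDressing_orlov_mul hl).poly_pos (isDressing_orlov_mul hr).poly_pos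
      (nonisoAsymp_mem_multiplierOp hl) (nonisoAsymp_mem_multiplierOp hr) _
      (comm_nonisoAsymp hl hr h)
  -- The case l = r = 1 would lead to index 0, which has no operator B; the commutator is zero
  -- there.
  · obtain rfl : l = 1 := by omega
    obtain rfl : r = 1 := by omega
    have h' := (isFlowPair_flowσ hl).isLieProduct (isFlowPair_flowσ hr) (isFlowPair_flowK 0)
      (isDressing_orlov_mul hl).poly_pos (isDressing_orlov_mul hr).poly_pos
      (nonisoAsymp_mem_multiplierOp hl) (nonisoAsymp_mem_multiplierOp hr) 0
      (by rw [comm_eq, sub_self, zero_smul])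
    rw [zero_smul] at h'
    rwa [sub_self, zero_smul]

/-! ### The Lie algebra spanned by the flows. -/

/-- The maps with a linear Gateaux derivative everywhere. -/
def GateauxMap : Submodule ℝ (RapidDecay → RapidDecay) where
  carrier := {f | ∀ u, ∃ d : RapidDecay →ₗ[ℝ] RapidDecay, ∀ g, HasGateaux f u g (d g)}
  zero_mem' u := ⟨0, fun g => hasGateaux_zero u g⟩
  add_mem' hf hf' u := by
    obtain ⟨d, hd⟩ := hf u
    obtain ⟨d', hd'⟩ := hf' u
    exact ⟨d + d', fun g => (hd g).add (hd' g)⟩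
  smul_mem' c _ hf u := by
    obtain ⟨d, hd⟩ := hf u
    exact ⟨c • d, fun g => (hd g).smul c⟩

theorem IsLieProduct.unique {f g h h' : RapidDecay → RapidDecay} (hh : IsLieProduct f g h)
    (hh' : IsLieProduct f g h') : h = h' := by
  funext u
  obtain ⟨a, b, ha, hb, e⟩ := hh u
  obtain ⟨a', b', ha', hb', e'⟩ := hh' u
  rw [e, e', ha.unique ha', hb.unique hb']

theorem IsLieProduct.symm {f g h : RapidDecay → RapidDecay} (hh : IsLieProduct f g h) :
    IsLieProduct g f (-h) := fun u => by
  obtain ⟨a, b, ha, hb, e⟩ := hh u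
  exact ⟨b, a, hb, ha, by rw [Pi.neg_apply, e, neg_sub]⟩

/-- The term g'[f] is additive in f because the derivative of g is linear in its direction. -/
theorem IsLieProduct.add_left {f f' g h h' : RapidDecay → RapidDecay} (hg : g ∈ GateauxMap)
    (hh : IsLieProduct f g h) (hh' : IsLieProduct f' g h') :
    IsLieProduct (f + f') g (h + h') := fun u => by
  obtain ⟨a, b, ha, hb, e⟩ := hh u
  obtain ⟨a', b', ha', hb', e'⟩ := hh' u
  obtain ⟨d, hd⟩ := hg u
  refine ⟨a + a', d (f u + f' u), ha.add ha', hd _, ?_⟩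
  rw [map_add, (hd _).unique hb, (hd _).unique hb', Pi.add_apply, e, e']
  abel

theorem IsLieProduct.smul_left {f g h : RapidDecay → RapidDecay} (hg : g ∈ GateauxMap) (c : ℝ)
    (hh : IsLieProduct f g h) : IsLieProduct (c • f) g (c • h) := fun u => by
  obtain ⟨a, b, ha, hb, e⟩ := hh u
  obtain ⟨d, hd⟩ := hg u
  refine ⟨c • a, d (c • f u), ha.smul c, hd _, ?_⟩
  rw [map_smul, (hd _).unique hb, Pi.smul_apply, e, smul_sub]

theorem IsLieProduct.zero_left {g : RapidDecay → RapidDecay} (hg : g ∈ GateauxMap) :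
    IsLieProduct 0 g 0 := fun u => by
  obtain ⟨d, hd⟩ := hg u
  exact ⟨0, d 0, hasGateaux_zero _ _, hd _, by rw [map_zero, sub_zero]; rfl⟩

theorem IsLieProduct.add_right {f g g' h h' : RapidDecay → RapidDecay} (hf : f ∈ GateauxMap)
    (hh : IsLieProduct f g h) (hh' : IsLieProduct f g' h') :
    IsLieProduct f (g + g') (h + h') := by
  have := (hh.symm.add_left hf hh'.symm).symm
  rwa [neg_add, neg_neg, neg_neg] at this

theorem IsLieProduct.smul_right {f g h : RapidDecay → RapidDecay} (hf : f ∈ GateauxMap) (c : ℝ)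
    (hh : IsLieProduct f g h) : IsLieProduct f (c • g) (c • h) := by
  have := (hh.symm.smul_left hf c).symm
  rwa [smul_neg, neg_neg] at this

theorem IsLieProduct.self {f : RapidDecay → RapidDecay} (hf : f ∈ GateauxMap) :
    IsLieProduct f f 0 := fun u => by
  obtain ⟨d, hd⟩ := hf u
  exact ⟨d (f u), d (f u), hd _, hd _, (sub_self _).symm⟩

theorem flowK_mem_gateauxMap (l : ℕ) : flowK l ∈ GateauxMap :=
  (isFlowPair_flowK l).exists_linear_gateaux (isDressing_laxL_pow l).poly_pos

theorem flowσ_mem_gateauxMap (r : ℕ) : flowσ r ∈ GateauxMap := by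
  rcases Nat.eq_zero_or_pos r with rfl | hr
  · rw [flowσ_zero]
    exact zero_mem _
  · exact (isFlowPair_flowσ hr).exists_linear_gateaux (isDressing_orlov_mul hr).poly_pos

theorem flowSpan_le : flowSpan ≤ GateauxMap := by
  refine Submodule.span_le.2 ?_
  rintro _ (⟨l, -, rfl⟩ | ⟨r, -, rfl⟩)
  · exact flowK_mem_gateauxMap l
  · exact flowσ_mem_gateauxMap r

theorem flowK_mem_flowSpan (l : ℕ) : flowK l ∈ flowSpan := by
  rcases Nat.eq_zero_or_pos l with rfl | hl
  · rw [flowK_zero]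
    exact zero_mem _
  · exact Submodule.subset_span (Or.inl ⟨l, hl, rfl⟩)

theorem flowσ_mem_flowSpan (r : ℕ) : flowσ r ∈ flowSpan := by
  rcases Nat.eq_zero_or_pos r with rfl | hr
  · rw [flowσ_zero]
    exact zero_mem _
  · exact Submodule.subset_span (Or.inr ⟨r, hr, rfl⟩)

theorem exists_isLieProduct {f g : RapidDecay → RapidDecay} (hf : f ∈ flowSpan)
    (hg : g ∈ flowSpan) : ∃ h ∈ flowSpan, IsLieProduct f g h := by
  induction hf using Submodule.span_induction with
  | zero => exact ⟨0, zero_mem _, IsLieProduct.zero_left (flowSpan_le hg)⟩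
  | add f f' _ _ ih ih' =>
    obtain ⟨h, hh, hl⟩ := ih
    obtain ⟨h', hh', hl'⟩ := ih'
    exact ⟨_, add_mem hh hh', hl.add_left (flowSpan_le hg) hl'⟩
  | smul c f _ ih =>
    obtain ⟨h, hh, hl⟩ := ih
    exact ⟨_, flowSpan.smul_mem c hh, hl.smul_left (flowSpan_le hg) c⟩
  | mem f hf =>
    have hf' : f ∈ GateauxMap := flowSpan_le (Submodule.subset_span hf)
    induction hg using Submodule.span_induction with
    | zero =>
      refine ⟨0, zero_mem _, ?_⟩
      simpa using (IsLieProduct.zero_left hf').symm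
    | add g g' _ _ ih ih' =>
      obtain ⟨h, hh, hl⟩ := ih
      obtain ⟨h', hh', hl'⟩ := ih'
      exact ⟨_, add_mem hh hh', hl.add_right hf' hl'⟩
    | smul c g _ ih =>
      obtain ⟨h, hh, hl⟩ := ih
      exact ⟨_, flowSpan.smul_mem c hh, hl.smul_right hf' c⟩
    | mem g hg =>
      rcases hf with ⟨l, hl, rfl⟩ | ⟨l, hl, rfl⟩ <;> rcases hg with ⟨r, hr, rfl⟩ | ⟨r, hr, rfl⟩
      · exact ⟨0, zero_mem _, isLieProduct_flowK_flowK l r⟩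
      · exact ⟨_, flowSpan.smul_mem _ (flowK_mem_flowSpan _), isLieProduct_flowK_flowσ hl hr⟩
      · exact ⟨_, neg_mem (flowSpan.smul_mem _ (flowK_mem_flowSpan _)),
          (isLieProduct_flowK_flowσ hr hl).symm⟩
      · exact ⟨_, flowSpan.smul_mem _ (flowσ_mem_flowSpan _), isLieProduct_flowσ_flowσ hl hr⟩

theorem exists_bracket : ∃ br : flowSpan →ₗ[ℝ] flowSpan →ₗ[ℝ] flowSpan,
    ∀ f g : flowSpan, IsLieProduct f g (br f g) := by
  choose br hbr hl using fun f g : flowSpan => exists_isLieProduct f.2 g.2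
  refine ⟨LinearMap.mk₂ ℝ (fun f g => ⟨br f g, hbr f g⟩) ?_ ?_ ?_ ?_, hl⟩
  · exact fun f f' g => Subtype.ext ((hl _ _).unique ((hl f g).add_left (flowSpan_le g.2) (hl f' g)))
  · exact fun c f g => Subtype.ext ((hl _ _).unique ((hl f g).smul_left (flowSpan_le g.2) c))
  · exact fun f g g' => Subtype.ext ((hl _ _).unique ((hl f g).add_right (flowSpan_le f.2) (hl f g')))
  · exact fun c f g => Subtype.ext ((hl _ _).unique ((hl f g).smul_right (flowSpan_le f.2) c))

/-- The Jacobi identity for a bilinear map may be checked on generators. -/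
theorem jacobi_of_span_eq_top {V : Type*} [AddCommGroup V] [Module ℝ V] (br : V →ₗ[ℝ] V →ₗ[ℝ] V)
    {s : Set V} (hs : Submodule.span ℝ s = ⊤)
    (h : ∀ a ∈ s, ∀ b ∈ s, ∀ c ∈ s, br a (br b c) + br b (br c a) + br c (br a b) = 0)
    (a b c : V) : br a (br b c) + br b (br c a) + br c (br a b) = 0 := by
  have h1 : ∀ a ∈ s, ∀ b ∈ s, ∀ c : V, br a (br b c) + br b (br c a) + br c (br a b) = 0 := by
    intro a ha b hb c
    have h0 := LinearMap.ext_on hs (f := (br a).comp (br b) + (br b).comp (br.flip a) +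
      br.flip (br a b)) (g := 0) fun c hc => h a ha b hb c hc
    exact LinearMap.congr_fun h0 c
  have h2 : ∀ a ∈ s, ∀ b c : V, br a (br b c) + br b (br c a) + br c (br a b) = 0 := by
    intro a ha b c
    have h0 := LinearMap.ext_on hs (f := (br a).comp (br.flip c) + br.flip (br c a) +
      (br c).comp (br a)) (g := 0) fun b hb => h1 a ha b hb c
    exact LinearMap.congr_fun h0 b
  have h0 := LinearMap.ext_on hs (f := br.flip (br b c) + (br b).comp (br c) +
    (br c).comp (br.flip b)) (g := 0) fun a ha => h2 a ha b c
  exact LinearMap.congr_fun h0 a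

/-- The Jacobi identity for a bracket with the structure constants of the flows. -/
theorem jacobi_of_structure_constants {V : Type*} [AddCommGroup V] [Module ℝ V]
    (br : V →ₗ[ℝ] V →ₗ[ℝ] V) (hself : ∀ f, br f f = 0) {K σ : ℕ → V} (hK0 : K 0 = 0)
    (hspan : Submodule.span ℝ ({f | ∃ l, 1 ≤ l ∧ f = K l} ∪ {f | ∃ r, 1 ≤ r ∧ f = σ r}) = ⊤)
    (hKK : ∀ l r, br (K l) (K r) = 0)
    (hKσ : ∀ l r, 1 ≤ l → 1 ≤ r → br (K l) (σ r) = (l : ℝ) • K (l + r - 2))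
    (hσσ : ∀ l r, 1 ≤ l → 1 ≤ r → br (σ l) (σ r) = ((l : ℝ) - r) • σ (l + r - 2)) (f g h : V) :
    br f (br g h) + br g (br h f) + br h (br f g) = 0 := by
  have hsymm : ∀ f g, br f g = -br g f := fun f g => by
    have h1 := hself (f + g)
    simp only [map_add, LinearMap.add_apply, hself, zero_add, add_zero] at h1
    exact neg_eq_iff_eq_neg.1 (neg_eq_of_add_eq_zero_left h1)
  have hKσ' : ∀ l r, 1 ≤ r → br (K l) (σ r) = (l : ℝ) • K (l + r - 2) := by
    intro l r hr
    rcases Nat.eq_zero_or_pos l with rfl | hl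
    · simp [hK0]
    · exact hKσ l r hl hr
  have hKσσ : ∀ l r t, 1 ≤ l → 1 ≤ r → 1 ≤ t →
      br (K l) (br (σ r) (σ t)) + br (σ r) (br (σ t) (K l)) + br (σ t) (br (K l) (σ r)) = 0 := by
    intro l r t hl hr ht
    have e1 : br (K l) (br (σ r) (σ t)) = (((r : ℝ) - t) * l) • K (l + r + t - 4) := by
      rw [hσσ r t hr ht, map_smul]
      -- For r = t = 1 the inner product involves σ 0, outside the range of the structure constants,
      -- but its coefficient r - t is zero.
      by_cases hrt : r + t = 2
      · have : (r : ℝ) - t = 0 := by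
          rw [show r = 1 by omega, show t = 1 by omega, sub_self]
        rw [this, zero_smul, zero_mul, zero_smul]
      · rw [hKσ' l _ (by omega), smul_smul, show l + (r + t - 2) - 2 = l + r + t - 4 by omega]
    have e2 : ∀ r t : ℕ, 1 ≤ r → 1 ≤ t → br (σ t) (br (K l) (σ r)) =
        -(((l : ℝ) * (l + r - 2)) • K (l + r + t - 4)) := by
      intro r t hr ht
      rw [hKσ' l r hr, map_smul, hsymm, hKσ' _ t ht, smul_neg, smul_smul, Nat.cast_sub (by omega)]
      by_cases hlrt : l + r = 2
      · have : (l : ℝ) + r - 2 = 0 := by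
          rw [show l = 1 by omega, show r = 1 by omega]
          norm_num
        push_cast
        rw [this, mul_zero, zero_smul, zero_smul]
      · rw [show l + r - 2 + t - 2 = l + r + t - 4 by omega]
        push_cast
        rfl
    rw [e1, hsymm (σ t) (K l), map_neg, e2 t r ht hr, e2 r t hr ht,
      show l + t + r - 4 = l + r + t - 4 by omega, neg_neg, ← sub_eq_add_neg, ← add_smul,
      ← sub_smul, show ((r : ℝ) - t) * l + l * (l + t - 2) - l * (l + r - 2) = 0 by ring,
      zero_smul]
  have hσσσ : ∀ l r t, 1 ≤ l → 1 ≤ r → 1 ≤ t →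
      br (σ l) (br (σ r) (σ t)) + br (σ r) (br (σ t) (σ l)) + br (σ t) (br (σ l) (σ r)) = 0 := by
    intro l r t hl hr ht
    have e : ∀ a b c : ℕ, 1 ≤ a → 1 ≤ b → 1 ≤ c → br (σ a) (br (σ b) (σ c)) =
        (((b : ℝ) - c) * (a - (b + c - 2))) • σ (a + b + c - 4) := by
      intro a b c ha hb hc
      rw [hσσ b c hb hc, map_smul]
      by_cases hbc : b + c = 2
      · have : (b : ℝ) - c = 0 := by
          rw [show b = 1 by omega, show c = 1 by omega, sub_self]
        rw [this, zero_smul, zero_mul, zero_smul]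
      · rw [hσσ a _ ha (by omega), smul_smul, Nat.cast_sub (by omega),
          show a + (b + c - 2) - 2 = a + b + c - 4 by omega]
        push_cast
        rfl
    rw [e l r t hl hr ht, e r t l hr ht hl, e t l r ht hl hr,
      show r + t + l - 4 = l + r + t - 4 by omega, show t + l + r - 4 = l + r + t - 4 by omega,
      ← add_smul, ← add_smul]
    convert zero_smul ℝ _ using 2
    ring
  refine jacobi_of_span_eq_top br hspan ?_ f g h
  rintro _ (⟨l, hl, rfl⟩ | ⟨l, hl, rfl⟩) _ (⟨r, hr, rfl⟩ | ⟨r, hr, rfl⟩)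
    _ (⟨t, ht, rfl⟩ | ⟨t, ht, rfl⟩)
  · simp [hKK]
  · rw [hsymm (σ t) (K l)]
    simp [hKK, hKσ' _ t ht]
  · rw [hsymm (σ r) (K t)]
    simp [hKK, hKσ' _ r hr]
  · exact hKσσ l r t hl hr ht
  · rw [hsymm (σ l) (K r)]
    simp [hKK, hKσ' _ l hl]
  -- The mixed cases with K in another position are cyclic permutations of `hKσσ`.
  · rw [← hKσσ r t l hr ht hl]
    abel
  · rw [← hKσσ t l r ht hl hr]
    abel
  · exact hσσσ l r t hl hr ht

theorem span_flows_eq_top : Submodule.span ℝ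
    ({f : flowSpan | ∃ l, 1 ≤ l ∧ f = ⟨flowK l, flowK_mem_flowSpan l⟩} ∪
      {f : flowSpan | ∃ r, 1 ≤ r ∧ f = ⟨flowσ r, flowσ_mem_flowSpan r⟩}) = ⊤ := by
  refine Eq.trans (congrArg _ (Set.ext fun f => ?_)) (Submodule.span_span_coe_preimage (R := ℝ)
    (s := {f | ∃ l, 1 ≤ l ∧ f = flowK l} ∪ {f | ∃ r, 1 ≤ r ∧ f = flowσ r}))
  simp only [Set.mem_union, Set.mem_ofPred_eq, Subtype.ext_iff]
  rfl

theorem exists_lieAlgebra : ∃ br : flowSpan →ₗ[ℝ] flowSpan →ₗ[ℝ] flowSpan,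
    (∀ f g : flowSpan, IsLieProduct f g (br f g)) ∧
    (∀ f : flowSpan, br f f = 0) ∧
    (∀ f g h : flowSpan, br f (br g h) + br g (br h f) + br h (br f g) = 0) := by
  obtain ⟨br, hbr⟩ := exists_bracket
  have hself : ∀ f : flowSpan, br f f = 0 := fun f =>
    Subtype.ext ((hbr f f).unique (IsLieProduct.self (flowSpan_le f.2)))
  refine ⟨br, hbr, hself, jacobi_of_structure_constants br hself (Subtype.ext flowK_zero)
    span_flows_eq_top ?_ ?_ ?_⟩
  · exact fun l r => Subtype.ext ((hbr _ _).unique (isLieProduct_flowK_flowK l r))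
  · exact fun l r hl hr => Subtype.ext ((hbr _ _).unique (isLieProduct_flowK_flowσ hl hr))
  · exact fun l r hl hr => Subtype.ext ((hbr _ _).unique (isLieProduct_flowσ_flowσ hl hr))

theorem flowK_apply_zero (m : ℕ) : flowK m 0 = 0 := by
  refine eq_of_monomial_two_smul_eq ?_
  have h : laxPowPos m 0 = monomial 1 1 ^ m := by
    rw [laxPowPos, (isDressing_laxL_pow m).apply_zero
      (by rw [← monomial_one_pow]; exact nabla_zero_d_pow m),
      pos_of_mem_diffOp (monomial_mem_diffOp _ (by omega)), monomial_one_pow]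
  rw [← (isFlowPair_flowK m).nabla_eq, h, nabla_zero_d_pow, Submodule.coe_zero, smul_zero,
    monomial_zero]

theorem flowσ_apply_zero {m : ℕ} (hm : 1 ≤ m) : flowσ m 0 = 0 := by
  refine eq_of_monomial_two_smul_eq ?_
  have h : orlovPowPos m 0 = nonisoAsymp m := by
    rw [orlovPowPos, (isDressing_orlov_mul hm).apply_zero (nabla_zero_nonisoAsymp hm),
      pos_of_mem_diffOp (nonisoAsymp_mem_diffOp hm)]
  rw [← (isFlowPair_flowσ hm).nabla_eq, h, nabla_zero_nonisoAsymp hm, Submodule.coe_zero, smul_zero,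
    monomial_zero]

end Flows

end KP

end

theorem mainTheorem10 :
    -- `L` is uniquely determined by `u`
    (∃! L : KP.RapidDecay → KP.PDO, KP.IsLaxOperator L) ∧
    -- the isospectral and non-isospectral Lax triads uniquely determine the operators and flows
    (∀ m : ℕ, 1 ≤ m →
      ∃! q : (KP.RapidDecay → KP.PDO) × (KP.RapidDecay → KP.RapidDecay),
        KP.IsIsospectralTriad m KP.laxL q.1 q.2) ∧
    (∀ m : ℕ, 1 ≤ m →
      ∃! q : (KP.RapidDecay → KP.PDO) × (KP.RapidDecay → KP.RapidDecay),
        KP.IsNonisospectralTriad m KP.laxL q.1 q.2) ∧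
    -- `A_m = (L^m)_+`
    (∀ m : ℕ, 1 ≤ m → ∀ u : KP.RapidDecay, KP.opA m u = ((KP.laxL u).pow m).pos) ∧
    -- zero curvature representations, with their asymptotic data
    (∀ m : ℕ, 1 ≤ m →
      (∀ u : KP.RapidDecay, KP.PDO.monomial ((2 : ℝ) • (KP.flowK m u).1) 0 =
        (KP.opA m u).dy - KP.PDO.comm (KP.A₂ u) (KP.opA m u)) ∧
      KP.flowK m 0 = 0 ∧ KP.opA m 0 = KP.PDO.monomial 1 m) ∧
    (∀ m : ℕ, 1 ≤ m →
      (∀ u : KP.RapidDecay, KP.PDO.monomial ((2 : ℝ) • (KP.flowσ m u).1) 0 =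
        (KP.opB m u).dy - KP.PDO.comm (KP.A₂ u) (KP.opB m u)) ∧
      KP.flowσ m 0 = 0 ∧ KP.opB m 0 = KP.nonisoAsymp m) ∧
    -- the basic structure
    (∀ l r : ℕ, 1 ≤ l → 1 ≤ r →
      KP.IsLieProduct (KP.flowK l) (KP.flowK r) 0 ∧
      KP.IsLieProduct (KP.flowK l) (KP.flowσ r) ((l : ℝ) • KP.flowK (l + r - 2)) ∧
      KP.IsLieProduct (KP.flowσ l) (KP.flowσ r) (((l : ℝ) - (r : ℝ)) • KP.flowσ (l + r - 2))) ∧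
    -- the span of the flows is closed under the Lie product, and is a Lie algebra with it
    (∃ br : KP.flowSpan →ₗ[ℝ] KP.flowSpan →ₗ[ℝ] KP.flowSpan,
      (∀ f g : KP.flowSpan, KP.IsLieProduct f g (br f g)) ∧
      (∀ f : KP.flowSpan, br f f = 0) ∧
      (∀ f g h : KP.flowSpan, br f (br g h) + br g (br h f) + br h (br f g) = 0)) := by
  refine ⟨⟨KP.laxL, KP.isLaxOperator_laxL, fun L hL => hL.unique KP.isLaxOperator_laxL⟩,
    fun m _ => ?_, fun m hm => ?_, fun m _ u => ?_, fun m _ => ⟨fun u => ?_, ?_, ?_⟩,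
    fun m hm => ⟨fun u => ?_, ?_, ?_⟩, fun l r hl hr => ⟨?_, ?_, ?_⟩, KP.exists_lieAlgebra⟩
  · refine ⟨KP.isoTriad m, KP.isIsospectralTriad_isoTriad m, fun q hq => ?_⟩
    exact Prod.ext_iff.2 (hq.isFlowPair.unique (KP.isIsospectralTriad_isoTriad m).isFlowPair)
  · refine ⟨KP.nonisoTriad m, KP.isNonisospectralTriad_nonisoTriad hm, fun q hq => ?_⟩
    exact Prod.ext_iff.2
      (hq.isFlowPair.unique (KP.isNonisospectralTriad_nonisoTriad hm).isFlowPair)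
  · rw [KP.opA_eq, KP.PDO.pow_eq, KP.laxPowPos]
  · rw [KP.opA_eq, ← KP.nabla_apply, (KP.isFlowPair_flowK m).nabla_eq]
  · exact KP.flowK_apply_zero m
  · exact (KP.isIsospectralTriad_isoTriad m).asymptotics.at_zero
  · rw [KP.opB_eq hm, ← KP.nabla_apply, (KP.isFlowPair_flowσ hm).nabla_eq]
  · exact KP.flowσ_apply_zero hm
  · exact (KP.isNonisospectralTriad_nonisoTriad hm).asymptotics.at_zero
  · exact KP.isLieProduct_flowK_flowK l r
  · exact KP.isLieProduct_flowK_flowσ hl hr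
  · exact KP.isLieProduct_flowσ_flowσ hl hr
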